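/- Let $M$ be a complex manifold of dimension $n$. Throughout, $\partial_k=\partial/\partial z^k$, $\bar\partial_l=\partial/\partial\bar z^l$ in local holomorphic coordinates, and repeated indices are summed. For a tensor $T^{\bar lk}$ defining the bivector field $\eta=iT^{\bar lk}\partial_k\wedge\bar\partial_l$ on $M$, with bracket $\{f,h\}=iT^{\bar lk}(\partial_kf\,\bar\partial_lh-\partial_kh\,\bar\partial_lf)$, a family $C_0,\dots,C_N$ of bidifferential operators is called a star-product up to order $N$ if $C_0(f,h)=fh$, $C_1(f,h)-C_1(h,f)=i\{f,h\}$, the constant $1$ is a unit of $f\ast h=\sum_{r\le N}\nu^rC_r(f,h)$, and $\ast$, extended $\nu$-bilinearly, is associative when $\nu^{N+1}=0$ (on functions on any open subset of $M$). It has separation of variables if $a\ast f=af$ and $f\ast b=fb$ for all local smooth $f$, holomorphic $a$ and antiholomorphic $b$. A regular expression is a finite sum $\sum a_{\alpha\beta}\,(\partial_\alpha\phi)(\partial_\beta\psi)$ of products of iterated partial derivatives (holomorphic and antiholomorphic) of $\phi$ and $\psi$ whose coefficients $a_{\alpha\beta}$ are fixed polynomials in the partial derivatives of the components $T^{\bar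 lk}$; it is covariant on $(M,T)$ if its value does not depend on the choice of holomorphic coordinates. Let $g_{k\bar l}$ be a Kähler metric with Kähler form $-ig_{k\bar l}dz^k\wedge d\bar z^l$, inverse $g^{\bar lk}$, Christoffel symbols $\Gamma^s_{kp}=(\partial_pg_{k\bar t})g^{\bar ts}$, $\Gamma^{\bar t}_{\bar l\bar q}=g^{\bar ts}\bar\partial_lg_{s\bar q}$, covariant derivatives $\phi_{/\bar l\bar q\dots}$, $\psi_{/kp\dots}$, and curvature $R^p_{mk\bar l}=-\bar\partial_l\Gamma^p_{mk}$, $R^{\bar qp}_{k\bar l}=g^{\bar qm}R^p_{mk\bar l}$, $R^{\bar lk\bar qp}=g^{\bar lm}g^{\bar rk}R^{\bar qp}_{m\bar r}$. Put $$C_1(\phi,\psi)=g^{\bar lk}\phi_{/\bar l}\psi_{/k},\qquad C_2(\phi,\psi)=\tfrac12g^{\bar lk}g^{\bar qp}\phi_{/\bar l\bar q}\psi_{/kp},$$ $$C_3(\phi,\psi)=\tfrac16g^{\bar lk}g^{\bar qp}g^{\bar ts}\phi_{/\bar l\bar q\bar t}\psi_{/kps}+\tfrac14R^{\bar lk\bar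 qp}\phi_{/\bar l\bar q}\psi_{/kp},\qquad R(\phi,\psi)=g^{\bar nm}R^{\bar lp}_{m\bar q}R^{\bar qk}_{p\bar n}\phi_{/\bar l}\psi_{/k},$$ and $\tilde C_3=C_3+\tfrac1{12}R$. Then for every $n$ there are regular expressions $D_0,D_1,D_2,D_3$, depending only on $n$, such that: (1) For every Kähler manifold $(M,g)$ of dimension $n$, in every holomorphic chart, the values of $D_0,D_1,D_2,D_3$ on $T^{\bar lk}=g^{\bar lk}$ are $\phi\psi$, $C_1$, $C_2$, $\tilde C_3$. The tensor $g^{\bar lk}$ defines a Poisson bivector field of type $(1,1)$, and $\phi\,\tilde\ast\,\psi=\phi\psi+\nu C_1(\phi,\psi)+\nu^2C_2(\phi,\psi)+\nu^3\tilde C_3(\phi,\psi)$ is a covariant associative star-product with separation of variables up to the third order on $M$. Moreover $C_1,C_2,C_3$ are the operators of the standard deformation quantization with separation of variables: for every local potential $\Phi$ with $g_{k\bar l}=\partial_k\bar\partial_l\Phi$, the operators $A_0=\phi$ and $A_r=C_r(\phi,\cdot)$ satisfy $A_r1=0$ for $1\le r\le 3$, commute with multiplication by every $\bar z^l$, and satisfy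 $[A_r,\bar\partial_l\Phi]=[\bar\partial_l,A_{r-1}]$ for $1\le r\le3$. (2) For every complex manifold $M$ of dimension $n$ with a (possibly degenerate) Poisson bivector field $\eta=iT^{\bar lk}\partial_k\wedge\bar\partial_l$ of type $(1,1)$, the same expressions $D_0,\dots,D_3$, evaluated on $T$, define a covariant associative star-product with separation of variables up to the third order on $M$; here $D_1=T^{\bar lk}(\bar\partial_l\phi)(\partial_k\psi)$ and $$D_2=\tfrac12\big(T^{\bar qp}T^{\bar lk}(\bar\partial_l\bar\partial_q\phi)(\partial_k\partial_p\psi)+T^{\bar qp}(\partial_pT^{\bar lk})(\bar\partial_l\bar\partial_q\phi)(\partial_k\psi)+(\bar\partial_lT^{\bar qp})T^{\bar lk}(\bar\partial_q\phi)(\partial_k\partial_p\psi)+(\bar\partial_lT^{\bar qp})(\partial_pT^{\bar lk})(\bar\partial_q\phi)(\partial_k\psi)\big).$$ -/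

import Mathlib

open scoped ContDiff Manifold ComplexOrder
open Complex

noncomputable section

/-! ### Wirtinger calculus on `ℂⁿ` -/

/-- The coordinate space `ℂⁿ`. -/
abbrev Cn (n : ℕ) : Type := Fin n → ℂ

/-- `∂_k = ∂/∂z^k = (∂/∂x^k - i ∂/∂y^k) / 2`. -/
def dz {n : ℕ} (k : Fin n) (f : Cn n → ℂ) (z : Cn n) : ℂ :=
  (fderiv ℝ f z (Pi.single k 1) - I * fderiv ℝ f z (Pi.single k I)) / 2

/-- `∂̄_l = ∂/∂z̄^l = (∂/∂x^l + i ∂/∂y^l) / 2`. -/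
def dzbar {n : ℕ} (l : Fin n) (f : Cn n → ℂ) (z : Cn n) : ℂ :=
  (fderiv ℝ f z (Pi.single l 1) + I * fderiv ℝ f z (Pi.single l I)) / 2

/-- Directions of partial derivatives: `Sum.inl k` is `∂_k`, `Sum.inr l` is `∂̄_l`. -/
abbrev Dir (n : ℕ) : Type := Fin n ⊕ Fin n

/-- Iterated partial derivative along a list of directions. -/
def partials {n : ℕ} : List (Dir n) → (Cn n → ℂ) → Cn n → ℂ
  | [], f => f
  | Sum.inl k :: ds, f => dz k (partials ds f)
  | Sum.inr l :: ds, f => dzbar l (partials ds f)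

/-! ### Complex manifolds, smooth functions, tensors of type (1,1) in components

A complex manifold of dimension `n` is a space `M` with `[ChartedSpace (Cn n) M]` and
`[IsManifold 𝓘(ℂ, Cn n) ω M]`; its holomorphic charts are the members of the maximal atlas. -/

section Manifold

variable {n : ℕ} {M : Type*} [TopologicalSpace M] [ChartedSpace (Cn n) M]

/-- `e` is a holomorphic coordinate chart of the complex manifold `M`. -/
def IsHolChart (e : OpenPartialHomeomorph M (Cn n)) : Prop :=
  e ∈ IsManifold.maximalAtlas 𝓘(ℂ, Cn n) ω M

variable (n) in
/-- `f` is a `C^∞` (in the real sense) complex valued function on the set `U`. -/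
def SmoothOn (f : M → ℂ) (U : Set M) : Prop :=
  ContMDiffOn 𝓘(ℝ, Cn n) 𝓘(ℝ, ℂ) ∞ f U

variable (n) in
/-- `f` is holomorphic on `U`. -/
def HolOn (f : M → ℂ) (U : Set M) : Prop :=
  MDifferentiableOn 𝓘(ℂ, Cn n) 𝓘(ℂ, ℂ) f U

variable (n M) in
/-- Components of a tensor with one holomorphic and one antiholomorphic index: for every
chart `e` a matrix valued function of the coordinates (only charts in the maximal atlas and
points of `e.target` matter). -/
abbrev ChartTensor : Type _ :=
  OpenPartialHomeomorph M (Cn n) → Cn n → Matrix (Fin n) (Fin n) ℂ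

/-- The holomorphic Jacobian `∂z'^a / ∂z^k` at `x` of the change from the chart `e`
(coordinates `z`) to the chart `e'` (coordinates `z'`). -/
def jacobian (e e' : OpenPartialHomeomorph M (Cn n)) (x : M) (a k : Fin n) : ℂ :=
  fderiv ℂ (fun z => e' (e.symm z)) (e x) (Pi.single k 1) a

/-- `g` is a Kähler metric: `g e z k l` is the component `g_{k l̄}` in the chart `e`, and the
form `ω = -i g_{k l̄} dz^k ∧ dz̄^l` is closed. -/
structure IsKahlerMetric (g : ChartTensor n M) : Prop where
  smooth : ∀ e : OpenPartialHomeomorph M (Cn n), IsHolChart e → ∀ k l : Fin n,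
    ContDiffOn ℝ ∞ (fun z => g e z k l) e.target
  transform : ∀ e e' : OpenPartialHomeomorph M (Cn n), IsHolChart e → IsHolChart e' →
    ∀ x ∈ e.source ∩ e'.source, ∀ k l : Fin n,
      g e (e x) k l = ∑ a, ∑ b,
        g e' (e' x) a b * jacobian e e' x a k * (starRingEnd ℂ) (jacobian e e' x b l)
  posDef : ∀ e : OpenPartialHomeomorph M (Cn n), IsHolChart e → ∀ z ∈ e.target, (g e z).PosDef
  closed : ∀ e : OpenPartialHomeomorph M (Cn n), IsHolChart e → ∀ z ∈ e.target,
    ∀ k m l : Fin n,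
      dz m (fun w => g e w k l) z = dz k (fun w => g e w m l) z ∧
      dzbar m (fun w => g e w l k) z = dzbar k (fun w => g e w l m) z

/-- The inverse tensor: `inverseTensor g e z l k` is `g^{l̄ k}`, with
`g^{l̄ k} g_{k n̄} = δ^l_n`. -/
def inverseTensor (g : ChartTensor n M) : ChartTensor n M := fun e z => (g e z)⁻¹

/-- The bracket `{f, h} = ⟨η, df ∧ dh⟩` of the bivector `η = i T^{l̄ k} ∂_k ∧ ∂̄_l`, where
`T e z l k` is the component `T^{l̄ k}`; computed at `x` in the preferred chart at `x`. -/
def bracket (T : ChartTensor n M) (f h : M → ℂ) (x : M) : ℂ :=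
  let e := chartAt (Cn n) x
  I * ∑ l, ∑ k, T e (e x) l k *
    (dz k (f ∘ e.symm) (e x) * dzbar l (h ∘ e.symm) (e x)
      - dz k (h ∘ e.symm) (e x) * dzbar l (f ∘ e.symm) (e x))

/-- `T` is a (possibly degenerate) Poisson bivector field of type (1,1):
`η = i T^{l̄ k} ∂_k ∧ ∂̄_l` is a smooth bivector field whose bracket satisfies the Jacobi
identity. -/
structure IsPoissonBivector (T : ChartTensor n M) : Prop where
  smooth : ∀ e : OpenPartialHomeomorph M (Cn n), IsHolChart e → ∀ l k : Fin n,
    ContDiffOn ℝ ∞ (fun z => T e z l k) e.target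
  transform : ∀ e e' : OpenPartialHomeomorph M (Cn n), IsHolChart e → IsHolChart e' →
    ∀ x ∈ e.source ∩ e'.source, ∀ b a : Fin n,
      T e' (e' x) b a = ∑ l, ∑ k,
        (starRingEnd ℂ) (jacobian e e' x b l) * jacobian e e' x a k * T e (e x) l k
  jacobi : ∀ U : Set M, IsOpen U → ∀ f g h : M → ℂ,
    SmoothOn n f U → SmoothOn n g U → SmoothOn n h U → ∀ x ∈ U,
      bracket T f (bracket T g h) x + bracket T g (bracket T h f) x
        + bracket T h (bracket T f g) x = 0

/-! ### Star-products up to order `N` -/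

/-- `C` is a bidifferential operator on `M`: in every holomorphic chart it is a finite sum of
products of partial derivatives of its arguments with smooth coefficients. It acts on local
functions, that is, on functions smooth on an open set `U`. -/
def IsBidifferential (C : (M → ℂ) → (M → ℂ) → M → ℂ) : Prop :=
  ∀ e : OpenPartialHomeomorph M (Cn n), IsHolChart e →
    ∃ c : (List (Dir n) × List (Dir n)) →₀ (Cn n → ℂ),
      (∀ i, ContDiffOn ℝ ∞ (c i) e.target) ∧
      ∀ U : Set M, IsOpen U → ∀ f h : M → ℂ, SmoothOn n f U → SmoothOn n h U →
        ∀ x ∈ U ∩ e.source,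
          C f h x = c.sum fun i a =>
            a (e x) * partials i.1 (f ∘ e.symm) (e x) * partials i.2 (h ∘ e.symm) (e x)

/-- The `ν`-bilinear extension of `f ∗ h = ∑ ν^r C_r(f, h)` to formal series in `ν`
(sequences of coefficients): the coefficient of `ν^k` of `F ∗ H`. -/
def starSeries (C : ℕ → (M → ℂ) → (M → ℂ) → M → ℂ) (F H : ℕ → M → ℂ) (k : ℕ) (x : M) : ℂ :=
  ∑ p ∈ Finset.HasAntidiagonal.antidiagonal k, ∑ q ∈ Finset.HasAntidiagonal.antidiagonal p.2, C p.1 (F q.1) (H q.2) x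

/-- `f ∗ h = ∑_{r ≤ N} ν^r C_r(f, h)` is a star-product up to order `N` (that is, for
`ν^{N+1} = 0`) for the bivector `i T^{l̄ k} ∂_k ∧ ∂̄_l`. -/
structure IsStarProductUpTo (N : ℕ) (T : ChartTensor n M)
    (C : ℕ → (M → ℂ) → (M → ℂ) → M → ℂ) : Prop where
  bidifferential : ∀ r ≤ N, IsBidifferential (n := n) (C r)
  zeroth : ∀ U : Set M, IsOpen U → ∀ f h : M → ℂ, SmoothOn n f U → SmoothOn n h U →
    ∀ x ∈ U, C 0 f h x = f x * h x
  first : 1 ≤ N → ∀ U : Set M, IsOpen U → ∀ f h : M → ℂ, SmoothOn n f U → SmoothOn n h U →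
    ∀ x ∈ U, C 1 f h x - C 1 h f x = I * bracket T f h x
  unit : ∀ U : Set M, IsOpen U → ∀ f : M → ℂ, SmoothOn n f U → ∀ r, 1 ≤ r → r ≤ N →
    ∀ x ∈ U, C r (fun _ => 1) f x = 0 ∧ C r f (fun _ => 1) x = 0
  assoc : ∀ U : Set M, IsOpen U → ∀ F G H : ℕ → M → ℂ,
    (∀ i, SmoothOn n (F i) U) → (∀ i, SmoothOn n (G i) U) → (∀ i, SmoothOn n (H i) U) →
    ∀ k ≤ N, ∀ x ∈ U,
      starSeries C (starSeries C F G) H k x = starSeries C F (starSeries C G H) k x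

variable (n) in
/-- Separation of variables up to order `N`: `a ∗ f = a f` and `f ∗ b = f b` for local
functions `f`, holomorphic `a` and antiholomorphic `b`. -/
def HasSeparationOfVariablesUpTo (N : ℕ) (C : ℕ → (M → ℂ) → (M → ℂ) → M → ℂ) : Prop :=
  ∀ U : Set M, IsOpen U → ∀ a b f : M → ℂ, HolOn n a U →
    HolOn n (fun x => (starRingEnd ℂ) (b x)) U → SmoothOn n f U →
    ∀ r, 1 ≤ r → r ≤ N → ∀ x ∈ U, C r a f x = 0 ∧ C r f b x = 0

end Manifold

/-! ### Regular operators -/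

/-- A regular bidifferential expression in dimension `n`: finitely many pairs of iterated
derivatives (of the first and of the second argument), each with a coefficient that is a
polynomial in the partial derivatives `∂_γ T^{l̄ k}` of the components of a tensor; the
variable `(l, k, γ)` stands for `∂_γ T^{l̄ k}`. -/
abbrev RegularOp (n : ℕ) : Type :=
  (List (Dir n) × List (Dir n)) →₀ MvPolynomial (Fin n × Fin n × List (Dir n)) ℂ

namespace RegularOp

variable {n : ℕ}

/-- The value in coordinates of a regular expression on the tensor `T` and the functions
`φ, ψ`. -/
def eval (D : RegularOp n) (T : Cn n → Matrix (Fin n) (Fin n) ℂ) (φ ψ : Cn n → ℂ)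
    (z : Cn n) : ℂ :=
  D.sum fun i a =>
    MvPolynomial.eval (fun v => partials v.2.2 (fun w => T w v.1 v.2.1) z) a
      * partials i.1 φ z * partials i.2 ψ z

variable {M : Type*} [TopologicalSpace M] [ChartedSpace (Cn n) M]

/-- The operator on `M` given by a regular expression, computed at each point in the preferred
chart at that point. -/
def toOperator (D : RegularOp n) (T : ChartTensor n M) (f h : M → ℂ) (x : M) : ℂ :=
  let e := chartAt (Cn n) x
  D.eval (T e) (f ∘ e.symm) (h ∘ e.symm) (e x)

/-- The regular expression `D` is covariant on `(M, T)`: it gives the same value in all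
holomorphic charts. -/
def IsCovariant (D : RegularOp n) (T : ChartTensor n M) : Prop :=
  ∀ U : Set M, IsOpen U → ∀ f h : M → ℂ, SmoothOn n f U → SmoothOn n h U →
    ∀ e : OpenPartialHomeomorph M (Cn n), IsHolChart e → ∀ x ∈ U ∩ e.source,
      D.eval (T e) (f ∘ e.symm) (h ∘ e.symm) (e x) = D.toOperator T f h x

end RegularOp

/-- The regular expressions `D 0, …, D 3` define on `M`, with the bivector
`i T^{l̄ k} ∂_k ∧ ∂̄_l`, a covariant associative star-product with separation of variables up to
the third order. -/
structure DefinesStarProduct {n : ℕ} {M : Type*} [TopologicalSpace M] [ChartedSpace (Cn n) M]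
    (D : ℕ → RegularOp n) (T : ChartTensor n M) : Prop where
  covariant : ∀ r ≤ 3, (D r).IsCovariant T
  star : IsStarProductUpTo 3 T (fun r => (D r).toOperator T)
  separation : HasSeparationOfVariablesUpTo n 3 (fun r => (D r).toOperator (M := M) T)

/-! ### The operators `C_1`, `C_2` of a Poisson tensor in coordinates -/

section Coordinates

variable {n : ℕ}

/-- `C_1(φ, ψ) = T^{l̄ k} (∂̄_l φ)(∂_k ψ)`. -/
def poissonC1 (T : Cn n → Matrix (Fin n) (Fin n) ℂ) (φ ψ : Cn n → ℂ) (z : Cn n) : ℂ :=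
  ∑ l, ∑ k, T z l k * dzbar l φ z * dz k ψ z

/-- `C_2` in terms of a Poisson tensor. -/
def poissonC2 (T : Cn n → Matrix (Fin n) (Fin n) ℂ) (φ ψ : Cn n → ℂ) (z : Cn n) : ℂ :=
  (1 / 2) * ∑ l, ∑ k, ∑ q, ∑ p,
    (T z q p * T z l k * dzbar l (dzbar q φ) z * dz k (dz p ψ) z
      + T z q p * dz p (fun w => T w l k) z * dzbar l (dzbar q φ) z * dz k ψ z
      + dzbar l (fun w => T w q p) z * T z l k * dzbar q φ z * dz k (dz p ψ) z
      + dzbar l (fun w => T w q p) z * dz p (fun w => T w l k) z * dzbar q φ z * dz k ψ z)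

/-! ### Kähler geometry in coordinates

Here `g z k l` is `g_{k l̄}` and `(g z)⁻¹ l k` is `g^{l̄ k}`. -/

variable (g : Cn n → Matrix (Fin n) (Fin n) ℂ)

/-- Christoffel symbols `Γ^s_{kp} = (∂_p g_{k t̄}) g^{t̄ s}`. -/
def christoffel (s k p : Fin n) (z : Cn n) : ℂ :=
  ∑ t, dz p (fun w => g w k t) z * (g z)⁻¹ t s

/-- Christoffel symbols `Γ^{t̄}_{l̄ q̄} = g^{t̄ s} (∂̄_l g_{s q̄})`. -/
def christoffelBar (t l q : Fin n) (z : Cn n) : ℂ :=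
  ∑ s, (g z)⁻¹ t s * dzbar l (fun w => g w s q) z

/-- Second covariant derivative `ψ_{/kp}`. -/
def cov2 (ψ : Cn n → ℂ) (k p : Fin n) (z : Cn n) : ℂ :=
  dz p (dz k ψ) z - ∑ s, christoffel g s k p z * dz s ψ z

/-- Third covariant derivative `ψ_{/kps}`. -/
def cov3 (ψ : Cn n → ℂ) (k p s : Fin n) (z : Cn n) : ℂ :=
  dz s (cov2 g ψ k p) z - ∑ a, christoffel g a k s z * cov2 g ψ a p z
    - ∑ a, christoffel g a p s z * cov2 g ψ k a z

/-- Second covariant derivative `φ_{/l̄ q̄}`. -/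
def cov2Bar (φ : Cn n → ℂ) (l q : Fin n) (z : Cn n) : ℂ :=
  dzbar q (dzbar l φ) z - ∑ t, christoffelBar g t l q z * dzbar t φ z

/-- Third covariant derivative `φ_{/l̄ q̄ t̄}`. -/
def cov3Bar (φ : Cn n → ℂ) (l q t : Fin n) (z : Cn n) : ℂ :=
  dzbar t (cov2Bar g φ l q) z - ∑ a, christoffelBar g a l t z * cov2Bar g φ a q z
    - ∑ a, christoffelBar g a q t z * cov2Bar g φ l a z

/-- Curvature of the Kähler connection: `R^p_{m k l̄} = -∂̄_l Γ^p_{mk}`, i.e.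
`R(∂_k, ∂̄_l) ∂_m = R^p_{m k l̄} ∂_p`. -/
def curvature (p m k l : Fin n) (z : Cn n) : ℂ :=
  - dzbar l (christoffel g p m k) z

/-- `R^{q̄ p}_{k l̄} = g^{q̄ m} R^p_{m k l̄}`. -/
def curvatureUp2 (q p k l : Fin n) (z : Cn n) : ℂ :=
  ∑ m, (g z)⁻¹ q m * curvature g p m k l z

/-- `R^{l̄ k q̄ p}`, all indices raised. -/
def curvatureUp4 (l k q p : Fin n) (z : Cn n) : ℂ :=
  ∑ m, ∑ r, (g z)⁻¹ l m * (g z)⁻¹ r k * curvatureUp2 g q p m r z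

/-- The operators `C_0, …, C_3` of the standard deformation quantization with separation of
variables in covariant form:
`C_0 = φψ`, `C_1 = g^{l̄k} φ_{/l̄} ψ_{/k}`, `C_2 = ½ g^{l̄k} g^{q̄p} φ_{/l̄q̄} ψ_{/kp}`,
`C_3 = ⅙ g^{l̄k} g^{q̄p} g^{t̄s} φ_{/l̄q̄t̄} ψ_{/kps} + ¼ R^{l̄kq̄p} φ_{/l̄q̄} ψ_{/kp}`. -/
def kahlerC : ℕ → (Cn n → ℂ) → (Cn n → ℂ) → Cn n → ℂ
  | 0, φ, ψ, z => φ z * ψ z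
  | 1, φ, ψ, z => ∑ l, ∑ k, (g z)⁻¹ l k * dzbar l φ z * dz k ψ z
  | 2, φ, ψ, z => (1 / 2) * ∑ l, ∑ k, ∑ q, ∑ p,
      (g z)⁻¹ l k * (g z)⁻¹ q p * cov2Bar g φ l q z * cov2 g ψ k p z
  | 3, φ, ψ, z =>
      (1 / 6) * (∑ l, ∑ k, ∑ q, ∑ p, ∑ t, ∑ s,
        (g z)⁻¹ l k * (g z)⁻¹ q p * (g z)⁻¹ t s * cov3Bar g φ l q t z * cov3 g ψ k p s z)
      + (1 / 4) * ∑ l, ∑ k, ∑ q, ∑ p,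
        curvatureUp4 g l k q p z * cov2Bar g φ l q z * cov2 g ψ k p z
  | _, _, _, _ => 0

/-- `R(φ, ψ) = g^{n̄m} R^{l̄p}_{m q̄} R^{q̄k}_{p n̄} φ_{/l̄} ψ_{/k}`. -/
def kahlerR (φ ψ : Cn n → ℂ) (z : Cn n) : ℂ :=
  ∑ r, ∑ m, ∑ l, ∑ p, ∑ q, ∑ k,
    (g z)⁻¹ r m * curvatureUp2 g l p m q z * curvatureUp2 g q k p r z
      * dzbar l φ z * dz k ψ z

/-- `C̃_3 = C_3 + R / 12`. -/
def kahlerC3Tilde (φ ψ : Cn n → ℂ) (z : Cn n) : ℂ :=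
  kahlerC g 3 φ ψ z + (1 / 12) * kahlerR g φ ψ z

/-- The defining equations, up to order `N`, of the standard deformation quantization with
separation of variables on an open set `V ⊆ ℂⁿ` with Kähler potential `Φ`: the operators
`A_r = C_r(φ, ·)` satisfy `A_0 = φ`, `A_r 1 = 0` for `r ≥ 1`, commute with the `z̄^l`, and
`[A_{r+1}, ∂̄_l Φ] = [∂̄_l, A_r]`. Equivalently `A = ∑ ν^r A_r` satisfies `A 1 = φ` and commutes
with the operators `z̄^l` and `∂̄_l Φ + ν ∂̄_l`. -/
structure IsStandardUpTo (N : ℕ) (V : Set (Cn n)) (Φ : Cn n → ℂ)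
    (C : ℕ → (Cn n → ℂ) → (Cn n → ℂ) → Cn n → ℂ) : Prop where
  zeroth : ∀ φ ψ : Cn n → ℂ, ContDiffOn ℝ ∞ φ V → ContDiffOn ℝ ∞ ψ V → ∀ z ∈ V,
    C 0 φ ψ z = φ z * ψ z
  one : ∀ φ : Cn n → ℂ, ContDiffOn ℝ ∞ φ V → ∀ r, 1 ≤ r → r ≤ N → ∀ z ∈ V,
    C r φ (fun _ => 1) z = 0
  comm : ∀ φ ψ : Cn n → ℂ, ContDiffOn ℝ ∞ φ V → ContDiffOn ℝ ∞ ψ V → ∀ r ≤ N,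
    ∀ l, ∀ z ∈ V,
      C r φ (fun w => (starRingEnd ℂ) (w l) * ψ w) z = (starRingEnd ℂ) (z l) * C r φ ψ z
  recursion : ∀ φ ψ : Cn n → ℂ, ContDiffOn ℝ ∞ φ V → ContDiffOn ℝ ∞ ψ V → ∀ r, r + 1 ≤ N →
    ∀ l, ∀ z ∈ V,
      C (r + 1) φ (fun w => dzbar l Φ w * ψ w) z - dzbar l Φ z * C (r + 1) φ ψ z
        = dzbar l (C r φ ψ) z - C r φ (dzbar l ψ) z

end Coordinates

end

/-! Put D^l = T^{l̄k}∂_k and K_m^l = [∂̄_m, D^l]. Testing on the functions z̄^l shows that the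
Jacobi identity for η amounts to two statements about derivations of the algebra of smooth
functions: the D^l commute with one another, and ∑_m (K_m^l g)(D^m h) is symmetric in g and h
(`IsSeparated`, `isSeparated_of_jacobi`, `IsSeparated.jacobi`). The construction then becomes
algebra in a commutative ℂ-algebra with two families of derivations.

The product is encoded by the left multiplications by the antiholomorphic coordinates, L^l = z̄^l +
νD^l + ν²U^l + ν³V^l. The value f ∗ h is the Taylor expansion of f in the commuting variables z̄
with the L^l substituted for them; symmetrizing in the indices gives `opC1`, `opC2`, `opC3`. Here
U^l = ½ K_m^l D^m, and V^l is a fixed noncommutative polynomial in D, K and W = [∂̄, K].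
Associativity reduces to the case of a coordinate in the first place, (z̄^l ∗ g) ∗ h = z̄^l ∗ (g ∗
h), at orders two and three (`opU_mul`, `opV_mul`). These follow from the symmetry identity, its
∂̄-derivative and its image under K; the remaining terms cancel by the product rule and by symmetry
in the summation indices (`assoc_two`, `assoc_three`).

Covariance: a holomorphic coordinate change multiplies ∂̄ and D by antiholomorphic Jacobians. These
are constants for D, K and W, so D, K and W act linearly over the antiholomorphic functions.
Differentiating the Jacobian by ∂̄ produces a torsion-free connection. Its contribution to U and V
cancels its contribution to the iterated ∂̄-derivatives of f (`IsFrameChange.opC2_eq`,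
`IsFrameChange.opC3_eq`).

Regularity: D, K and W are vector fields whose coefficients are derivatives of T, so every operator
is given by one universal expression. Each term differentiates the first argument by some ∂̄
innermost and the second by some ∂ innermost (`exists_regularOp`), which is separation of variables.

In the Kähler case K_m^l = G^l_{mq}D^q with -G the antiholomorphic Christoffel symbols, D^l D^q ψ is
the second covariant derivative of ψ with raised indices, and D^l G gives the curvature.
Substitution turns `opC3` into C_3 plus a twelfth of the first order term (DG)(DG)D, which is R. The
recursion for C_1, C_2, C_3 comes from D^q(∂̄_l Φ) = δ^q_l and the total symmetry of the covariant
derivatives of φ.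

Transfer to manifolds goes through the algebras of smooth functions on open sets of ℂⁿ: regular
expressions, covariant derivatives and brackets are all represented by elements of these algebras.
-/

noncomputable section

set_option linter.unusedSectionVars false

/-! ### Separation of variables in terms of two families of derivations -/

namespace SepVar

section Algebra

variable {ι : Type*} [Fintype ι] {A : Type*} [CommRing A] [Algebra ℂ A]

section Operators

variable (db D : ι → Derivation ℂ A A)

/-- `K_m^l = [∂̄_m, D^l]`. -/
def lieK (m l : ι) : Derivation ℂ A A := ⁅db m, D l⁆

/-- `W_{ab}^l = [∂̄_a, K_b^l]`. -/
def lieW (a b l : ι) : Derivation ℂ A A := ⁅db a, lieK db D b l⁆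

/-- The second order term of the left multiplication by `z̄^l`. -/
def opU (l : ι) (h : A) : A := (1 / 2 : ℂ) • ∑ m, lieK db D m l (D m h)

/-- The third order term of the left multiplication by `z̄^l`. -/
def opV (l : ι) (h : A) : A := (1 / 12 : ℂ) • ∑ a, ∑ b,
  (2 * lieW db D a b l (D a (D b h)) + 3 * lieK db D a l (lieK db D b a (D b h))
    - lieK db D b a (lieK db D a l (D b h)) - lieK db D a l (D b (lieK db D b a h))
    + D b (lieK db D a l (lieK db D b a h)))

/-- `∑ ∂̄_l f D^l h`. -/
def opC1 (f h : A) : A := ∑ l, db l f * D l h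

/-- The second order term of the product with separation of variables. -/
def opC2 (f h : A) : A :=
  ∑ l, db l f * opU db D l h + (1 / 2 : ℂ) • ∑ l, ∑ q, db l (db q f) * D l (D q h)

/-- The third order term of the product with separation of variables. -/
def opC3 (f h : A) : A :=
  ∑ l, db l f * opV db D l h
    + (1 / 2 : ℂ) • ∑ l, ∑ q, db l (db q f) * (D l (opU db D q h) + opU db D l (D q h))
    + (1 / 6 : ℂ) • ∑ l, ∑ q, ∑ t, db l (db q (db t f)) * D l (D q (D t h))

end Operators

/-! ### Associativity up to the third order from the algebraic Jacobi identity -/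

theorem sum_eq_zero_of_symm_two {F : ι → ι → A} (hF : ∀ l q, F l q + F q l = 0) :
    ∑ l, ∑ q, F l q = 0 := by
  have h : ∑ l, ∑ q, (F l q + F q l) = 0 := by simp [hF]
  simp only [Finset.sum_add_distrib] at h
  rw [Finset.sum_comm (f := fun l q => F q l)] at h
  linear_combination (norm := algebra with ℂ) (1 / 2 : ℂ) • h

/-- Only the symmetrization of a summand matters in a sum over all indices, and 6 is invertible over
ℂ. The associativity defects vanish only after this symmetrization. -/
theorem sum_eq_zero_of_symm_three {F : ι → ι → ι → A}
    (hF : ∀ l q t, F l q t + F l t q + F q l t + F q t l + F t l q + F t q l = 0) :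
    ∑ l, ∑ q, ∑ t, F l q t = 0 := by
  have h : ∑ l, ∑ q, ∑ t, (F l q t + F l t q + F q l t + F q t l + F t l q + F t q l) = 0 := by
    simp [hF]
  have e1 : ∑ l, ∑ q, ∑ t, F l t q = ∑ l, ∑ q, ∑ t, F l q t :=
    Finset.sum_congr rfl fun l _ => Finset.sum_comm
  have e2 : ∑ l, ∑ q, ∑ t, F q l t = ∑ l, ∑ q, ∑ t, F l q t := Finset.sum_comm
  have e3 : ∑ l, ∑ q, ∑ t, F q t l = ∑ l, ∑ q, ∑ t, F l q t := by
    rw [Finset.sum_comm]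
    exact Finset.sum_congr rfl fun l _ => Finset.sum_comm
  have e4 : ∑ l, ∑ q, ∑ t, F t l q = ∑ l, ∑ q, ∑ t, F l q t := by
    rw [← e2, ← Finset.sum_congr rfl fun l _ => Finset.sum_comm]
  have e5 : ∑ l, ∑ q, ∑ t, F t q l = ∑ l, ∑ q, ∑ t, F l q t := by
    rw [← e3, ← Finset.sum_congr rfl fun l _ => Finset.sum_comm]
  simp only [Finset.sum_add_distrib] at h
  rw [e1, e2, e3, e4, e5] at h
  linear_combination (norm := algebra with ℂ) (1 / 6 : ℂ) • h

/-- Two commuting families of derivations subject to the algebraic form of the Jacobi identity. -/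
structure IsSeparated (db D : ι → Derivation ℂ A A) : Prop where
  comm_db : ∀ a b f, db a (db b f) = db b (db a f)
  comm_D : ∀ a b f, D a (D b f) = D b (D a f)
  symm : ∀ l g h, ∑ m, lieK db D m l g * D m h = ∑ m, lieK db D m l h * D m g

namespace IsSeparated

variable {db D : ι → Derivation ℂ A A}

variable (db D) in
theorem lieK_def (m l : ι) (f : A) : lieK db D m l f = db m (D l f) - D l (db m f) := rfl

variable (db D) in
theorem lieW_def (a b l : ι) (f : A) :
    lieW db D a b l f = db a (lieK db D b l f) - lieK db D b l (db a f) := rfl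

variable (db D) in
theorem db_D (m l : ι) (f : A) : db m (D l f) = D l (db m f) + lieK db D m l f := by
  rw [lieK_def]; ring

variable (db D) in
theorem db_K (a b l : ι) (f : A) :
    db a (lieK db D b l f) = lieK db D b l (db a f) + lieW db D a b l f := by
  rw [lieW_def]; ring

/-- The Jacobi identity for commutators with [∂̄_a, ∂̄_b] = 0. -/
theorem lieW_comm (H : IsSeparated db D) (a b l : ι) (f : A) : lieW db D a b l f = lieW db D b a l f := by
  simp only [lieW_def, lieK_def, map_sub, H.comm_db a b]; ring

/-- The Jacobi identity for commutators with [D^q, D^l] = 0: [D^q, K_m^l] is symmetric in q and l.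
-/
theorem D_lieK_comm (H : IsSeparated db D) (q m l : ι) (f : A) :
    D q (lieK db D m l f) - lieK db D m l (D q f)
      = D l (lieK db D m q f) - lieK db D m q (D l f) := by
  simp only [lieK_def, map_sub, H.comm_D q l]; ring

/-- Apply ∂̄_q to the symmetry identity; the terms in which ∂̄_q reaches g or h are again instances
of that identity and drop out. -/
theorem symm_lieW (H : IsSeparated db D) (l q : ι) (g h : A) :
    ∑ m, (lieW db D q m l g * D m h + lieK db D m l g * lieK db D q m h)
      = ∑ m, (lieW db D q m l h * D m g + lieK db D m l h * lieK db D q m g) := by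
  have key : ∀ g h, ∑ m, (lieW db D q m l g * D m h + lieK db D m l g * lieK db D q m h)
      = db q (∑ m, lieK db D m l g * D m h) - ∑ m, lieK db D m l (db q g) * D m h
        - ∑ m, lieK db D m l g * D m (db q h) := by
    intro g h
    rw [map_sum, ← Finset.sum_sub_distrib, ← Finset.sum_sub_distrib]
    refine Finset.sum_congr rfl fun m _ => ?_
    simp only [Derivation.leibniz, smul_eq_mul, db_D db D, db_K db D]
    ring
  rw [key, key, H.symm l g h, H.symm l (db q g) h, H.symm l g (db q h)]
  ring

/-- This is (z̄^l ∗ g) ∗ h = z̄^l ∗ (g ∗ h) at order ν², after removal of the terms carrying a bare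
factor z̄^l. The factor ½ in U balances the two mixed terms that the symmetry identity makes equal.
-/
theorem opU_mul (H : IsSeparated db D) (l : ι) (g h : A) :
    opU db D l (g * h) + D l (opC1 db D g h)
      = g * opU db D l h + h * opU db D l g + opC1 db D (D l g) h + opC1 db D g (D l h) := by
  have e := H.symm l g h
  have key : ∀ m, lieK db D m l (D m (g * h)) =
      g * lieK db D m l (D m h) + h * lieK db D m l (D m g)
        + (lieK db D m l g * D m h + lieK db D m l h * D m g) := by
    intro m; simp only [Derivation.leibniz, smul_eq_mul, map_add]; ring
  have key2 : ∀ m, D l (db m g * D m h) = db m (D l g) * D m h + db m g * D m (D l h)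
      - lieK db D m l g * D m h := by
    intro m; simp only [Derivation.leibniz, smul_eq_mul, db_D db D, H.comm_D l m]; ring
  simp only [opU, opC1, map_sum, key, key2, Finset.sum_add_distrib, Finset.sum_sub_distrib,
    ← Finset.mul_sum]
  linear_combination (norm := algebra with ℂ) (-1/2 : ℂ) • e

/-- The same coordinate case of associativity at order ν³. It is what the coefficients 2, 3, -1, -1,
1 of V are adjusted to. -/
theorem opV_mul (H : IsSeparated db D) (l : ι) (g h : A) :
    opV db D l (g * h) + opU db D l (opC1 db D g h) + D l (opC2 db D g h)
      = h * opV db D l g + opC1 db D (opU db D l g) h + opC2 db D (D l g) h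
        + (g * opV db D l h + opC1 db D g (opU db D l h) + opC2 db D g (D l h)) := by
  set K := lieK db D with hK
  set W := lieW db D with hW
  -- The vanishing sums `s1` to `s4` are the symmetry identity differentiated by ∂̄_b, evaluated on
  -- (∂̄_b g, D^b h), acted on by K_a^l, and evaluated with K_a^l h as one argument.
  have s1 : ∀ g h, ∑ b, ∑ a, (W b a l g * D a (D b h) + K a l g * K b a (D b h)
      - W b a l (D b h) * D a g - K a l (D b h) * K b a g) = 0 := by
    intro g h
    refine Finset.sum_eq_zero fun b _ => ?_
    have := H.symm_lieW l b g (D b h)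
    simp only [Finset.sum_add_distrib, Finset.sum_sub_distrib] at this ⊢
    linear_combination this
  have s2 : ∑ b, ∑ a, (K a l (db b g) * D a (D b h) - K a l (D b h) * D a (db b g)) = 0 := by
    refine Finset.sum_eq_zero fun b _ => ?_
    rw [Finset.sum_sub_distrib, H.symm, sub_self]
  have s3 : ∑ a, ∑ b, (K a l (K b a g) * D b h + K b a g * K a l (D b h)
      - K a l (K b a h) * D b g - K b a h * K a l (D b g)) = 0 := by
    refine Finset.sum_eq_zero fun a _ => ?_
    have : K a l (∑ b, K b a g * D b h) - K a l (∑ b, K b a h * D b g) = 0 := by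
      rw [H.symm, sub_self]
    rw [← this, map_sum, map_sum, ← Finset.sum_sub_distrib]
    refine Finset.sum_congr rfl fun b _ => ?_
    simp only [Derivation.leibniz, smul_eq_mul]
    ring
  have s4 : ∀ g h, ∑ a, ∑ b, (K b a g * D b (K a l h) - K b a (K a l h) * D b g) = 0 := by
    intro g h
    refine Finset.sum_eq_zero fun a _ => ?_
    rw [Finset.sum_sub_distrib, H.symm, sub_self]
  rw [Finset.sum_comm] at s2
  have s1' := s1 g h
  have s1'' := s1 h g
  rw [Finset.sum_comm] at s1' s1''
  have sw : ∀ X : ι → ι → A, ∑ a, ∑ b, (X a b - X b a) = 0 := by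
    intro X
    simp only [Finset.sum_sub_distrib]
    rw [Finset.sum_comm, sub_self]
  have p1 : opV db D l (g * h) - g * opV db D l h - h * opV db D l g
      = (1 / 12 : ℂ) • ∑ a, ∑ b, (
        2 * (W a b l g * D a (D b h) + D a g * W a b l (D b h) + D b g * W a b l (D a h)
          + W a b l h * D a (D b g) + D a h * W a b l (D b g) + D b h * W a b l (D a g))
        + 2 * (K a l g * K b a (D b h) + K b a g * K a l (D b h) + D b g * K a l (K b a h)
          + K a l h * K b a (D b g) + K b a h * K a l (D b g) + D b h * K a l (K b a g))
        + ((K a l (K b a g) - K b a (K a l g)) * D b h + (K a l (K b a h) - K b a (K a l h)) * D b g)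
        - ((K a l (D b g) - D b (K a l g)) * K b a h + (K a l (D b h) - D b (K a l h)) * K b a g)) := by
    simp only [opV, ← hK, ← hW, mul_smul_comm, ← smul_sub, Finset.mul_sum,
      ← Finset.sum_sub_distrib]
    congr 1
    refine Finset.sum_congr rfl fun a _ => Finset.sum_congr rfl fun b _ => ?_
    simp only [Derivation.leibniz, smul_eq_mul, map_add]
    ring
  have p2 : opU db D l (opC1 db D g h) - opC1 db D (opU db D l g) h - opC1 db D g (opU db D l h)
      = (1 / 2 : ℂ) • ∑ a, ∑ b, (
        D a (db b g) * K a l (D b h) + K a l (db b g) * D a (D b h)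
          + db b g * (K a l (D b (D a h)) - D b (K a l (D a h)))
          - K a l (K b a g) * D b h - W a b l (D a g) * D b h) := by
    have c1 : opC1 db D (opU db D l g) h
        = (1 / 2 : ℂ) • ∑ a, ∑ b, db b (K a l (D a g)) * D b h := by
      rw [Finset.sum_comm]
      simp only [opC1, opU, ← hK, map_sum, smul_mul_assoc, Finset.sum_mul,
        Finset.smul_sum, Derivation.map_smul]
    have c2 : opC1 db D g (opU db D l h)
        = (1 / 2 : ℂ) • ∑ a, ∑ b, db b g * D b (K a l (D a h)) := by
      rw [Finset.sum_comm]
      simp only [opC1, opU, ← hK, map_sum, mul_smul_comm, Finset.mul_sum,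
        Finset.smul_sum, Derivation.map_smul]
    rw [c1, c2]
    simp only [opU, opC1, ← hK, map_sum, ← smul_sub, ← Finset.sum_sub_distrib]
    congr 1
    refine Finset.sum_congr rfl fun a _ => Finset.sum_congr rfl fun b _ => ?_
    rw [hK, db_K db D, db_D db D, H.lieW_comm b a, ← hK, ← hW]
    simp only [Derivation.leibniz, smul_eq_mul, map_add, H.comm_D a b]
    ring
  have c3 : ∀ g h, opC2 db D g h
      = (1 / 2 : ℂ) • ∑ a, ∑ b, (db a g * K b a (D b h) + db a (db b g) * D a (D b h)) := by
    intro g h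
    simp only [opC2, opU, ← hK, mul_smul_comm, ← Finset.smul_sum, Finset.mul_sum,
      Finset.sum_add_distrib, smul_add]
  have p3 : D l (opC2 db D g h) - opC2 db D (D l g) h - opC2 db D g (D l h)
      = (1 / 2 : ℂ) • ∑ a, ∑ b, (
        db a g * (D a (K b l (D b h)) - K b l (D a (D b h)))
          - K a l g * K b a (D b h)
          - (K a l (db b g) + K b l (db a g) + W a b l g) * D a (D b h)) := by
    simp only [c3, Derivation.map_smul, map_sum, ← smul_sub, ← Finset.sum_sub_distrib]
    congr 1
    refine Finset.sum_congr rfl fun a _ => Finset.sum_congr rfl fun b _ => ?_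
    have kD : ∀ m l f, db m (D l f) = D l (db m f) + K m l f := db_D db D
    have kK : ∀ a b l f, db a (K b l f) = K b l (db a f) + W a b l f := db_K db D
    have := H.D_lieK_comm a b l (D b h)
    rw [← hK] at this
    rw [this]
    simp only [Derivation.leibniz, smul_eq_mul, map_add, kD, kK]
    rw [H.comm_D b l h, H.comm_D a l (D b h)]
    ring
  -- Twelve times the total defect, the weights 6 = 12 · ½ matching the prefactors in `p2` and `p3`.
  have q : ∑ a, ∑ b, (
        2 * (W a b l g * D a (D b h) + D a g * W a b l (D b h) + D b g * W a b l (D a h)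
          + W a b l h * D a (D b g) + D a h * W a b l (D b g) + D b h * W a b l (D a g))
        + 2 * (K a l g * K b a (D b h) + K b a g * K a l (D b h) + D b g * K a l (K b a h)
          + K a l h * K b a (D b g) + K b a h * K a l (D b g) + D b h * K a l (K b a g))
        + ((K a l (K b a g) - K b a (K a l g)) * D b h + (K a l (K b a h) - K b a (K a l h)) * D b g)
        - ((K a l (D b g) - D b (K a l g)) * K b a h + (K a l (D b h) - D b (K a l h)) * K b a g))
      + 6 * ∑ a, ∑ b, (
        D a (db b g) * K a l (D b h) + K a l (db b g) * D a (D b h)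
          + db b g * (K a l (D b (D a h)) - D b (K a l (D a h)))
          - K a l (K b a g) * D b h - W a b l (D a g) * D b h)
      + 6 * ∑ a, ∑ b, (
        db a g * (D a (K b l (D b h)) - K b l (D a (D b h)))
          - K a l g * K b a (D b h)
          - (K a l (db b g) + K b l (db a g) + W a b l g) * D a (D b h)) = 0 := by
    have hs : ∀ a b x, W b a l x = W a b l x := fun a b x => H.lieW_comm b a l x
    have r1 := sw fun a b => K a l (db b g) * D a (D b h)
    have r2 := sw fun a b => db b g * (K a l (D b (D a h)) - D b (K a l (D a h)))
    have r3 := sw fun a b => D a g * W a b l (D b h)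
    have r4 := sw fun a b => D a h * W a b l (D b g)
    -- The defect is an explicit combination of consequences of the Jacobi identity (s) and of
    -- antisymmetric double sums (r); these coefficients make the summands agree monomial by
    -- monomial.
    have : ∀ s1 s1' s2 s3 s4 s4' r1 r2 r3 r4 : A, s1 = 0 → s1' = 0 → s2 = 0 → s3 = 0 → s4 = 0 →
        s4' = 0 → r1 = 0 → r2 = 0 → r3 = 0 → r4 = 0 →
        -4 * s1 + 2 * s1' - 6 * s2 - 3 * s3 + s4 + s4' + 6 * r1 + 6 * r2 - 2 * r3 + 4 * r4 = 0 := by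
      rintro _ _ _ _ _ _ _ _ _ _ rfl rfl rfl rfl rfl rfl rfl rfl rfl rfl; ring
    rw [← this _ _ _ _ _ _ _ _ _ _ s1' s1'' s2 s3 (s4 g h) (s4 h g) r1 r2 r3 r4]
    simp only [Finset.mul_sum, ← Finset.sum_add_distrib, ← Finset.sum_sub_distrib]
    refine Finset.sum_congr rfl fun a _ => Finset.sum_congr rfl fun b _ => ?_
    rw [hs a b, hs a b, hs a b, hs a b, hs a b, hs a b, H.comm_D b a h]
    ring
  linear_combination (norm := algebra with ℂ) p1 + p2 + p3 + (1/12 : ℂ) • q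

theorem assoc_one (f g h : A) :
    opC1 db D f g * h + opC1 db D (f * g) h = f * opC1 db D g h + opC1 db D f (g * h) := by
  simp only [opC1, Finset.mul_sum, Finset.sum_mul, ← Finset.sum_add_distrib]
  refine Finset.sum_congr rfl fun l _ => ?_
  simp only [Derivation.leibniz, smul_eq_mul]
  ring

/-- The terms with a single derivative of f are controlled by `opU_mul`; what remains cancels by the
product rule, partly after symmetrization in the two summation indices. -/
theorem assoc_two (H : IsSeparated db D) (f g h : A) :
    opC2 db D f g * h + opC1 db D (opC1 db D f g) h + opC2 db D (f * g) h
      = f * opC2 db D g h + opC1 db D f (opC1 db D g h) + opC2 db D f (g * h) := by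
  have cu : ∑ l, db l f * (opU db D l (g * h) + D l (opC1 db D g h)) =
      ∑ l, db l f * (g * opU db D l h + h * opU db D l g + opC1 db D (D l g) h
        + opC1 db D g (D l h)) :=
    Finset.sum_congr rfl fun l _ => by rw [H.opU_mul]
  have key1 : ∑ l, (db l f * opU db D l g * h + db l (f * g) * opU db D l h
      - f * (db l g * opU db D l h) - db l f * (g * opU db D l h + h * opU db D l g)) = 0 :=
    Finset.sum_eq_zero fun l _ => by
      simp only [Derivation.leibniz, smul_eq_mul]; ring
  have key2 : ∑ l, ∑ q, (db l (db q f) * D l (D q g) * h + (2 : ℂ) • (db l (db q f * D q g) * D l h)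
      + db l (db q (f * g)) * D l (D q h) - f * (db l (db q g) * D l (D q h))
      - (2 : ℂ) • (db l f * (db q (D l g) * D q h + db q g * D q (D l h)))
      - db l (db q f) * D l (D q (g * h))) = 0 := by
    refine sum_eq_zero_of_symm_two fun l q => ?_
    simp only [Derivation.leibniz, smul_eq_mul, map_add, H.comm_D q l, H.comm_db q l]
    algebra with ℂ
  simp only [opC2]
  simp only [opC1, mul_add, add_mul, Finset.sum_add_distrib, map_sum, Finset.mul_sum,
    Finset.sum_mul, smul_mul_assoc, mul_smul_comm, Finset.sum_sub_distrib, ← Finset.smul_sum,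
    mul_assoc] at *
  linear_combination (norm := algebra with ℂ) key1 + (1 / 2 : ℂ) • key2 - cu

/-- The left multiplications by z̄^l and z̄^q commute; this is the ν³ part of that statement. -/
theorem D_opU_symm (H : IsSeparated db D) (l q : ι) (h : A) :
    D l (opU db D q h) + opU db D l (D q h) = D q (opU db D l h) + opU db D q (D l h) := by
  have : ∑ m, (D l (lieK db D m q (D m h)) + lieK db D m l (D m (D q h)))
      = ∑ m, (D q (lieK db D m l (D m h)) + lieK db D m q (D m (D l h))) := by
    refine Finset.sum_congr rfl fun m _ => ?_
    rw [H.comm_D m q, H.comm_D m l]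
    linear_combination H.D_lieK_comm l m q (D m h)
  simp only [Finset.sum_add_distrib] at this
  simp only [opU, Derivation.map_smul, map_sum]
  linear_combination (norm := algebra with ℂ) (1 / 2 : ℂ) • this

/-- Multiplicativity of two successive left multiplications by coordinates: the image of `opU_mul`
under D^l plus two instances of `opU_mul` in which one factor is already differentiated. -/
theorem opU_D_mul (H : IsSeparated db D) (l q : ι) (g h : A) :
    D l (opU db D q (g * h)) + opU db D l (D q (g * h)) + D l (D q (opC1 db D g h))
      = D l g * opU db D q h + D l h * opU db D q g + D q h * opU db D l g + D q g * opU db D l h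
        + g * (D l (opU db D q h) + opU db D l (D q h))
        + h * (D l (opU db D q g) + opU db D l (D q g))
        + (opC1 db D (D l g) (D q h) + opC1 db D g (D l (D q h))
          + opC1 db D (D l (D q g)) h + opC1 db D (D q g) (D l h)) := by
  have e1 := congrArg (D l) (H.opU_mul q g h)
  have e2 := H.opU_mul l g (D q h)
  have e3 := H.opU_mul l (D q g) h
  have e4 : ∀ x y, opU db D l (x + y) = opU db D l x + opU db D l y := by
    intro x y; simp only [opU, map_add, Finset.sum_add_distrib, smul_add]
  simp only [Derivation.leibniz, smul_eq_mul, map_add, e4] at e1 ⊢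
  rw [mul_comm h (D q g)]
  linear_combination e1 + e2 + e3

-- Sort the defect by its origin. `opV_mul` treats the first derivatives of f paired with full
-- products, `opU_D_mul` the second derivatives, and `key1`, `key2`, `key3` collect what the product
-- rule leaves with V, with U and with three D's.
set_option maxHeartbeats 800000 in
theorem assoc_three (H : IsSeparated db D) (f g h : A) :
    opC3 db D f g * h + opC1 db D (opC2 db D f g) h + opC2 db D (opC1 db D f g) h
        + opC3 db D (f * g) h
      = f * opC3 db D g h + opC1 db D f (opC2 db D g h) + opC2 db D f (opC1 db D g h)
        + opC3 db D f (g * h) := by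
  have cv : ∑ l, db l f * (opV db D l (g * h) + opU db D l (opC1 db D g h) + D l (opC2 db D g h))
      = ∑ l, db l f * (h * opV db D l g + opC1 db D (opU db D l g) h + opC2 db D (D l g) h
        + (g * opV db D l h + opC1 db D g (opU db D l h) + opC2 db D g (D l h))) :=
    Finset.sum_congr rfl fun l _ => by rw [H.opV_mul]
  have cw : ∑ l, ∑ q, db l (db q f) * (D l (opU db D q (g * h)) + opU db D l (D q (g * h))
        + D l (D q (opC1 db D g h)))
      = ∑ l, ∑ q, db l (db q f) *
        (D l g * opU db D q h + D l h * opU db D q g + D q h * opU db D l g + D q g * opU db D l h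
        + g * (D l (opU db D q h) + opU db D l (D q h))
        + h * (D l (opU db D q g) + opU db D l (D q g))
        + (opC1 db D (D l g) (D q h) + opC1 db D g (D l (D q h))
          + opC1 db D (D l (D q g)) h + opC1 db D (D q g) (D l h))) :=
    Finset.sum_congr rfl fun l _ => Finset.sum_congr rfl fun q _ => by rw [H.opU_D_mul]
  have key1 : ∑ l, (db l f * opV db D l g * h + db l (f * g) * opV db D l h
      - f * (db l g * opV db D l h) - db l f * (h * opV db D l g + g * opV db D l h)) = 0 :=
    Finset.sum_eq_zero fun l _ => by
      simp only [Derivation.leibniz, smul_eq_mul]; ring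
  have key2 : ∑ l, ∑ q, (db l (db q f) * (D l (opU db D q g) + opU db D l (D q g)) * h
      + (2 : ℂ) • (db l (db q f * opU db D q g) * D l h) + (2 : ℂ) • (db l (db q f * D q g) * opU db D l h)
      + db l (db q (f * g)) * (D l (opU db D q h) + opU db D l (D q h))
      - f * (db l (db q g) * (D l (opU db D q h) + opU db D l (D q h)))
      - (2 : ℂ) • (db l f * (db q (opU db D l g) * D q h + db q (D l g) * opU db D q h
        + db q g * D q (opU db D l h) + db q g * opU db D q (D l h)))
      - db l (db q f) * (D l g * opU db D q h + D l h * opU db D q g + D q h * opU db D l g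
        + D q g * opU db D l h
        + g * (D l (opU db D q h) + opU db D l (D q h))
        + h * (D l (opU db D q g) + opU db D l (D q g)))) = 0 := by
    refine sum_eq_zero_of_symm_two fun l q => ?_
    simp only [Derivation.leibniz, smul_eq_mul, map_add, H.comm_db q l]
    -- After symmetrization in l and q only the commutator of two left multiplications survives,
    -- with a coefficient antisymmetric in l and q.
    linear_combination (norm := algebra with ℂ) (db l f * db q g - db q f * db l g) *
      H.D_opU_symm l q h
  have key3 : ∑ l, ∑ q, ∑ t, ((3 : ℂ) • (db l (db q (db t f) * D q (D t g)) * D l h)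
      + (3 : ℂ) • (db l (db q (db t f * D t g)) * D l (D q h))
      + db l (db q (db t f)) * D l (D q (D t g)) * h
      + db l (db q (db t (f * g))) * D l (D q (D t h))
      - f * (db l (db q (db t g)) * D l (D q (D t h)))
      - (3 : ℂ) • (db l f * (db q (db t (D l g)) * D q (D t h) + db q (db t g) * D q (D t (D l h))))
      - (3 : ℂ) • (db l (db q f) * (db t (D l g) * D t (D q h) + db t g * D t (D l (D q h))
        + db t (D l (D q g)) * D t h + db t (D q g) * D t (D l h)))
      - db l (db q (db t f)) * D l (D q (D t (g * h)))) = 0 := by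
    refine sum_eq_zero_of_symm_three fun l q t => ?_
    -- Bringing all iterated derivatives to one fixed order makes the six permuted summands
    -- comparable.
    simp only [Derivation.leibniz, smul_eq_mul, map_add, H.comm_D q l, H.comm_db q l,
      H.comm_D t l, H.comm_db t l, H.comm_D t q, H.comm_db t q]
    algebra with ℂ
  simp only [opC3, opC2] at *
  simp only [opC1, mul_add, add_mul, Finset.sum_add_distrib, map_sum, Finset.mul_sum,
    Finset.sum_mul, smul_mul_assoc, mul_smul_comm, Finset.sum_sub_distrib, ← Finset.smul_sum,
    mul_assoc, map_add, Derivation.map_smul] at *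
  linear_combination (norm := module) key1 + (1 / 2 : ℂ) • key2 + (1 / 6 : ℂ) • key3
    - cv - (1 / 2 : ℂ) • cw

end IsSeparated

end Algebra

end SepVar
end

/-! ### Frame changes in a noncommutative algebra of operators -/

noncomputable section
set_option linter.unusedSectionVars false

namespace SepVar

section Frame

variable {ι : Type*} [Fintype ι] [DecidableEq ι] {S : Type*} [CommRing S]

section Contract

variable {M N P : Type*} [AddCommGroup M] [AddCommGroup N] [AddCommGroup P]
  [Module S M] [Module S N] [Module S P]

/-- A contracted pair of indices, one transforming by J and the other by its inverse, is insensitive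
to the frame. Stated for an arbitrary bilinear map, so that products of functions and compositions
of operators are both covered. -/
theorem sum_contract {J Jh : ι → ι → S}
    (hinv : ∀ m l, ∑ b, Jh b m * J b l = if m = l then 1 else 0)
    (B : M →ₗ[S] N →ₗ[S] P) (x : ι → M) (y : ι → N) :
    ∑ b, B (∑ m, Jh b m • x m) (∑ l, J b l • y l) = ∑ m, B (x m) (y m) := by
  have h : ∀ l m, ∑ b, (J b l * Jh b m) • (B (x m)) (y l)
      = if m = l then B (x m) (y l) else 0 := by
    intro l m
    rw [← Finset.sum_smul]
    simp only [mul_comm (J _ _), hinv]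
    split_ifs <;> simp
  calc _ = ∑ b, ∑ l, ∑ m, (J b l * Jh b m) • (B (x m)) (y l) := by
        simp only [map_sum, LinearMap.sum_apply, map_smul, LinearMap.smul_apply, mul_smul,
          Finset.smul_sum]
    _ = ∑ l, ∑ b, ∑ m, (J b l * Jh b m) • (B (x m)) (y l) := Finset.sum_comm
    _ = ∑ l, ∑ m, ∑ b, (J b l * Jh b m) • (B (x m)) (y l) :=
        Finset.sum_congr rfl fun l _ => Finset.sum_comm
    _ = _ := by simp [h]

end Contract

variable {E : Type*} [Ring E] [Algebra S E]

/-- Twelve times the third order term of the left multiplication by `z̄^l`, as an element of an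
algebra of operators. -/
def genV (D : ι → E) (K : ι → ι → E) (W : ι → ι → ι → E) (l : ι) : E :=
  2 * ∑ a, ∑ b, W a b l * D a * D b + 3 * ∑ a, ∑ b, K a l * K b a * D b
    - ∑ a, ∑ b, K b a * K a l * D b - ∑ a, ∑ b, K a l * D b * K b a
    + ∑ a, ∑ b, D b * K a l * K b a

/-- Twice the second order term of the left multiplication by `z̄^l`. -/
def genU (D : ι → E) (K : ι → ι → E) (l : ι) : E := ∑ m, K m l * D m

theorem genU_frame {J Jh : ι → ι → S}
    (hinv : ∀ m l, ∑ b, Jh b m * J b l = if m = l then 1 else 0)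
    (D : ι → E) (K : ι → ι → E) (b : ι) :
    genU (fun b => ∑ l, J b l • D l) (fun c b => ∑ m, Jh c m • ∑ l, J b l • K m l) b
      = ∑ l, J b l • genU D K l := by
  have := sum_contract hinv (LinearMap.mul S E) (fun m => ∑ l, J b l • K m l) D
  simp only [LinearMap.mul_apply'] at this
  rw [genU, this]
  simp only [genU, Finset.sum_mul, Finset.smul_sum, smul_mul_assoc]
  exact Finset.sum_comm

/-- The cubic terms of V have the same index pattern and differ only in the order of the three
factors. An arbitrary trilinear Θ covers all the orders at once. -/
theorem sum_contract_three {J Jh : ι → ι → S}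
    (hinv : ∀ m l, ∑ b, Jh b m * J b l = if m = l then 1 else 0)
    (Θ : E →ₗ[S] E →ₗ[S] E →ₗ[S] E) (X Y : ι → ι → E) (Z : ι → E) (l : ι) :
    ∑ a, ∑ b, Θ (∑ m, Jh a m • ∑ p, J l p • X m p) (∑ m, Jh b m • ∑ p, J a p • Y m p)
        (∑ q, J b q • Z q)
      = ∑ p, J l p • ∑ a, ∑ b, Θ (X a p) (Y b a) (Z b) := by
  have h := fun b => sum_contract hinv (Θ.compr₂ (LinearMap.applyₗ (Z b)))
    (fun m => ∑ p, J l p • X m p) (Y b)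
  simp only [LinearMap.compr₂_apply, LinearMap.applyₗ_apply_apply] at h
  calc _ = ∑ b, ∑ a, Θ (∑ p, J l p • X a p) (Y b a) (Z b) := by
        simp only [sum_contract hinv (Θ _)]
        rw [Finset.sum_comm]
        simp only [h]
    _ = ∑ b, ∑ p, J l p • ∑ a, Θ (X a p) (Y b a) (Z b) := by
        refine Finset.sum_congr rfl fun b _ => ?_
        simp only [map_sum, map_smul, LinearMap.sum_apply, LinearMap.smul_apply, Finset.smul_sum]
        exact Finset.sum_comm
    _ = ∑ p, J l p • ∑ b, ∑ a, Θ (X a p) (Y b a) (Z b) := by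
        rw [Finset.sum_comm]; simp only [Finset.smul_sum]
    _ = _ := Finset.sum_congr rfl fun p _ => by rw [Finset.sum_comm]

/-- If D, K and W all transformed as tensors, V would be a vector in its free index. The
inhomogeneous parts of K and W are accounted for separately by `genV_shift`. -/
theorem genV_frame {J Jh : ι → ι → S}
    (hinv : ∀ m l, ∑ b, Jh b m * J b l = if m = l then 1 else 0)
    (D : ι → E) (K : ι → ι → E) (W : ι → ι → ι → E) (b : ι) :
    genV (fun b => ∑ l, J b l • D l) (fun c b => ∑ m, Jh c m • ∑ l, J b l • K m l)
        (fun a c b => ∑ m, Jh a m • ∑ p, Jh c p • ∑ l, J b l • W m p l) b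
      = ∑ l, J b l • genV D K W l := by
  let t : E →ₗ[S] E →ₗ[S] E →ₗ[S] E := (LinearMap.mul S E).compr₂ (LinearMap.mul S E)
  have h1 : ∑ a, ∑ c, (∑ m, Jh a m • ∑ p, Jh c p • ∑ l, J b l • W m p l)
      * (∑ l, J a l • D l) * (∑ l, J c l • D l) = ∑ l, J b l • ∑ a, ∑ c, W a c l * D a * D c := by
    have k1 := fun c => sum_contract hinv (LinearMap.mul S E)
      (fun m => ∑ p, Jh c p • ∑ l, J b l • W m p l) D
    have k2 := sum_contract hinv (LinearMap.mul S E)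
      (fun p => ∑ a, (∑ l, J b l • W a p l) * D a) D
    simp only [LinearMap.mul_apply'] at k1 k2
    calc _ = ∑ c, (∑ m, (∑ p, Jh c p • ∑ l, J b l • W m p l) * D m) * (∑ l, J c l • D l) := by
          rw [Finset.sum_comm]
          simp only [← Finset.sum_mul, k1]
      _ = ∑ c, (∑ a, (∑ l, J b l • W a c l) * D a) * D c := by
          rw [← k2]
          refine Finset.sum_congr rfl fun c _ => ?_
          congr 1
          simp only [Finset.sum_mul, smul_mul_assoc, Finset.smul_sum]
          exact Finset.sum_comm
      _ = ∑ c, ∑ l, J b l • ∑ a, W a c l * D a * D c := by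
          refine Finset.sum_congr rfl fun c _ => ?_
          simp only [Finset.sum_mul, smul_mul_assoc, Finset.smul_sum]
          exact Finset.sum_comm
      _ = ∑ l, J b l • ∑ c, ∑ a, W a c l * D a * D c := by
          rw [Finset.sum_comm]
          simp only [Finset.smul_sum]
      _ = _ := Finset.sum_congr rfl fun l _ => by rw [Finset.sum_comm]
  have h2 := sum_contract_three hinv t K K D b
  have h3 := sum_contract_three hinv t.flip K K D b
  have h4 := sum_contract_three hinv ((LinearMap.lflip (R₀ := S)).toLinearMap ∘ₗ t) K K D b
  have h5 := sum_contract_three hinv ((LinearMap.lflip (R₀ := S)).toLinearMap ∘ₗ t.flip) K K D b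
  simp only [t, LinearMap.compr₂_apply, LinearMap.mul_apply', LinearMap.flip_apply,
    LinearMap.comp_apply, LinearMap.lflip_apply, LinearEquiv.coe_coe] at h2 h3 h4 h5
  have three : ∀ x : E, 3 * x = x + x + x := fun x => by noncomm_ring
  simp only [genV]
  rw [h1, h2, h3, h4, h5]
  simp only [smul_add, smul_sub, Finset.sum_add_distrib, Finset.sum_sub_distrib, two_mul, three]

/-- K is replaced by K + GD, and W by the covariant derivative of the new K. The symmetry of G and
the commutativity of the D's cancel most cross terms; what is left is cubic in D, or contains K once
together with one G. -/
theorem genV_shift {D : ι → E} (hD : ∀ a b, D a * D b = D b * D a) (K : ι → ι → E)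
    (W : ι → ι → ι → E) {G : ι → ι → ι → S} (hG : ∀ l a b, G l a b = G l b a)
    (dG : ι → ι → ι → ι → S) (l : ι) :
    genV D (fun m l => K m l + ∑ q, G l m q • D q)
        (fun a b l => W a b l + ∑ q, dG a l b q • D q + ∑ q, G l b q • K a q
          + ∑ c, G l a c • (K b c + ∑ q, G c b q • D q)
          - ∑ c, G c a b • (K c l + ∑ q, G l c q • D q)) l
      = genV D K W l
        + 2 * ∑ a, ∑ b, (∑ q, dG a l b q • D q) * D a * D b
        + 2 * ∑ a, ∑ b, (∑ q, G l a q • D q) * (∑ q, G a b q • D q) * D b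
        + 3 * ∑ a, ∑ b, K b a * (∑ q, G l a q • D q) * D b
        + 3 * ∑ a, ∑ b, (∑ q, G l a q • D q) * K b a * D b := by
  obtain ⟨Y, hY⟩ : ∃ Y : ι → ι → E, Y = fun m l => ∑ q, G l m q • D q := ⟨_, rfl⟩
  have cY : ∀ a b c, Y a b * D c = D c * Y a b := by
    intro a b c
    simp only [hY, Finset.sum_mul, Finset.mul_sum, smul_mul_assoc, mul_smul_comm, hD _ c]
  have cYY : ∀ a b c d, Y a b * Y c d = Y c d * Y a b := by
    intro a b c d
    conv_lhs => enter [2]; simp only [hY]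
    conv_rhs => enter [1]; simp only [hY]
    simp only [Finset.sum_mul, Finset.mul_sum, smul_mul_assoc, mul_smul_comm, cY]
  -- Y_b^a = G^a_{bq}D^q with G symmetric, so the outer factors exchange their roles when b and q
  -- are renamed.
  have sw : ∀ a, ∑ b, Y b a * K a l * D b = ∑ b, D b * K a l * Y b a := by
    intro a
    simp only [hY, Finset.sum_mul, Finset.mul_sum, smul_mul_assoc, mul_smul_comm]
    rw [Finset.sum_comm]
    simp only [hG a]
  have t1 : ∑ a, ∑ b, (W a b l + ∑ q, dG a l b q • D q + ∑ q, G l b q • K a q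
          + ∑ c, G l a c • (K b c + Y b c) - ∑ c, G c a b • (K c l + Y c l)) * D a * D b
      = ∑ a, ∑ b, W a b l * D a * D b + ∑ a, ∑ b, (∑ q, dG a l b q • D q) * D a * D b
        + 2 * ∑ a, ∑ b, K b a * Y a l * D b - ∑ a, ∑ b, K a l * Y b a * D b := by
    have r1 : ∑ a, ∑ b, (∑ q, G l b q • K a q) * D a * D b = ∑ a, ∑ b, K b a * Y a l * D b := by
      simp only [hY, Finset.sum_mul, Finset.mul_sum, smul_mul_assoc, mul_smul_comm]
      calc _ = ∑ a, ∑ q, ∑ b, G l b q • (K a q * D a * D b) :=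
            Finset.sum_congr rfl fun a _ => Finset.sum_comm
        _ = ∑ q, ∑ a, ∑ b, G l b q • (K a q * D a * D b) := Finset.sum_comm
        _ = _ := by simp only [mul_assoc, hD, hG l]
    have r2 : ∀ Z : ι → ι → E, ∑ a, ∑ b, (∑ c, G l a c • Z b c) * D a * D b
        = ∑ a, ∑ b, Z b a * Y a l * D b := by
      intro Z
      simp only [hY, Finset.sum_mul, Finset.mul_sum, smul_mul_assoc, mul_smul_comm]
      calc _ = ∑ a, ∑ c, ∑ b, G l a c • (Z b c * D a * D b) :=
            Finset.sum_congr rfl fun a _ => Finset.sum_comm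
        _ = ∑ c, ∑ a, ∑ b, G l a c • (Z b c * D a * D b) := Finset.sum_comm
        _ = ∑ c, ∑ b, ∑ a, G l a c • (Z b c * D a * D b) :=
            Finset.sum_congr rfl fun a _ => Finset.sum_comm
        _ = _ := by simp only [hG l]
    have r3 : ∀ Z : ι → E, ∑ a, ∑ b, (∑ c, G c a b • Z c) * D a * D b
        = ∑ a, ∑ b, Z a * Y b a * D b := by
      intro Z
      simp only [hY, Finset.sum_mul, Finset.mul_sum, smul_mul_assoc, mul_smul_comm]
      calc _ = ∑ a, ∑ c, ∑ b, G c a b • (Z c * D a * D b) :=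
            Finset.sum_congr rfl fun a _ => Finset.sum_comm
        _ = ∑ c, ∑ a, ∑ b, G c a b • (Z c * D a * D b) := Finset.sum_comm
        _ = ∑ c, ∑ b, ∑ a, G c a b • (Z c * D a * D b) :=
            Finset.sum_congr rfl fun a _ => Finset.sum_comm
        _ = _ := by simp only [hG]
    have r4 : ∑ a, ∑ b, Y b a * Y a l * D b = ∑ a, ∑ b, Y a l * Y b a * D b := by
      simp only [cYY]
    simp only [add_mul, sub_mul, smul_add, Finset.sum_add_distrib, Finset.sum_sub_distrib,
      r1, r2, r3]
    rw [r4, two_mul]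
    abel
  suffices genV D (fun m l => K m l + Y m l) (fun a b l => W a b l + ∑ q, dG a l b q • D q
      + ∑ q, G l b q • K a q + ∑ c, G l a c • (K b c + Y b c) - ∑ c, G c a b • (K c l + Y c l)) l
    = genV D K W l + 2 * ∑ a, ∑ b, (∑ q, dG a l b q • D q) * D a * D b
      + 2 * ∑ a, ∑ b, Y a l * Y b a * D b + 3 * ∑ a, ∑ b, K b a * Y a l * D b
      + 3 * ∑ a, ∑ b, Y a l * K b a * D b by
    simpa only [hY] using this
  simp only [genV]
  rw [t1]
  simp only [add_mul, mul_add, Finset.sum_add_distrib, sw]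
  have e1 : ∀ a b, K a l * D b * Y b a = K a l * Y b a * D b := by
    intro a b; rw [mul_assoc, mul_assoc, cY]
  have e2 : ∀ a b, D b * Y a l * K b a = Y a l * D b * K b a := by
    intro a b; rw [cY]
  have e3 : ∀ a b, D b * Y a l * Y b a = Y a l * Y b a * D b := by
    intro a b; rw [← cY a l b, mul_assoc, mul_assoc, cY b a b]
  have e4 : ∀ a b, Y a l * D b * Y b a = Y a l * Y b a * D b := by
    intro a b; rw [mul_assoc, mul_assoc, cY]
  have e5 : ∀ a b, Y b a * Y a l * D b = Y a l * Y b a * D b := by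
    intro a b; rw [cYY]
  simp only [e1, e2, e3, e4, e5]
  noncomm_ring

end Frame
end SepVar
end

/-! ### Invariance of the operators under holomorphic coordinate changes -/

noncomputable section
set_option linter.unusedSectionVars false

namespace SepVar

section FrameChange

variable {ι : Type*} [Fintype ι] [DecidableEq ι] {A : Type*} [CommRing A] [Algebra ℂ A]

theorem sum_rotate {M : Type*} [AddCommMonoid M] (F : ι → ι → ι → M) :
    ∑ c, ∑ a, ∑ b, F a b c = ∑ a, ∑ b, ∑ c, F a b c := by
  rw [Finset.sum_comm]
  exact Finset.sum_congr rfl fun _ _ => Finset.sum_comm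

theorem sum_comm_pairs {M : Type*} [AddCommMonoid M] (F : ι → ι → ι → ι → M) :
    ∑ a, ∑ b, ∑ c, ∑ d, F a b c d = ∑ c, ∑ d, ∑ a, ∑ b, F a b c d := by
  rw [← sum_rotate fun c d a => ∑ b, F a b c d]
  exact Finset.sum_congr rfl fun a _ => sum_rotate fun c d b => F a b c d

/-- A derivation that kills the subalgebra `S`, as an `S`-linear operator. -/
def endOver (S : Subalgebra ℂ A) (d : Derivation ℂ A A) (hd : ∀ s ∈ S, d s = 0) :
    Module.End S A where
  toFun := d
  map_add' := map_add d
  map_smul' s x := by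
    simp only [Subalgebra.smul_def, smul_eq_mul, Derivation.leibniz, hd s s.2, mul_zero, add_zero,
      RingHom.id_apply]

@[simp] theorem endOver_apply (S : Subalgebra ℂ A) (d : Derivation ℂ A A)
    (hd : ∀ s ∈ S, d s = 0) (x : A) : endOver S d hd x = d x := rfl

/-- A change of frame: `∂̄'_b = Ĵ_b^m ∂̄_m` and `D'^b = J^b_l D^l`, with coefficients in a subalgebra
of antiholomorphic elements. -/
structure IsFrameChange (S : Subalgebra ℂ A) (db D db' D' : ι → Derivation ℂ A A)
    (J Jh : ι → ι → S) : Prop where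
  comm_db : ∀ a b f, db a (db b f) = db b (db a f)
  comm_D : ∀ a b f, D a (D b f) = D b (D a f)
  D_eq_zero : ∀ q, ∀ s ∈ S, D q s = 0
  db_mem : ∀ m, ∀ s ∈ S, db m s ∈ S
  inv_left : ∀ m l, ∑ b, Jh b m * J b l = if m = l then 1 else 0
  inv_right : ∀ b c, ∑ l, J b l * Jh c l = if b = c then 1 else 0
  symm : ∀ m b l, db m (J b l : A) = db l (J b m : A)
  db'_apply : ∀ b f, db' b f = ∑ m, Jh b m • db m f
  D'_apply : ∀ b f, D' b f = ∑ l, J b l • D l f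

namespace IsFrameChange

variable {S : Subalgebra ℂ A} {db D db' D' : ι → Derivation ℂ A A} {J Jh : ι → ι → S}

/-- Elements of S are constants for D and stay in S under ∂̄, so the commutators K and W kill them
as well. This makes D, K and W operators linear over S. -/
theorem lieK_eq_zero (H : IsFrameChange S db D db' D' J Jh) (m l : ι) (s : A) (hs : s ∈ S) :
    lieK db D m l s = 0 := by
  rw [IsSeparated.lieK_def, H.D_eq_zero l s hs, H.D_eq_zero l _ (H.db_mem m s hs)]; simp

theorem lieW_eq_zero (H : IsFrameChange S db D db' D' J Jh) (a m l : ι) (s : A) (hs : s ∈ S) :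
    lieW db D a m l s = 0 := by
  rw [IsSeparated.lieW_def, H.lieK_eq_zero m l s hs, H.lieK_eq_zero m l _ (H.db_mem a s hs)]; simp

theorem D'_eq_zero (H : IsFrameChange S db D db' D' J Jh) (q : ι) (s : A) (hs : s ∈ S) :
    D' q s = 0 := by
  rw [H.D'_apply]; exact Finset.sum_eq_zero fun l _ => by rw [H.D_eq_zero l s hs, smul_zero]

theorem db'_mem (H : IsFrameChange S db D db' D' J Jh) (m : ι) (s : A) (hs : s ∈ S) :
    db' m s ∈ S := by
  rw [H.db'_apply]
  exact S.sum_mem fun l _ => S.mul_mem (Jh m l).2 (H.db_mem l s hs)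

theorem lieK'_eq_zero (H : IsFrameChange S db D db' D' J Jh) (m l : ι) (s : A) (hs : s ∈ S) :
    lieK db' D' m l s = 0 := by
  rw [IsSeparated.lieK_def, H.D'_eq_zero l s hs, H.D'_eq_zero l _ (H.db'_mem m s hs)]; simp

/-- The derivation of `S` induced by `∂̄_m`. -/
def dbS (H : IsFrameChange S db D db' D' J Jh) (m : ι) (s : S) : S :=
  ⟨db m s, H.db_mem m s s.2⟩

/-- The connection coefficients of the frame change. -/
def conn (H : IsFrameChange S db D db' D' J Jh) (l m q : ι) : S :=
  ∑ b, Jh b l * H.dbS m (J b q)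

/-- The connection is torsion free because its J satisfies the symmetry ∂̄_m J^b_l = ∂̄_l J^b_m of a
Jacobian matrix. -/
theorem conn_symm (H : IsFrameChange S db D db' D' J Jh) (l m q : ι) :
    H.conn l m q = H.conn l q m :=
  Finset.sum_congr rfl fun b _ => by
    congr 1; exact Subtype.ext (H.symm m b q)

theorem dbS_J (H : IsFrameChange S db D db' D' J Jh) (m b q : ι) :
    H.dbS m (J b q) = ∑ l, J b l * H.conn l m q := by
  simp only [conn, Finset.mul_sum, ← mul_assoc]
  rw [Finset.sum_comm]
  simp only [← Finset.sum_mul, H.inv_right]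
  simp

theorem dbS_mul (H : IsFrameChange S db D db' D' J Jh) (m : ι) (s t : S) :
    H.dbS m (s * t) = s * H.dbS m t + t * H.dbS m s :=
  Subtype.ext (by simp [dbS])

theorem dbS_sum (H : IsFrameChange S db D db' D' J Jh) (m : ι) (s : ι → S) :
    H.dbS m (∑ i, s i) = ∑ i, H.dbS m (s i) :=
  Subtype.ext (by simp [dbS])

/-- Differentiate J Ĵ = 1 and contract with Ĵ. -/
theorem dbS_Jh (H : IsFrameChange S db D db' D' J Jh) (m c p : ι) :
    H.dbS m (Jh c p) = - ∑ r, Jh c r * H.conn p m r := by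
  have h : ∀ b, ∑ l, (J b l * H.dbS m (Jh c l) + Jh c l * H.dbS m (J b l)) = 0 := by
    intro b
    have := congrArg (H.dbS m) (H.inv_right b c)
    rw [dbS_sum] at this
    simp only [dbS_mul] at this
    rw [this]
    exact Subtype.ext (by simp only [dbS]; split_ifs <;> simp)
  have h2 : ∑ b, Jh b p * ∑ l, (J b l * H.dbS m (Jh c l) + Jh c l * H.dbS m (J b l)) = 0 := by
    simp [h]
  have e1 : ∑ b, ∑ l, Jh b p * (J b l * H.dbS m (Jh c l)) = H.dbS m (Jh c p) := by
    rw [Finset.sum_comm]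
    simp only [← mul_assoc, ← Finset.sum_mul, H.inv_left]
    simp
  have e2 : ∑ b, ∑ l, Jh b p * (Jh c l * H.dbS m (J b l)) = ∑ r, Jh c r * H.conn p m r := by
    rw [Finset.sum_comm]
    simp only [conn, Finset.mul_sum]
    exact Finset.sum_congr rfl fun r _ => Finset.sum_congr rfl fun b _ => by ring
  simp only [Finset.mul_sum, mul_add, Finset.sum_add_distrib, e1, e2] at h2
  linear_combination h2

theorem db_smul (H : IsFrameChange S db D db' D' J Jh) (m : ι) (s : S) (x : A) :
    db m (s • x) = s • db m x + H.dbS m s • x := by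
  simp only [Subalgebra.smul_def, smul_eq_mul, Derivation.leibniz, dbS]
  ring

theorem D_smul (H : IsFrameChange S db D db' D' J Jh) (m : ι) (s : S) (x : A) :
    D m (s • x) = s • D m x := (endOver S (D m) (H.D_eq_zero m)).map_smul s x

theorem lieK_smul (H : IsFrameChange S db D db' D' J Jh) (m l : ι) (s : S) (x : A) :
    lieK db D m l (s • x) = s • lieK db D m l x :=
  (endOver S _ (H.lieK_eq_zero m l)).map_smul s x

theorem db_sum_Jh (H : IsFrameChange S db D db' D' J Jh) (m c : ι) (y : ι → A) :
    db m (∑ p, Jh c p • y p) = ∑ p, Jh c p • (db m (y p) - ∑ r, H.conn r m p • y r) := by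
  simp only [map_sum, H.db_smul, H.dbS_Jh, smul_sub, Finset.sum_sub_distrib,
    Finset.sum_add_distrib, neg_smul, Finset.sum_neg_distrib, Finset.sum_smul, Finset.smul_sum,
    smul_smul]
  rw [Finset.sum_comm (f := fun x y_1 => (Jh c y_1 * H.conn x m y_1) • y x)]
  exact (sub_eq_add_neg _ _).symm

theorem db_sum_J (H : IsFrameChange S db D db' D' J Jh) (m c : ι) (y : ι → A) :
    db m (∑ l, J c l • y l) = ∑ l, J c l • (db m (y l) + ∑ q, H.conn l m q • y q) := by
  simp only [map_sum, H.db_smul, H.dbS_J, smul_add, Finset.sum_add_distrib, Finset.sum_smul,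
    Finset.smul_sum, smul_smul]
  rw [Finset.sum_comm (f := fun x y_1 => (J c y_1 * H.conn y_1 m x) • y x)]

/-- `K̃_m^l = K_m^l + G^l_{mq} D^q`. -/
def shiftK (H : IsFrameChange S db D db' D' J Jh) (m l : ι) (x : A) : A :=
  lieK db D m l x + ∑ q, H.conn l m q • D q x

/-- D passes through the antiholomorphic factors, so the only inhomogeneous term comes from ∂̄
acting on J. -/
theorem lieK'_apply (H : IsFrameChange S db D db' D' J Jh) (c b : ι) (x : A) :
    lieK db' D' c b x = ∑ m, Jh c m • ∑ l, J b l • H.shiftK m l x := by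
  have e : D' b (db' c x) = ∑ m, Jh c m • ∑ l, J b l • D l (db m x) := by
    rw [H.D'_apply, H.db'_apply]
    simp only [map_sum, H.D_smul, Finset.smul_sum]
    rw [Finset.sum_comm]
    simp only [smul_smul, mul_comm]
  rw [IsSeparated.lieK_def, H.D'_apply, H.db'_apply, e, ← Finset.sum_sub_distrib]
  refine Finset.sum_congr rfl fun m _ => ?_
  rw [H.db_sum_J, ← smul_sub, ← Finset.sum_sub_distrib]
  congr 1
  refine Finset.sum_congr rfl fun l _ => ?_
  rw [← smul_sub, shiftK, IsSeparated.lieK_def]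
  congr 1
  ring

/-- The covariant form of `W_{ab}^l`. -/
def shiftW (H : IsFrameChange S db D db' D' J Jh) (a b l : ι) (x : A) : A :=
  lieW db D a b l x + ∑ q, H.dbS a (H.conn l b q) • D q x + ∑ q, H.conn l b q • lieK db D a q x
    + ∑ c, H.conn l a c • H.shiftK b c x - ∑ c, H.conn c a b • H.shiftK c l x

/-- One more ∂̄ differentiates J, Ĵ and the connection coefficients; together these terms form the
covariant derivative of the shifted K. -/
theorem lieW'_apply (H : IsFrameChange S db D db' D' J Jh) (a c b : ι) (x : A) :
    lieW db' D' a c b x = ∑ m, Jh a m • ∑ p, Jh c p • ∑ l, J b l • H.shiftW m p l x := by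
  have e : lieK db' D' c b (db' a x)
      = ∑ m, Jh a m • ∑ p, Jh c p • ∑ l, J b l • H.shiftK p l (db m x) := by
    have := (endOver S _ (H.lieK'_eq_zero c b)).map_smul
    simp only [endOver_apply] at this
    rw [H.db'_apply]
    simp only [map_sum, this]
    simp only [H.lieK'_apply]
  rw [IsSeparated.lieW_def, H.db'_apply, e, ← Finset.sum_sub_distrib]
  refine Finset.sum_congr rfl fun m _ => ?_
  rw [H.lieK'_apply, H.db_sum_Jh, ← smul_sub, ← Finset.sum_sub_distrib]
  congr 1
  refine Finset.sum_congr rfl fun p _ => ?_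
  rw [← smul_sub, H.db_sum_J]
  congr 1
  have e2 : ∑ r, H.conn r m p • ∑ l, J b l • H.shiftK r l x
      = ∑ l, J b l • ∑ r, H.conn r m p • H.shiftK r l x := by
    simp only [Finset.smul_sum]
    rw [Finset.sum_comm]
    simp only [smul_smul, mul_comm]
  rw [e2, ← Finset.sum_sub_distrib, ← Finset.sum_sub_distrib]
  refine Finset.sum_congr rfl fun l _ => ?_
  rw [← smul_sub, ← smul_sub]
  congr 1
  have e3 : db m (H.shiftK p l x) - H.shiftK p l (db m x)
      = lieW db D m p l x + ∑ q, H.dbS m (H.conn l p q) • D q x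
        + ∑ q, H.conn l p q • lieK db D m q x := by
    simp only [shiftK, map_add, map_sum, H.db_smul, IsSeparated.lieW_def, IsSeparated.lieK_def,
      smul_sub, Finset.sum_add_distrib, Finset.sum_sub_distrib]
    ring
  rw [shiftW, ← e3]
  ring

/-- `D^l` as an `S`-linear operator. -/
def endD (H : IsFrameChange S db D db' D' J Jh) (l : ι) : Module.End S A :=
  endOver S (D l) (H.D_eq_zero l)

/-- `K_m^l` as an `S`-linear operator. -/
def endK (H : IsFrameChange S db D db' D' J Jh) (m l : ι) : Module.End S A :=
  endOver S _ (H.lieK_eq_zero m l)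

/-- `W_{ab}^l` as an `S`-linear operator. -/
def endW (H : IsFrameChange S db D db' D' J Jh) (a m l : ι) : Module.End S A :=
  endOver S _ (H.lieW_eq_zero a m l)

theorem genU_apply (H : IsFrameChange S db D db' D' J Jh) (l : ι) (x : A) :
    opU db D l x = (1 / 2 : ℂ) • genU H.endD H.endK l x := by
  simp [opU, genU, endD, endK]

/-- As an element of End_S(A), V is a noncommutative polynomial in S-linear operators, so the
identities for abstract operator algebras apply to it. -/
theorem genV_apply (H : IsFrameChange S db D db' D' J Jh) (l : ι) (x : A) :
    opV db D l x = (1 / 12 : ℂ) • genV H.endD H.endK H.endW l x := by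
  have e3 : ∀ x : A, 3 * x = x + x + x := fun x => by ring
  have eThree : ∀ x : Module.End S A, 3 * x = x + x + x := fun x => by noncomm_ring
  simp only [opV, genV, endD, endK, endW, Finset.sum_add_distrib, Finset.sum_sub_distrib,
    LinearMap.add_apply, LinearMap.sub_apply, LinearMap.sum_apply, Module.End.mul_apply,
    endOver_apply, two_mul, e3, eThree]

/-- The second order term of the left multiplication in the new frame. -/
def shiftU (H : IsFrameChange S db D db' D' J Jh) (l : ι) (x : A) : A :=
  opU db D l x + (1 / 2 : ℂ) • ∑ m, ∑ q, H.conn l m q • D q (D m x)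

/-- The third order term of the left multiplication in the new frame. -/
def shiftV (H : IsFrameChange S db D db' D' J Jh) (l : ι) (x : A) : A :=
  opV db D l x
    + (1 / 6 : ℂ) • ∑ a, ∑ b, ∑ q, H.dbS a (H.conn l b q) • D a (D b (D q x))
    + (1 / 6 : ℂ) • ∑ a, ∑ b, H.conn l a b • ∑ c, ∑ q, H.conn b c q • D a (D c (D q x))
    + (1 / 2 : ℂ) • ∑ a, ∑ b, H.conn l a b • (D a (opU db D b x) + opU db D a (D b x))

theorem opU'_apply (H : IsFrameChange S db D db' D' J Jh) (b : ι) (x : A) :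
    opU db' D' b x = ∑ l, J b l • H.shiftU l x := by
  have h := genU_frame H.inv_left H.endD
    (fun m l => H.endK m l + ∑ q, H.conn l m q • H.endD q) b
  have e1 : opU db' D' b x = (1 / 2 : ℂ) • (genU (fun b => ∑ l, J b l • H.endD l)
      (fun c b => ∑ m, Jh c m • ∑ l, J b l • (H.endK m l + ∑ q, H.conn l m q • H.endD q)) b) x := by
    simp only [opU, genU, LinearMap.sum_apply, Module.End.mul_apply, H.lieK'_apply,
      H.D'_apply, shiftK, LinearMap.smul_apply, LinearMap.add_apply, endD, endK, endOver_apply]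
  rw [e1, h]
  simp only [LinearMap.sum_apply, LinearMap.smul_apply, Finset.smul_sum, shiftU, H.genU_apply]
  refine Finset.sum_congr rfl fun l _ => ?_
  rw [smul_comm]
  congr 1
  simp only [genU, add_mul, Finset.sum_add_distrib, LinearMap.add_apply, LinearMap.sum_apply,
    Finset.sum_mul, smul_mul_assoc, LinearMap.smul_apply, Module.End.mul_apply, smul_add,
    Finset.smul_sum, endD, endK, endOver_apply]

theorem opV'_apply (H : IsFrameChange S db D db' D' J Jh) (b : ι) (x : A) :
    opV db' D' b x = ∑ l, J b l • H.shiftV l x := by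
  have h := genV_frame H.inv_left H.endD
    (fun m l => H.endK m l + ∑ q, H.conn l m q • H.endD q)
    (fun a b l => H.endW a b l + ∑ q, H.dbS a (H.conn l b q) • H.endD q
      + ∑ q, H.conn l b q • H.endK a q
      + ∑ c, H.conn l a c • (H.endK b c + ∑ q, H.conn c b q • H.endD q)
      - ∑ c, H.conn c a b • (H.endK c l + ∑ q, H.conn l c q • H.endD q)) b
  have hD : ∀ a b, H.endD a * H.endD b = H.endD b * H.endD a := by
    intro a b
    ext x
    exact H.comm_D a b x
  have h' := fun l => genV_shift hD H.endK H.endW H.conn_symm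
    (fun a l b q => H.dbS a (H.conn l b q)) l
  simp only [h'] at h
  have e1 : opV db' D' b x = (1 / 12 : ℂ) • (genV (fun b => ∑ l, J b l • H.endD l)
      (fun c b => ∑ m, Jh c m • ∑ l, J b l • (H.endK m l + ∑ q, H.conn l m q • H.endD q))
      (fun a c b => ∑ m, Jh a m • ∑ p, Jh c p • ∑ l, J b l •
        (H.endW m p l + ∑ q, H.dbS m (H.conn l p q) • H.endD q
          + ∑ q, H.conn l p q • H.endK m q
          + ∑ c, H.conn l m c • (H.endK p c + ∑ q, H.conn c p q • H.endD q)
          - ∑ c, H.conn c m p • (H.endK c l + ∑ q, H.conn l c q • H.endD q))) b) x := by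
    have e3 : ∀ x : A, 3 * x = x + x + x := fun x => by ring
    have eThree : ∀ x : Module.End S A, 3 * x = x + x + x := fun x => by noncomm_ring
    simp only [opV, genV, LinearMap.sum_apply, Module.End.mul_apply, LinearMap.add_apply,
      LinearMap.sub_apply, two_mul, e3, eThree, Finset.sum_add_distrib, Finset.sum_sub_distrib]
    simp only [H.lieW'_apply, shiftW, H.lieK'_apply,
      H.D'_apply, shiftK, LinearMap.smul_apply, LinearMap.sum_apply, LinearMap.add_apply,
      LinearMap.sub_apply, endD, endK, endW, endOver_apply]
  rw [e1, h]
  rw [LinearMap.sum_apply, Finset.smul_sum]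
  refine Finset.sum_congr rfl fun l _ => ?_
  rw [LinearMap.smul_apply, smul_comm, shiftV, H.genV_apply]
  congr 1
  have ra : ∑ a, ∑ b, ∑ q, H.dbS a (H.conn l b q) • D a (D b (D q x))
      = (∑ a, ∑ b, (∑ q, H.dbS a (H.conn l b q) • H.endD q) * H.endD a * H.endD b) x := by
    simp only [Finset.sum_mul, smul_mul_assoc, LinearMap.sum_apply, LinearMap.smul_apply,
      Module.End.mul_apply, endD, endOver_apply]
    refine Finset.sum_congr rfl fun a _ => Finset.sum_congr rfl fun b _ =>
      Finset.sum_congr rfl fun q _ => ?_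
    rw [H.comm_D b q, H.comm_D a q]
  have rb : ∑ a, ∑ b, H.conn l a b • ∑ c, ∑ q, H.conn b c q • D a (D c (D q x))
      = (∑ a, ∑ b, (∑ q, H.conn l a q • H.endD q) * (∑ q, H.conn a b q • H.endD q) * H.endD b)
        x := by
    simp only [Finset.sum_mul, Finset.mul_sum, smul_mul_assoc, mul_smul_comm, LinearMap.sum_apply,
      LinearMap.smul_apply, Module.End.mul_apply, endD, endOver_apply, Finset.smul_sum]
    rw [Finset.sum_comm]
    refine Finset.sum_congr rfl fun b _ => ?_
    rw [Finset.sum_comm]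
    refine Finset.sum_congr rfl fun c _ => ?_
    rw [Finset.sum_comm]
    refine Finset.sum_congr rfl fun a _ => Finset.sum_congr rfl fun q _ => ?_
    rw [smul_comm, H.conn_symm l q b, H.comm_D c a]
  have rc : ∑ a, ∑ b, H.conn l a b • (D a (opU db D b x) + opU db D a (D b x))
      = (1 / 2 : ℂ) • ((∑ a, ∑ b, H.endK b a * (∑ q, H.conn l a q • H.endD q) * H.endD b) x
        + (∑ a, ∑ b, (∑ q, H.conn l a q • H.endD q) * H.endK b a * H.endD b) x) := by
    have k1 : (∑ a, ∑ b, H.endK b a * (∑ q, H.conn l a q • H.endD q) * H.endD b) x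
        = ∑ a, ∑ b, ∑ q, H.conn l a q • lieK db D b a (D q (D b x)) := by
      simp only [LinearMap.sum_apply, Module.End.mul_apply, LinearMap.smul_apply, endD, endK,
        endOver_apply, map_sum, H.lieK_smul]
    have k2 : (∑ a, ∑ b, (∑ q, H.conn l a q • H.endD q) * H.endK b a * H.endD b) x
        = ∑ a, ∑ b, ∑ q, H.conn l a q • D q (lieK db D b a (D b x)) := by
      simp only [LinearMap.sum_apply, Module.End.mul_apply, LinearMap.smul_apply, endD, endK,
        endOver_apply]
    have k3 : ∑ a, ∑ b, H.conn l a b • D a (opU db D b x)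
        = (1 / 2 : ℂ) • ∑ a, ∑ b, ∑ q, H.conn l a q • D q (lieK db D b a (D b x)) := by
      simp only [opU, map_sum, Derivation.map_smul, Finset.smul_sum]
      rw [Finset.sum_comm]
      refine Finset.sum_congr rfl fun a _ => ?_
      rw [Finset.sum_comm]
      refine Finset.sum_congr rfl fun b _ => Finset.sum_congr rfl fun q _ => ?_
      rw [smul_comm, H.conn_symm]
    have k4 : ∑ a, ∑ b, H.conn l a b • opU db D a (D b x)
        = (1 / 2 : ℂ) • ∑ a, ∑ b, ∑ q, H.conn l a q • lieK db D b a (D q (D b x)) := by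
      simp only [opU, Finset.smul_sum]
      refine Finset.sum_congr rfl fun a _ => ?_
      rw [Finset.sum_comm]
      refine Finset.sum_congr rfl fun b _ => Finset.sum_congr rfl fun q _ => ?_
      rw [smul_comm, H.comm_D b q]
    simp only [smul_add, Finset.sum_add_distrib]
    rw [k1, k2, k3, k4, add_comm]
  rw [ra, rb, rc]
  have eThree : ∀ x : Module.End S A, 3 * x = x + x + x := fun x => by noncomm_ring
  simp only [LinearMap.add_apply, two_mul, eThree]
  module

/-- Second derivatives with respect to the connection of the frame change. -/
def nabla2 (H : IsFrameChange S db D db' D' J Jh) (f : A) (m p : ι) : A :=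
  db m (db p f) - ∑ r, H.conn r m p • db r f

/-- Third derivatives with respect to the connection of the frame change. -/
def nabla3 (H : IsFrameChange S db D db' D' J Jh) (f : A) (m p q : ι) : A :=
  db m (H.nabla2 f p q) - ∑ r, H.conn r m q • H.nabla2 f p r
    - ∑ r, H.conn r m p • H.nabla2 f r q

/-- The ∂̄-derivatives of Ĵ assemble into the second covariant derivative for the frame connection.
-/
theorem db'_db' (H : IsFrameChange S db D db' D' J Jh) (a b : ι) (f : A) :
    db' a (db' b f) = ∑ m, Jh a m • ∑ p, Jh b p • H.nabla2 f m p := by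
  rw [H.db'_apply a, H.db'_apply b]
  simp only [H.db_sum_Jh, nabla2]

theorem db'_db'_db' (H : IsFrameChange S db D db' D' J Jh) (a b c : ι) (f : A) :
    db' a (db' b (db' c f))
      = ∑ m, Jh a m • ∑ p, Jh b p • ∑ q, Jh c q • H.nabla3 f m p q := by
  rw [H.db'_db' b c, H.db'_apply]
  simp only [H.db_sum_Jh, nabla3]
  refine Finset.sum_congr rfl fun m _ => ?_
  congr 1
  refine Finset.sum_congr rfl fun p _ => ?_
  congr 1
  simp only [Finset.smul_sum, smul_sub, Finset.sum_sub_distrib]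
  congr 1
  rw [Finset.sum_comm]
  simp only [smul_smul, mul_comm]

theorem opC1_eq (H : IsFrameChange S db D db' D' J Jh) (f h : A) :
    opC1 db' D' f h = opC1 db D f h := by
  have := sum_contract H.inv_left (LinearMap.mul S A) (fun m => db m f) (fun m => D m h)
  simpa only [opC1, H.db'_apply, H.D'_apply, LinearMap.mul_apply'] using this

theorem sum_contract_mul_two (H : IsFrameChange S db D db' D' J Jh) (x y : ι → ι → A) :
    ∑ a, ∑ b, (∑ m, Jh a m • ∑ p, Jh b p • x m p) * (∑ l, J a l • ∑ q, J b q • y l q)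
      = ∑ m, ∑ p, x m p * y m p := by
  have h1 := fun m => sum_contract H.inv_left (LinearMap.mul S A) (x m) (y m)
  have h2 := fun b => sum_contract H.inv_left (LinearMap.mul S A)
    (fun m => ∑ p, Jh b p • x m p) (fun l => ∑ q, J b q • y l q)
  simp only [LinearMap.mul_apply'] at h1 h2
  rw [Finset.sum_comm]
  simp only [h2]
  rw [Finset.sum_comm]
  simp only [h1]

theorem sum_contract_mul_three (H : IsFrameChange S db D db' D' J Jh) (x y : ι → ι → ι → A) :
    ∑ a, ∑ b, ∑ c, (∑ m, Jh a m • ∑ p, Jh b p • ∑ q, Jh c q • x m p q)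
        * (∑ l, J a l • ∑ r, J b r • ∑ s, J c s • y l r s)
      = ∑ m, ∑ p, ∑ q, x m p q * y m p q := by
  have h1 := fun b c => sum_contract H.inv_left (LinearMap.mul S A)
    (fun m => ∑ p, Jh b p • ∑ q, Jh c q • x m p q) (fun l => ∑ r, J b r • ∑ s, J c s • y l r s)
  simp only [LinearMap.mul_apply'] at h1
  calc _ = ∑ b, ∑ c, ∑ a, (∑ m, Jh a m • ∑ p, Jh b p • ∑ q, Jh c q • x m p q)
        * (∑ l, J a l • ∑ r, J b r • ∑ s, J c s • y l r s) := by
        rw [Finset.sum_comm]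
        exact Finset.sum_congr rfl fun _ _ => Finset.sum_comm
    _ = ∑ b, ∑ c, ∑ m, (∑ p, Jh b p • ∑ q, Jh c q • x m p q)
        * (∑ r, J b r • ∑ s, J c s • y m r s) := by simp only [h1]
    _ = ∑ m, ∑ b, ∑ c, (∑ p, Jh b p • ∑ q, Jh c q • x m p q)
        * (∑ r, J b r • ∑ s, J c s • y m r s) := by
        symm
        rw [Finset.sum_comm]
        exact Finset.sum_congr rfl fun _ _ => Finset.sum_comm
    _ = _ := by simp only [H.sum_contract_mul_two]

theorem D'_D' (H : IsFrameChange S db D db' D' J Jh) (a b : ι) (x : A) :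
    D' a (D' b x) = ∑ l, J a l • ∑ q, J b q • D l (D q x) := by
  rw [H.D'_apply, H.D'_apply]
  simp only [map_sum, H.D_smul]

theorem D'_D'_D' (H : IsFrameChange S db D db' D' J Jh) (a b c : ι) (x : A) :
    D' a (D' b (D' c x)) = ∑ l, J a l • ∑ q, J b q • ∑ t, J c t • D l (D q (D t x)) := by
  rw [H.D'_D' b c, H.D'_apply]
  simp only [map_sum, H.D_smul]

/-- The connection part of U is exactly compensated by the connection part of the second derivatives
of f. -/
theorem opC2_eq (H : IsFrameChange S db D db' D' J Jh) (f h : A) :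
    opC2 db' D' f h = opC2 db D f h := by
  have h1 := sum_contract H.inv_left (LinearMap.mul S A) (fun m => db m f)
    (fun m => H.shiftU m h)
  have h2 := H.sum_contract_mul_two (H.nabla2 f) (fun l q => D l (D q h))
  simp only [LinearMap.mul_apply'] at h1
  simp only [opC2, H.db'_db', H.D'_D', h2]
  simp only [H.db'_apply, H.opU'_apply, h1]
  simp only [shiftU, nabla2]
  have : ∑ m, db m f * ∑ a, ∑ q, H.conn m a q • D q (D a h)
      = ∑ a, ∑ q, (∑ r, H.conn r a q • db r f) * D a (D q h) := by
    simp only [Finset.mul_sum, Finset.sum_mul]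
    rw [Finset.sum_comm]
    refine Finset.sum_congr rfl fun a _ => ?_
    rw [Finset.sum_comm]
    refine Finset.sum_congr rfl fun q _ => Finset.sum_congr rfl fun r _ => ?_
    rw [mul_smul_comm, smul_mul_assoc, H.comm_D q a]
  simp only [mul_add, sub_mul, Finset.sum_add_distrib, Finset.sum_sub_distrib, mul_smul_comm,
    ← Finset.smul_sum, this]
  module

theorem nabla2_symm (H : IsFrameChange S db D db' D' J Jh) (f : A) (m p : ι) :
    H.nabla2 f m p = H.nabla2 f p m := by
  simp only [nabla2, H.comm_db m p, H.conn_symm _ m p]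

theorem D_shiftU (H : IsFrameChange S db D db' D' J Jh) (l q : ι) (h : A) :
    D l (H.shiftU q h) + H.shiftU l (D q h) = D l (opU db D q h) + opU db D l (D q h)
      + (1 / 2 : ℂ) • (∑ m, ∑ r, H.conn q m r • D l (D m (D r h))
        + ∑ m, ∑ r, H.conn l m r • D q (D m (D r h))) := by
  simp only [shiftU, map_add, Derivation.map_smul, map_sum, H.D_smul]
  have e1 : ∑ m, ∑ r, H.conn q m r • D l (D r (D m h))
      = ∑ m, ∑ r, H.conn q m r • D l (D m (D r h)) :=
    Finset.sum_congr rfl fun m _ => Finset.sum_congr rfl fun r _ => by rw [H.comm_D r m]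
  have e2 : ∑ m, ∑ r, H.conn l m r • D r (D m (D q h))
      = ∑ m, ∑ r, H.conn l m r • D q (D m (D r h)) :=
    Finset.sum_congr rfl fun m _ => Finset.sum_congr rfl fun r _ => by
      rw [H.comm_D m q, H.comm_D r q, H.comm_D r m]
  rw [e1, e2]
  module

/-- After contraction the Jacobians disappear, and only the connection terms have to cancel: those
in the second and third covariant derivatives of f against those in U and V. -/
theorem opC3_eq (H : IsFrameChange S db D db' D' J Jh) (f h : A) :
    opC3 db' D' f h = opC3 db D f h := by
  have h1 := sum_contract H.inv_left (LinearMap.mul S A) (fun m => db m f)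
    (fun m => H.shiftV m h)
  have h2 := H.sum_contract_mul_two (H.nabla2 f)
    (fun l q => D l (H.shiftU q h) + H.shiftU l (D q h))
  have h3 := H.sum_contract_mul_three (H.nabla3 f) (fun l q t => D l (D q (D t h)))
  simp only [LinearMap.mul_apply'] at h1
  have hUs : ∀ l (s : S) (x : A), H.shiftU l (s • x) = s • H.shiftU l x := by
    intro l s x
    simp only [shiftU, opU, H.lieK_smul, H.D_smul, smul_add, Finset.smul_sum]
    congr 1
    · exact Finset.sum_congr rfl fun m _ => smul_comm _ _ _
    · refine Finset.sum_congr rfl fun m _ => Finset.sum_congr rfl fun q _ => ?_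
      rw [smul_comm (H.conn l m q) s, smul_comm _ s]
  have hU : ∀ l (x : ι → A), H.shiftU l (∑ q, x q) = ∑ q, H.shiftU l (x q) := by
    intro l x
    let φ : A →+ A :=
      { toFun := H.shiftU l
        map_zero' := by simp [shiftU, opU]
        map_add' := fun x y => by
          simp only [shiftU, opU, map_add, smul_add, Finset.sum_add_distrib]
          ring }
    exact map_sum φ x _
  have hY : ∀ b c, D' b (opU db' D' c h) + opU db' D' b (D' c h)
      = ∑ l, J b l • ∑ q, J c q • (D l (H.shiftU q h) + H.shiftU l (D q h)) := by
    intro b c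
    rw [H.opU'_apply, H.opU'_apply, H.D'_apply, H.D'_apply]
    simp only [map_sum, H.D_smul, hU, hUs, smul_add, Finset.sum_add_distrib]
  simp only [opC3, H.db'_db'_db', H.D'_D'_D', hY, h3]
  simp only [H.db'_db', h2]
  simp only [H.db'_apply, H.opV'_apply, h1, H.D_shiftU]
  set ψ : ι → ι → ι → A := fun a b c => D a (D b (D c h)) with hψ
  set g : ι → ι → A := fun q l => ∑ m, ∑ r, H.conn q m r • ψ l m r with hg
  set Y : ι → ι → A := fun l q => D l (opU db D q h) + opU db D l (D q h) with hYd
  have kV : ∑ m, db m f * H.shiftV m h = ∑ m, db m f * opV db D m h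
      + (1 / 6 : ℂ) • ∑ m, db m f * ∑ a, ∑ b, ∑ q, H.dbS a (H.conn m b q) • ψ a b q
      + (1 / 6 : ℂ) • ∑ m, db m f * ∑ a, ∑ b, H.conn m a b • g b a
      + (1 / 2 : ℂ) • ∑ m, db m f * ∑ a, ∑ b, H.conn m a b • Y a b := by
    simp only [shiftV, mul_add, Finset.sum_add_distrib, mul_smul_comm, ← Finset.smul_sum]
    rfl
  have ex : ∀ Z : ι → ι → A, ∑ m, ∑ p, (∑ r, H.conn r m p • db r f) * Z m p
      = ∑ r, db r f * ∑ a, ∑ b, H.conn r a b • Z a b := by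
    intro Z
    simp only [Finset.sum_mul, Finset.mul_sum, smul_mul_assoc, mul_smul_comm]
    symm
    rw [Finset.sum_comm]
    exact Finset.sum_congr rfl fun _ _ => Finset.sum_comm
  -- The order of the indices of g is immaterial here, because the covariant Hessian of f is
  -- symmetric.
  have gs : ∑ m, ∑ p, H.nabla2 f m p * g m p = ∑ m, ∑ p, H.nabla2 f m p * g p m := by
    rw [Finset.sum_comm]
    simp only [fun m p => H.nabla2_symm f p m]
  have kU : ∑ m, ∑ p, H.nabla2 f m p * (D m (opU db D p h) + opU db D m (D p h)
      + (1 / 2 : ℂ) • (∑ a, ∑ r, H.conn p a r • D m (D a (D r h))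
        + ∑ a, ∑ r, H.conn m a r • D p (D a (D r h))))
      = ∑ m, ∑ p, db m (db p f) * Y m p - ∑ r, db r f * ∑ a, ∑ b, H.conn r a b • Y a b
        + ∑ m, ∑ p, H.nabla2 f m p * g p m := by
    have : ∀ m p, H.nabla2 f m p * (D m (opU db D p h) + opU db D m (D p h)
      + (1 / 2 : ℂ) • (∑ a, ∑ r, H.conn p a r • D m (D a (D r h))
        + ∑ a, ∑ r, H.conn m a r • D p (D a (D r h))))
        = db m (db p f) * Y m p - (∑ r, H.conn r m p • db r f) * Y m p
          + (1 / 2 : ℂ) • (H.nabla2 f m p * g p m) + (1 / 2 : ℂ) • (H.nabla2 f m p * g m p) := by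
      intro m p
      rw [← sub_mul]
      change H.nabla2 f m p * (Y m p + (1 / 2 : ℂ) • (g p m + g m p)) = H.nabla2 f m p * Y m p + _ + _
      generalize Y m p = y
      rw [mul_add, mul_smul_comm, mul_add, smul_add, add_assoc]
    simp only [this, Finset.sum_add_distrib, Finset.sum_sub_distrib, ex, ← Finset.smul_sum, gs]
    module
  -- ψ is totally symmetric, so the two correction terms containing the covariant Hessian contribute
  -- the same sum; hence the factor 2.
  have k3 : ∑ m, ∑ p, ∑ q, H.nabla3 f m p q * ψ m p q
      = ∑ m, ∑ p, ∑ q, db m (db p (db q f)) * ψ m p q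
        - ∑ m, db m f * ∑ a, ∑ b, ∑ q, H.dbS a (H.conn m b q) • ψ a b q
        - ∑ m, ∑ p, db m (db p f) * g p m - (2 : ℂ) • ∑ m, ∑ p, H.nabla2 f m p * g p m := by
    have e1 : ∑ m, ∑ p, ∑ q, (∑ r, H.conn r m p • H.nabla2 f r q) * ψ m p q
        = ∑ m, ∑ p, H.nabla2 f m p * g p m := by
      rw [← gs]
      simp only [hg, Finset.sum_mul, Finset.mul_sum, smul_mul_assoc, mul_smul_comm]
      rw [sum_comm_pairs, Finset.sum_comm]
      refine Finset.sum_congr rfl fun m _ => Finset.sum_congr rfl fun p _ =>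
        Finset.sum_congr rfl fun a _ => Finset.sum_congr rfl fun r _ => ?_
      simp only [hψ]
      rw [H.comm_D r p, H.comm_D a p]
    have e2 : ∑ m, ∑ p, ∑ q, (∑ r, H.conn r m q • H.nabla2 f p r) * ψ m p q
        = ∑ m, ∑ p, H.nabla2 f m p * g p m := by
      simp only [hg, Finset.sum_mul, Finset.mul_sum, smul_mul_assoc, mul_smul_comm]
      rw [Finset.sum_comm]
      refine Finset.sum_congr rfl fun m _ => ?_
      rw [← sum_rotate]
      refine Finset.sum_congr rfl fun p _ => Finset.sum_congr rfl fun a _ =>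
        Finset.sum_congr rfl fun r _ => ?_
      simp only [hψ]
      rw [H.comm_D m a]
    have e3 : ∑ m, ∑ p, ∑ q, (∑ r, H.conn r p q • db m (db r f)) * ψ m p q
        = ∑ m, ∑ p, db m (db p f) * g p m := by
      simp only [hg, Finset.sum_mul, Finset.mul_sum, smul_mul_assoc, mul_smul_comm]
      refine Finset.sum_congr rfl fun m _ => ?_
      rw [← sum_rotate]
    have e4 : ∑ m, ∑ p, ∑ q, (∑ r, H.dbS m (H.conn r p q) • db r f) * ψ m p q
        = ∑ m, db m f * ∑ a, ∑ b, ∑ q, H.dbS a (H.conn m b q) • ψ a b q := by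
      simp only [Finset.sum_mul, Finset.mul_sum, smul_mul_assoc, mul_smul_comm]
      symm
      rw [Finset.sum_comm]
      refine Finset.sum_congr rfl fun m _ => ?_
      rw [Finset.sum_comm]
      exact Finset.sum_congr rfl fun m _ => Finset.sum_comm
    have : ∀ m p q, H.nabla3 f m p q * ψ m p q = db m (db p (db q f)) * ψ m p q
        - (∑ r, H.conn r p q • db m (db r f)) * ψ m p q
        - (∑ r, H.dbS m (H.conn r p q) • db r f) * ψ m p q
        - (∑ r, H.conn r m q • H.nabla2 f p r) * ψ m p q
        - (∑ r, H.conn r m p • H.nabla2 f r q) * ψ m p q := by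
      intro m p q
      rw [nabla3]
      conv_lhs => enter [1, 1, 1]; rw [nabla2]
      simp only [map_sub, map_sum, H.db_smul, Finset.sum_add_distrib]
      ring
    simp only [this, Finset.sum_sub_distrib, e1, e2, e3, e4]
    module
  have k4 : ∑ m, ∑ p, H.nabla2 f m p * g p m = ∑ m, ∑ p, db m (db p f) * g p m
      - ∑ m, db m f * ∑ a, ∑ b, H.conn m a b • g b a := by
    rw [← ex fun a b => g b a]
    simp only [nabla2, sub_mul, Finset.sum_sub_distrib]
  rw [kV, kU, k3, k4]
  module

end IsFrameChange

end FrameChange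

end SepVar
end

/-! ### Kähler frames and the covariant form of the operators -/

noncomputable section
set_option linter.unusedSectionVars false

namespace SepVar

section Kahler

variable {ι : Type*} [Fintype ι] [DecidableEq ι] {A : Type*} [CommRing A] [Algebra ℂ A]

section Definitions

variable (db D : ι → Derivation ℂ A A) (G : ι → ι → ι → A)

/-- Second covariant derivatives for the connection with coefficients `-G`. -/
def covTwo (φ : A) (l q : ι) : A := db q (db l φ) + ∑ t, G t l q * db t φ

/-- Third covariant derivatives for the connection with coefficients `-G`. -/
def covThree (φ : A) (l q t : ι) : A :=
  db t (covTwo db G φ l q) + ∑ a, G a l t * covTwo db G φ a q + ∑ a, G a q t * covTwo db G φ l a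

/-- `½ φ_{/l̄q̄} D^l D^q ψ`. -/
def stdC2 (φ ψ : A) : A := (1 / 2 : ℂ) • ∑ l, ∑ q, covTwo db G φ l q * D l (D q ψ)

/-- `⅙ φ_{/l̄q̄t̄} D^l D^q D^t ψ + ¼ φ_{/l̄q̄} (D^l G^q_{rs}) D^r D^s ψ`. -/
def stdC3 (φ ψ : A) : A :=
  (1 / 6 : ℂ) • ∑ l, ∑ q, ∑ t, covThree db G φ l q t * D l (D q (D t ψ))
    + (1 / 4 : ℂ) • ∑ l, ∑ q, covTwo db G φ l q * ∑ r, ∑ s, D l (G q r s) * D r (D s ψ)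

/-- The correction term, quadratic in the curvature. -/
def stdR (φ ψ : A) : A :=
  ∑ l, db l φ * ∑ a, ∑ b, ∑ s, ∑ t, D b (G l a s) * D s (G a b t) * D t ψ

end Definitions

/-- The derivations `D^l` of a Kähler metric: the commutators `[∂̄_m, D^l]` are combinations
`G^l_{mq} D^q`, where `-G` are the Christoffel symbols. -/
structure IsKahlerFrame (db D : ι → Derivation ℂ A A) (G : ι → ι → ι → A) : Prop where
  comm_db : ∀ a b f, db a (db b f) = db b (db a f)
  comm_D : ∀ a b f, D a (D b f) = D b (D a f)
  symm : ∀ l a b, G l a b = G l b a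
  lieK_apply : ∀ m l x, lieK db D m l x = ∑ q, G l m q * D q x

namespace IsKahlerFrame

variable {db D : ι → Derivation ℂ A A} {G : ι → ι → ι → A}

theorem opU_apply (H : IsKahlerFrame db D G) (l : ι) (x : A) :
    opU db D l x = (1 / 2 : ℂ) • ∑ m, ∑ q, G l m q * D m (D q x) := by
  simp only [opU, H.lieK_apply]
  congr 1
  exact Finset.sum_congr rfl fun m _ => Finset.sum_congr rfl fun q _ => by rw [H.comm_D]

theorem lieW_apply (H : IsKahlerFrame db D G) (a b l : ι) (x : A) :
    lieW db D a b l x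
      = ∑ s, db a (G l b s) * D s x + ∑ s, ∑ t, G l b s * G s a t * D t x := by
  rw [IsSeparated.lieW_def]
  simp only [H.lieK_apply, map_sum, Derivation.leibniz, smul_eq_mul, IsSeparated.db_D db D,
    mul_add, Finset.sum_add_distrib, Finset.mul_sum]
  simp only [mul_comm (D _ _), mul_assoc]
  ring

/-- Substitution of K = GD expresses V through three, two and one D's acting on x. The only first
order part is quadratic in the derivatives of G and becomes the correction R. -/
theorem opV_apply (H : IsKahlerFrame db D G) (l : ι) (x : A) :
    (12 : ℂ) • opV db D l x = 2 * ∑ a, ∑ b, ∑ s, db a (G l b s) * D a (D b (D s x))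
      + 4 * ∑ a, ∑ b, ∑ s, ∑ t, G l a s * G a b t * D s (D b (D t x))
      + 3 * ∑ a, ∑ b, ∑ s, ∑ t, G l a s * D s (G a b t) * D b (D t x)
      + ∑ a, ∑ b, ∑ s, ∑ t, D b (G l a s) * D s (G a b t) * D t x := by
  have t1 : ∑ a, ∑ b, lieW db D a b l (D a (D b x))
      = ∑ a, ∑ b, ∑ s, db a (G l b s) * D a (D b (D s x))
        + ∑ a, ∑ b, ∑ s, ∑ t, G l a s * G a b t * D s (D b (D t x)) := by
    simp only [H.lieW_apply, Finset.sum_add_distrib]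
    congr 1
    · refine Finset.sum_congr rfl fun a _ => Finset.sum_congr rfl fun b _ =>
        Finset.sum_congr rfl fun s _ => ?_
      rw [H.comm_D s a, H.comm_D s b]
    · calc _ = ∑ a, ∑ s, ∑ b, ∑ t, G l b s * G s a t * D t (D a (D b x)) :=
            Finset.sum_congr rfl fun a _ => Finset.sum_comm
        _ = ∑ s, ∑ a, ∑ b, ∑ t, G l b s * G s a t * D t (D a (D b x)) := Finset.sum_comm
        _ = _ := by
            refine Finset.sum_congr rfl fun s _ => Finset.sum_congr rfl fun a _ =>
              Finset.sum_congr rfl fun b _ => Finset.sum_congr rfl fun t _ => ?_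
            rw [H.comm_D a b, H.comm_D t b, H.comm_D t a, H.symm l b s]
  have t2 : ∑ a, ∑ b, lieK db D a l (lieK db D b a (D b x))
      = ∑ a, ∑ b, ∑ s, ∑ t, (G l a s * G a b t * D s (D b (D t x))
        + G l a s * D s (G a b t) * D b (D t x)) := by
    simp only [H.lieK_apply, map_sum, Derivation.leibniz, smul_eq_mul, Finset.mul_sum]
    refine Finset.sum_congr rfl fun a _ => Finset.sum_congr rfl fun b _ =>
        Finset.sum_congr rfl fun s _ => Finset.sum_congr rfl fun t _ => ?_
    rw [H.comm_D t b]
    ring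
  have t3 : ∑ a, ∑ b, lieK db D b a (lieK db D a l (D b x))
      = ∑ a, ∑ b, ∑ s, ∑ t, (G l a s * G a b t * D s (D b (D t x))
        + G a b t * D b (G l a s) * D s (D t x)) := by
    simp only [H.lieK_apply, map_sum, Derivation.leibniz, smul_eq_mul, Finset.mul_sum]
    refine Finset.sum_congr rfl fun a _ => ?_
    calc _ = ∑ b, ∑ t, ∑ s, (G a b t * (G l a s * D t (D s (D b x)))
          + G a b t * (D s (D b x) * D t (G l a s))) := by simp only [mul_add]
      _ = ∑ t, ∑ b, ∑ s, (G a b t * (G l a s * D t (D s (D b x)))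
          + G a b t * (D s (D b x) * D t (G l a s))) := Finset.sum_comm
      _ = _ := by
        refine Finset.sum_congr rfl fun t _ => ?_
        rw [Finset.sum_comm]
        refine Finset.sum_congr rfl fun s _ => Finset.sum_congr rfl fun b _ => ?_
        rw [H.comm_D t s, H.symm a b t]
        ring
  -- The last two terms of V combine into [D^b, K_a^l]K_b^a. Since the D's commute, this commutator
  -- differentiates only the coefficients G.
  have t45 : ∑ a, ∑ b, D b (lieK db D a l (lieK db D b a x))
      - ∑ a, ∑ b, lieK db D a l (D b (lieK db D b a x))
      = ∑ a, ∑ b, ∑ s, ∑ t, (D b (G l a s) * D s (G a b t) * D t x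
        + G a b t * D b (G l a s) * D s (D t x)) := by
    rw [← Finset.sum_sub_distrib]
    refine Finset.sum_congr rfl fun a _ => ?_
    rw [← Finset.sum_sub_distrib]
    refine Finset.sum_congr rfl fun b _ => ?_
    set y := lieK db D b a x with hy
    have e : D b (lieK db D a l y) - lieK db D a l (D b y) = ∑ s, D b (G l a s) * D s y := by
      simp only [H.lieK_apply, map_sum, Derivation.leibniz, smul_eq_mul, ← Finset.sum_sub_distrib]
      refine Finset.sum_congr rfl fun s _ => ?_
      rw [H.comm_D b s]
      ring
    rw [e, hy]
    refine Finset.sum_congr rfl fun s _ => ?_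
    simp only [H.lieK_apply, map_sum, Derivation.leibniz, smul_eq_mul, Finset.mul_sum]
    refine Finset.sum_congr rfl fun t _ => ?_
    ring
  simp only [Finset.sum_add_distrib] at t2 t3 t45
  simp only [opV, Finset.sum_add_distrib, Finset.sum_sub_distrib, ← Finset.mul_sum]
  rw [smul_smul, t1, t2, t3]
  norm_num
  linear_combination t45

/-- `∑ G^q_{mr} D^l D^m D^r ψ`. -/
def connD (D : ι → Derivation ℂ A A) (G : ι → ι → ι → A) (ψ : A) (q l : ι) : A :=
  ∑ m, ∑ r, G q m r * D l (D m (D r ψ))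

theorem sum_covTwo (H : IsKahlerFrame db D G) (φ : A) (Z : ι → ι → A) :
    ∑ l, ∑ q, covTwo db G φ l q * Z l q = ∑ l, ∑ q, db l (db q φ) * Z l q
      + ∑ m, db m φ * ∑ l, ∑ q, G m l q * Z l q := by
  simp only [covTwo, add_mul, Finset.sum_add_distrib, Finset.sum_mul, Finset.mul_sum]
  congr 1
  · exact Finset.sum_congr rfl fun l _ => Finset.sum_congr rfl fun q _ => by rw [H.comm_db]
  · symm
    rw [Finset.sum_comm]
    refine Finset.sum_congr rfl fun l _ => ?_
    rw [Finset.sum_comm]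
    exact Finset.sum_congr rfl fun q _ => Finset.sum_congr rfl fun m _ => by ring

theorem covTwo_symm (H : IsKahlerFrame db D G) (φ : A) (l q : ι) :
    covTwo db G φ l q = covTwo db G φ q l := by
  simp only [covTwo, H.comm_db q l, H.symm _ q l]

theorem opC2_eq (H : IsKahlerFrame db D G) (φ ψ : A) : opC2 db D φ ψ = stdC2 db D G φ ψ := by
  rw [stdC2, H.sum_covTwo, opC2]
  simp only [H.opU_apply, mul_smul_comm, ← Finset.smul_sum]
  module

/-- Pairing with the totally symmetric DDDψ identifies the two corrections that contain the
covariant Hessian, whence the factor 2. -/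
theorem sum_covThree (H : IsKahlerFrame db D G) (φ ψ : A) :
    ∑ l, ∑ q, ∑ t, covThree db G φ l q t * D l (D q (D t ψ))
      = ∑ l, ∑ q, ∑ t, db l (db q (db t φ)) * D l (D q (D t ψ))
        + ∑ m, db m φ * ∑ a, ∑ b, ∑ s, db a (G m b s) * D a (D b (D s ψ))
        + ∑ l, ∑ q, db l (db q φ) * connD D G ψ q l
        + 2 * ∑ l, ∑ q, covTwo db G φ l q * connD D G ψ q l := by
  have e1 : ∑ l, ∑ q, ∑ t, (∑ a, G a l t * covTwo db G φ a q) * D l (D q (D t ψ))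
      = ∑ l, ∑ q, covTwo db G φ l q * connD D G ψ q l := by
    simp only [connD, Finset.sum_mul, Finset.mul_sum]
    rw [Finset.sum_comm]
    refine Finset.sum_congr rfl fun l _ => ?_
    rw [← sum_rotate]
    refine Finset.sum_congr rfl fun q _ => Finset.sum_congr rfl fun m _ =>
      Finset.sum_congr rfl fun r _ => ?_
    rw [H.comm_D m l, H.covTwo_symm φ q l]
    ring
  have e2 : ∑ l, ∑ q, ∑ t, (∑ a, G a q t * covTwo db G φ l a) * D l (D q (D t ψ))
      = ∑ l, ∑ q, covTwo db G φ l q * connD D G ψ q l := by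
    simp only [connD, Finset.sum_mul, Finset.mul_sum]
    refine Finset.sum_congr rfl fun l _ => ?_
    rw [← sum_rotate]
    refine Finset.sum_congr rfl fun q _ => Finset.sum_congr rfl fun m _ =>
      Finset.sum_congr rfl fun r _ => ?_
    ring
  have e3 : ∑ l, ∑ q, ∑ t, (∑ a, G a l q * db t (db a φ)) * D l (D q (D t ψ))
      = ∑ l, ∑ q, db l (db q φ) * connD D G ψ q l := by
    simp only [connD, Finset.sum_mul, Finset.mul_sum]
    rw [sum_comm_pairs]
    refine Finset.sum_congr rfl fun t _ => Finset.sum_congr rfl fun a _ =>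
      Finset.sum_congr rfl fun l _ => Finset.sum_congr rfl fun q _ => ?_
    rw [H.comm_D q t, H.comm_D l t]
    ring
  have e4 : ∑ l, ∑ q, ∑ t, (∑ a, db t (G a l q) * db a φ) * D l (D q (D t ψ))
      = ∑ m, db m φ * ∑ a, ∑ b, ∑ s, db a (G m b s) * D a (D b (D s ψ)) := by
    simp only [Finset.sum_mul, Finset.mul_sum]
    rw [sum_comm_pairs, Finset.sum_comm]
    refine Finset.sum_congr rfl fun a _ => Finset.sum_congr rfl fun t _ =>
      Finset.sum_congr rfl fun l _ => Finset.sum_congr rfl fun q _ => ?_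
    rw [H.comm_D q t, H.comm_D l t]
    ring
  have : ∀ l q t, covThree db G φ l q t * D l (D q (D t ψ))
      = db l (db q (db t φ)) * D l (D q (D t ψ))
        + (∑ a, db t (G a l q) * db a φ) * D l (D q (D t ψ))
        + (∑ a, G a l q * db t (db a φ)) * D l (D q (D t ψ))
        + (∑ a, G a l t * covTwo db G φ a q) * D l (D q (D t ψ))
        + (∑ a, G a q t * covTwo db G φ l a) * D l (D q (D t ψ)) := by
    intro l q t
    rw [covThree]
    conv_lhs => enter [1, 1, 1]; rw [covTwo]
    simp only [map_add, map_sum, Derivation.leibniz, smul_eq_mul, Finset.sum_add_distrib]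
    rw [H.comm_db q l φ, H.comm_db t l, H.comm_db t q]
    simp only [mul_comm (db _ φ)]
    ring
  simp only [this, Finset.sum_add_distrib, e1, e2, e3, e4]
  ring

/-- Covariantizing the second and third derivatives of φ uses up the contributions of V with weights
2/12, 4/12 and 3/12. The remaining twelfth is R. -/
theorem opC3_eq (H : IsKahlerFrame db D G) (φ ψ : A) :
    opC3 db D φ ψ = stdC3 db D G φ ψ + (1 / 12 : ℂ) • stdR db D G φ ψ := by
  have hV : ∑ l, db l φ * opV db D l ψ = (1 / 12 : ℂ) • (
      2 * ∑ m, db m φ * ∑ a, ∑ b, ∑ s, db a (G m b s) * D a (D b (D s ψ))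
      + 4 * ∑ m, db m φ * ∑ l, ∑ q, G m l q * connD D G ψ q l
      + 3 * ∑ m, db m φ * ∑ l, ∑ q, G m l q * ∑ r, ∑ s, D l (G q r s) * D r (D s ψ)
      + stdR db D G φ ψ) := by
    simp only [stdR, Finset.mul_sum _ _ (2 : A), Finset.mul_sum _ _ (3 : A),
      Finset.mul_sum _ _ (4 : A), ← Finset.sum_add_distrib]
    rw [Finset.smul_sum]
    refine Finset.sum_congr rfl fun l _ => ?_
    have h := H.opV_apply l ψ
    have f1 : ∑ a, ∑ b, ∑ s, ∑ t, G l a s * G a b t * D s (D b (D t ψ))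
        = ∑ s, ∑ a, G l s a * connD D G ψ a s := by
      simp only [connD, Finset.mul_sum]
      rw [Finset.sum_comm (f := fun s a => ∑ m, ∑ r, G l s a * (G a m r * D s (D m (D r ψ))))]
      refine Finset.sum_congr rfl fun a _ => ?_
      rw [Finset.sum_comm]
      refine Finset.sum_congr rfl fun s _ => Finset.sum_congr rfl fun b _ =>
        Finset.sum_congr rfl fun t _ => ?_
      rw [H.symm l a s]
      ring
    have f2 : ∑ a, ∑ b, ∑ s, ∑ t, G l a s * D s (G a b t) * D b (D t ψ)
        = ∑ s, ∑ a, G l s a * ∑ b, ∑ t, D s (G a b t) * D b (D t ψ) := by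
      simp only [Finset.mul_sum]
      rw [Finset.sum_comm (f := fun s a => ∑ m, ∑ r, G l s a * (D s (G a m r) * D m (D r ψ)))]
      refine Finset.sum_congr rfl fun a _ => ?_
      rw [Finset.sum_comm]
      refine Finset.sum_congr rfl fun s _ => Finset.sum_congr rfl fun b _ =>
        Finset.sum_congr rfl fun t _ => ?_
      rw [H.symm l a s]
      ring
    rw [f1, f2] at h
    linear_combination (norm := algebra with ℂ) (1 / 12 : ℂ) • (db l φ * h)
  have hU : ∑ l, ∑ q, db l (db q φ) * (D l (opU db D q ψ) + opU db D l (D q ψ))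
      = (1 / 2 : ℂ) • ∑ l, ∑ q, db l (db q φ) * ∑ r, ∑ s, D l (G q r s) * D r (D s ψ)
        + ∑ l, ∑ q, db l (db q φ) * connD D G ψ q l := by
    have g1 : ∀ l q, D l (opU db D q ψ)
        = (1 / 2 : ℂ) • (∑ r, ∑ s, D l (G q r s) * D r (D s ψ)) + (1 / 2 : ℂ) • connD D G ψ q l := by
      intro l q
      simp only [H.opU_apply, Derivation.map_smul, map_sum, Derivation.leibniz, smul_eq_mul, connD,
        Finset.sum_add_distrib, smul_add]
      rw [add_comm]
      simp only [mul_comm (D _ (D _ ψ))]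
    have g2 : ∀ l q, opU db D l (D q ψ) = (1 / 2 : ℂ) • connD D G ψ l q := by
      intro l q
      rw [H.opU_apply, connD]
      congr 1
      refine Finset.sum_congr rfl fun m _ => Finset.sum_congr rfl fun r _ => ?_
      rw [H.comm_D r q, H.comm_D m q]
    have g3 : ∑ l, ∑ q, db l (db q φ) * connD D G ψ l q
        = ∑ l, ∑ q, db l (db q φ) * connD D G ψ q l := by
      rw [Finset.sum_comm]
      exact Finset.sum_congr rfl fun l _ => Finset.sum_congr rfl fun q _ => by rw [H.comm_db]
    simp only [g1, g2, mul_add, mul_smul_comm, Finset.sum_add_distrib, ← Finset.smul_sum, g3]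
    module
  rw [opC3, hV, hU, stdC3, H.sum_covThree, H.sum_covTwo, H.sum_covTwo]
  algebra with ℂ

theorem covThree_symm_left (H : IsKahlerFrame db D G) (φ : A) (l q t : ι) :
    covThree db G φ l q t = covThree db G φ q l t := by
  have e1 : ∑ a, G a l t * covTwo db G φ a q = ∑ a, G a l t * covTwo db G φ q a :=
    Finset.sum_congr rfl fun a _ => by rw [H.covTwo_symm φ a q]
  have e2 : ∑ a, G a q t * covTwo db G φ l a = ∑ a, G a q t * covTwo db G φ a l :=
    Finset.sum_congr rfl fun a _ => by rw [H.covTwo_symm φ l a]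
  rw [covThree, covThree, H.covTwo_symm φ l q, e1, e2]
  ring

/-- Exchanging the last two derivatives costs the curvature with two antiholomorphic form indices,
and `hflat` says that this curvature vanishes. With the symmetry in the first two indices it gives
total symmetry. -/
theorem covThree_symm_right (H : IsKahlerFrame db D G)
    (hflat : ∀ m l q t, db t (G m l q) + ∑ a, G a l t * G m a q
      = db q (G m l t) + ∑ a, G a l q * G m a t) (φ : A) (l q t : ι) :
    covThree db G φ l q t = covThree db G φ l t q := by
  have h : ∑ m, (db t (G m l q) + ∑ a, G a l t * G m a q) * db m φ
      = ∑ m, (db q (G m l t) + ∑ a, G a l q * G m a t) * db m φ := by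
    simp only [hflat]
  have e : ∀ l q t, covThree db G φ l q t = db t (db q (db l φ))
      + ∑ m, (db t (G m l q) + ∑ a, G a l t * G m a q) * db m φ
      + ∑ a, G a l q * db t (db a φ) + ∑ a, G a l t * db q (db a φ)
      + ∑ a, G a q t * covTwo db G φ l a := by
    intro l q t
    have e2 : ∑ a, G a l t * covTwo db G φ a q
        = ∑ a, G a l t * db q (db a φ) + ∑ m, ∑ a, G a l t * G m a q * db m φ := by
      simp only [covTwo, mul_add, Finset.sum_add_distrib, Finset.mul_sum, ← mul_assoc]
      congr 1
      exact Finset.sum_comm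
    have e3 : db t (covTwo db G φ l q) = db t (db q (db l φ)) + ∑ a, G a l q * db t (db a φ)
        + ∑ a, db t (G a l q) * db a φ := by
      simp only [covTwo, map_add, map_sum, Derivation.leibniz, smul_eq_mul,
        Finset.sum_add_distrib, mul_comm (db _ φ), add_assoc]
    rw [covThree, e2, e3]
    simp only [Finset.sum_add_distrib, add_mul, Finset.sum_mul]
    ring
  rw [e, e, h, H.comm_db t q]
  simp only [H.symm _ t q]
  ring

/-! ### Recursion for the standard deformation quantization -/

section Standard

variable {u : ι → A}

/-- The element u_l stands for ∂̄_l Φ, so the hypothesis on D^q(u_l) says that g^{q̄k} inverts g_{k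
l̄}. -/
theorem opC1_comm (hu : ∀ q l, D q (u l) = if q = l then 1 else 0) (l : ι) (φ ψ : A) :
    opC1 db D φ (u l * ψ) - u l * opC1 db D φ ψ = db l (φ * ψ) - φ * db l ψ := by
  simp only [opC1, Derivation.leibniz, smul_eq_mul, hu, mul_add, Finset.sum_add_distrib,
    Finset.mul_sum]
  have : ∑ q, db q φ * (u l * D q ψ) = ∑ q, u l * (db q φ * D q ψ) :=
    Finset.sum_congr rfl fun q _ => by ring
  rw [this]
  simp
  ring

theorem D_D_mul (hu : ∀ q l, D q (u l) = if q = l then 1 else 0) (a b l : ι) (ψ : A) :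
    D a (D b (u l * ψ)) = u l * D a (D b ψ) + (if a = l then 1 else 0) * D b ψ
      + (if b = l then 1 else 0) * D a ψ := by
  have h0 : D a (if b = l then (1 : A) else 0) = 0 := by split_ifs <;> simp
  simp only [Derivation.leibniz, smul_eq_mul, hu, map_add, h0]
  ring

theorem D_D_D_mul (hu : ∀ q l, D q (u l) = if q = l then 1 else 0) (a b c l : ι) (ψ : A) :
    D a (D b (D c (u l * ψ))) = u l * D a (D b (D c ψ)) + (if a = l then 1 else 0) * D b (D c ψ)
      + (if b = l then 1 else 0) * D a (D c ψ) + (if c = l then 1 else 0) * D a (D b ψ) := by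
  have h0 : ∀ b, D a (if b = l then (1 : A) else 0) = 0 := fun b => by split_ifs <;> simp
  rw [D_D_mul hu]
  simp only [Derivation.leibniz, smul_eq_mul, hu, map_add, h0]
  ring

/-- Commuting u_l past two D's removes one of them, in two equal ways because the Hessian of φ is
symmetric; this absorbs the factor ½. On the other side, [∂̄_l, D^a] = G^a_{lq}D^q completes
∂̄_l∂̄_a φ to a covariant derivative. -/
theorem stdC2_comm (H : IsKahlerFrame db D G) (hu : ∀ q l, D q (u l) = if q = l then 1 else 0)
    (l : ι) (φ ψ : A) :
    stdC2 db D G φ (u l * ψ) - u l * stdC2 db D G φ ψ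
      = db l (opC1 db D φ ψ) - opC1 db D φ (db l ψ) := by
  have e1 : ∑ a, ∑ b, covTwo db G φ a b * D a (D b (u l * ψ))
      = u l * ∑ a, ∑ b, covTwo db G φ a b * D a (D b ψ) + 2 * ∑ a, covTwo db G φ a l * D a ψ := by
    have s1 : ∑ a, ∑ b, covTwo db G φ a b * ((if a = l then 1 else 0) * D b ψ)
        = ∑ a, covTwo db G φ a l * D a ψ := by
      rw [Finset.sum_eq_single l (fun a _ ha => by simp [ha]) (by simp)]
      exact Finset.sum_congr rfl fun b _ => by rw [H.covTwo_symm φ l b]; simp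
    have s2 : ∑ a, ∑ b, covTwo db G φ a b * ((if b = l then 1 else 0) * D a ψ)
        = ∑ a, covTwo db G φ a l * D a ψ := by simp
    simp only [D_D_mul hu, mul_add, Finset.sum_add_distrib, s1, s2]
    simp only [mul_left_comm (covTwo db G φ _ _) (u l), ← Finset.mul_sum]
    ring
  have e2 : db l (opC1 db D φ ψ) - opC1 db D φ (db l ψ) = ∑ a, covTwo db G φ a l * D a ψ := by
    have : ∑ a, (∑ t, G t a l * db t φ) * D a ψ = ∑ a, db a φ * lieK db D l a ψ := by
      simp only [H.lieK_apply, Finset.sum_mul, Finset.mul_sum]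
      rw [Finset.sum_comm]
      refine Finset.sum_congr rfl fun a _ => Finset.sum_congr rfl fun q _ => ?_
      rw [H.symm]
      ring
    simp only [covTwo, add_mul, Finset.sum_add_distrib, this]
    simp only [opC1, map_sum, Derivation.leibniz, smul_eq_mul, IsSeparated.db_D db D,
      ← Finset.sum_sub_distrib, ← Finset.sum_add_distrib]
    exact Finset.sum_congr rfl fun a _ => by ring
  rw [e2, stdC2, stdC2, e1]
  algebra with ℂ

/-- Total symmetry of the third covariant derivatives makes the three contractions with u_l equal,
turning 1/6 into 1/2. The curvature term likewise turns 1/4 into 1/2 and accounts for D acting on G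
when ∂̄_l is commuted past two D's. -/
theorem stdC3_comm (H : IsKahlerFrame db D G)
    (hflat : ∀ m l q t, db t (G m l q) + ∑ a, G a l t * G m a q
      = db q (G m l t) + ∑ a, G a l q * G m a t)
    (hu : ∀ q l, D q (u l) = if q = l then 1 else 0) (l : ι) (φ ψ : A) :
    stdC3 db D G φ (u l * ψ) - u l * stdC3 db D G φ ψ
      = db l (stdC2 db D G φ ψ) - stdC2 db D G φ (db l ψ) := by
  have e1 : ∑ a, ∑ b, ∑ c, covThree db G φ a b c * D a (D b (D c (u l * ψ)))
      = u l * ∑ a, ∑ b, ∑ c, covThree db G φ a b c * D a (D b (D c ψ))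
        + 3 * ∑ a, ∑ b, covThree db G φ a b l * D a (D b ψ) := by
    have s1 : ∑ a, ∑ b, ∑ c, covThree db G φ a b c * ((if a = l then 1 else 0) * D b (D c ψ))
        = ∑ a, ∑ b, covThree db G φ a b l * D a (D b ψ) := by
      rw [Finset.sum_eq_single l (fun a _ ha => by simp [ha]) (by simp)]
      refine Finset.sum_congr rfl fun b _ => Finset.sum_congr rfl fun c _ => ?_
      rw [H.covThree_symm_left φ l b, H.covThree_symm_right hflat φ b l]
      simp
    have s2 : ∑ a, ∑ b, ∑ c, covThree db G φ a b c * ((if b = l then 1 else 0) * D a (D c ψ))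
        = ∑ a, ∑ b, covThree db G φ a b l * D a (D b ψ) := by
      refine Finset.sum_congr rfl fun a _ => ?_
      rw [Finset.sum_eq_single l (fun a _ ha => by simp [ha]) (by simp)]
      refine Finset.sum_congr rfl fun c _ => ?_
      rw [H.covThree_symm_right hflat φ a l]
      simp
    have s3 : ∑ a, ∑ b, ∑ c, covThree db G φ a b c * ((if c = l then 1 else 0) * D a (D b ψ))
        = ∑ a, ∑ b, covThree db G φ a b l * D a (D b ψ) := by simp
    simp only [D_D_D_mul hu, mul_add, Finset.sum_add_distrib, s1, s2, s3]
    simp only [mul_left_comm (covThree db G φ _ _ _) (u l), ← Finset.mul_sum]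
    ring
  have e2 : ∑ a, ∑ b, covTwo db G φ a b * ∑ r, ∑ s, D a (G b r s) * D r (D s (u l * ψ))
      = u l * ∑ a, ∑ b, covTwo db G φ a b * ∑ r, ∑ s, D a (G b r s) * D r (D s ψ)
        + 2 * ∑ a, ∑ b, covTwo db G φ a b * ∑ s, D a (G b l s) * D s ψ := by
    have s1 : ∀ a b, ∑ r, ∑ s, D a (G b r s) * ((if r = l then 1 else 0) * D s ψ)
        = ∑ s, D a (G b l s) * D s ψ := by
      intro a b
      rw [Finset.sum_eq_single l (fun a _ ha => by simp [ha]) (by simp)]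
      simp
    have s2 : ∀ a b, ∑ r, ∑ s, D a (G b r s) * ((if s = l then 1 else 0) * D r ψ)
        = ∑ s, D a (G b l s) * D s ψ := by
      intro a b
      refine Finset.sum_congr rfl fun r _ => ?_
      rw [H.symm b l r]
      simp
    have s3 : ∀ a b, ∑ r, ∑ s, D a (G b r s) * D r (D s (u l * ψ))
        = u l * ∑ r, ∑ s, D a (G b r s) * D r (D s ψ) + 2 * ∑ s, D a (G b l s) * D s ψ := by
      intro a b
      simp only [D_D_mul hu, mul_add, Finset.sum_add_distrib, s1, s2]
      simp only [mul_left_comm (D _ (G _ _ _)) (u l), ← Finset.mul_sum]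
      ring
    simp only [s3, mul_add, Finset.sum_add_distrib]
    simp only [mul_left_comm (covTwo db G φ _ _) (u l), mul_left_comm (covTwo db G φ _ _) 2,
      ← Finset.mul_sum]
  have e3 : db l (stdC2 db D G φ ψ) - stdC2 db D G φ (db l ψ)
      = (1 / 2 : ℂ) • (∑ a, ∑ b, covThree db G φ a b l * D a (D b ψ)
        + ∑ a, ∑ b, covTwo db G φ a b * ∑ s, D a (G b l s) * D s ψ) := by
    have s1 : ∑ a, ∑ b, (∑ t, G t a l * covTwo db G φ t b) * D a (D b ψ)
        = ∑ a, ∑ b, covTwo db G φ a b * ∑ q, G a l q * D q (D b ψ) := by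
      simp only [Finset.sum_mul, Finset.mul_sum]
      rw [show ∀ F : ι → ι → ι → A, ∑ a, ∑ b, ∑ c, F a b c = ∑ c, ∑ b, ∑ a, F a b c from
        fun F => by rw [← sum_rotate]; exact Finset.sum_congr rfl fun c _ => Finset.sum_comm]
      refine Finset.sum_congr rfl fun a _ => Finset.sum_congr rfl fun b _ =>
        Finset.sum_congr rfl fun q _ => ?_
      rw [H.symm a l q]
      ring
    have s2 : ∑ a, ∑ b, (∑ t, G t b l * covTwo db G φ a t) * D a (D b ψ)
        = ∑ a, ∑ b, covTwo db G φ a b * ∑ q, G b l q * D a (D q ψ) := by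
      simp only [Finset.sum_mul, Finset.mul_sum]
      refine Finset.sum_congr rfl fun a _ => ?_
      rw [Finset.sum_comm]
      refine Finset.sum_congr rfl fun b _ => Finset.sum_congr rfl fun q _ => ?_
      rw [H.symm b l q]
      ring
    have s3 : ∀ a b, db l (D a (D b ψ)) = D a (D b (db l ψ)) + ∑ s, D a (G b l s) * D s ψ
        + ∑ q, G b l q * D a (D q ψ) + ∑ q, G a l q * D q (D b ψ) := by
      intro a b
      simp only [IsSeparated.db_D db D, H.lieK_apply, map_add, map_sum, Derivation.leibniz,
        smul_eq_mul, Finset.sum_add_distrib, mul_comm (D _ ψ)]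
      ring
    simp only [covThree, add_mul, Finset.sum_add_distrib, s1, s2]
    simp only [stdC2, Derivation.map_smul, map_sum, Derivation.leibniz, smul_eq_mul, s3, mul_add,
      Finset.sum_add_distrib, mul_comm (D _ (D _ _)) (db _ _)]
    module
  rw [e3, stdC3, stdC3, e1, e2]
  algebra with ℂ

end Standard

end IsKahlerFrame

end Kahler

end SepVar
end

noncomputable section
set_option linter.unusedSectionVars false

namespace SepVar

/-! ### Naturality -/

section Naturality

variable {ι : Type*} [Fintype ι] {A B : Type*} [CommRing A] [Algebra ℂ A] [CommRing B] [Algebra ℂ B]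

/-- The homomorphism `σ` intertwines two pairs of families of derivations. -/
structure Intertwines (σ : A →ₐ[ℂ] B) (db D : ι → Derivation ℂ A A)
    (db' D' : ι → Derivation ℂ B B) : Prop where
  map_db : ∀ l f, σ (db l f) = db' l (σ f)
  map_D : ∀ l f, σ (D l f) = D' l (σ f)

namespace Intertwines

variable {σ : A →ₐ[ℂ] B} {db D : ι → Derivation ℂ A A} {db' D' : ι → Derivation ℂ B B}

theorem map_lieK (H : Intertwines σ db D db' D') (m l : ι) (f : A) :
    σ (lieK db D m l f) = lieK db' D' m l (σ f) := by
  simp only [IsSeparated.lieK_def, map_sub, H.map_db, H.map_D]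

theorem map_lieW (H : Intertwines σ db D db' D') (a b l : ι) (f : A) :
    σ (lieW db D a b l f) = lieW db' D' a b l (σ f) := by
  simp only [IsSeparated.lieW_def, map_sub, H.map_db, H.map_lieK]

theorem map_opU (H : Intertwines σ db D db' D') (l : ι) (f : A) :
    σ (opU db D l f) = opU db' D' l (σ f) := by
  simp only [opU, map_smul, map_sum, H.map_lieK, H.map_D]

theorem map_opV (H : Intertwines σ db D db' D') (l : ι) (f : A) :
    σ (opV db D l f) = opV db' D' l (σ f) := by
  simp only [opV, map_smul, map_sum, map_add, map_sub, map_mul, map_ofNat, H.map_lieK,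
    H.map_lieW, H.map_D]

theorem map_opC1 (H : Intertwines σ db D db' D') (f h : A) :
    σ (opC1 db D f h) = opC1 db' D' (σ f) (σ h) := by
  simp only [opC1, map_sum, map_mul, H.map_db, H.map_D]

theorem map_opC2 (H : Intertwines σ db D db' D') (f h : A) :
    σ (opC2 db D f h) = opC2 db' D' (σ f) (σ h) := by
  simp only [opC2, map_add, map_smul, map_sum, map_mul, H.map_db, H.map_D, H.map_opU]

theorem map_opC3 (H : Intertwines σ db D db' D') (f h : A) :
    σ (opC3 db D f h) = opC3 db' D' (σ f) (σ h) := by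
  simp only [opC3, map_add, map_smul, map_sum, map_mul, H.map_db, H.map_D, H.map_opU, H.map_opV]

end Intertwines

end Naturality

/-! ### Regular expressions in differential algebras -/

/-- A commutative algebra with commuting derivations `∂_k`, `∂̄_l` and a matrix `T^{l̄ k}`. -/
structure DiffData (n : ℕ) where
  carrier : Type
  [commRing : CommRing carrier]
  [algebra : Algebra ℂ carrier]
  der : Dir n → Derivation ℂ carrier carrier
  der_comm : ∀ d d' f, der d (der d' f) = der d' (der d f)
  tensor : Fin n → Fin n → carrier

namespace DiffData

attribute [instance] commRing algebra

variable {n : ℕ} (X : DiffData n)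

/-- Iterated derivatives. -/
def iterDer : List (Dir n) → X.carrier → X.carrier
  | [], f => f
  | d :: ds, f => X.der d (iterDer ds f)

/-- The value of a polynomial in the iterated derivatives of `T^{l̄ k}`. -/
def polyEval : MvPolynomial (Fin n × Fin n × List (Dir n)) ℂ →ₐ[ℂ] X.carrier :=
  MvPolynomial.aeval fun v => X.iterDer v.2.2 (X.tensor v.1 v.2.1)

/-- The value of a regular expression. -/
def regEval (E : RegularOp n) (φ ψ : X.carrier) : X.carrier :=
  E.sum fun i a => X.polyEval a * X.iterDer i.1 φ * X.iterDer i.2 ψ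

/-- `∂̄_l`. -/
def db (l : Fin n) : Derivation ℂ X.carrier X.carrier := X.der (Sum.inr l)

/-- `D^l = T^{l̄ k} ∂_k`. -/
def D (l : Fin n) : Derivation ℂ X.carrier X.carrier := ∑ k, X.tensor l k • X.der (Sum.inl k)

theorem D_apply (l : Fin n) (f : X.carrier) :
    X.D l f = ∑ k, X.tensor l k * X.der (Sum.inl k) f := by
  simp only [D, ← Derivation.coeFnAddMonoidHom_apply, map_sum, Finset.sum_apply]
  rfl

/-- ∂̄_m commutes with the ∂_k, so the commutator differentiates only the coefficients of D^l. -/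
theorem lieK_apply (m l : Fin n) (f : X.carrier) :
    lieK X.db X.D m l f = ∑ k, X.db m (X.tensor l k) * X.der (Sum.inl k) f := by
  simp only [IsSeparated.lieK_def, D_apply, map_sum, Derivation.leibniz, smul_eq_mul,
    ← Finset.sum_sub_distrib]
  refine Finset.sum_congr rfl fun k _ => ?_
  rw [db, X.der_comm (Sum.inr m)]
  ring

theorem lieW_apply (a b l : Fin n) (f : X.carrier) :
    lieW X.db X.D a b l f = ∑ k, X.db a (X.db b (X.tensor l k)) * X.der (Sum.inl k) f := by
  simp only [IsSeparated.lieW_def, lieK_apply, map_sum, Derivation.leibniz, smul_eq_mul,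
    ← Finset.sum_sub_distrib]
  refine Finset.sum_congr rfl fun k _ => ?_
  have := X.der_comm (Sum.inr a) (Sum.inl k) f
  simp only [db, this]
  ring

/-- The value of `s` is given by a universal polynomial in the derivatives of `T^{l̄ k}`. -/
def IsPoly (s : ∀ X : DiffData n, X.carrier) : Prop := ∃ p, ∀ X, s X = X.polyEval p

theorem IsPoly.tensor (l k : Fin n) : IsPoly fun X => X.tensor l k :=
  ⟨MvPolynomial.X (l, k, []), fun X => by simp [polyEval, iterDer]⟩

/-- Differentiating a variable (l, k, γ) yields the variable (l, k, d :: γ); the product rule does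
the rest. Universal polynomials are thus stable under all derivatives. -/
theorem exists_der_polyEval (d : Dir n) (p : MvPolynomial (Fin n × Fin n × List (Dir n)) ℂ) :
    IsPoly fun X => X.der d (X.polyEval p) := by
  induction p using MvPolynomial.induction_on with
  | C a => exact ⟨0, fun X => by simp [polyEval]⟩
  | add p q hp hq =>
    obtain ⟨p', hp⟩ := hp
    obtain ⟨q', hq⟩ := hq
    exact ⟨p' + q', fun X => by simp [hp, hq]⟩
  | mul_X p v hp =>
    obtain ⟨p', hp⟩ := hp
    refine ⟨p' * MvPolynomial.X v + p * MvPolynomial.X (v.1, v.2.1, d :: v.2.2), fun X => ?_⟩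
    simp only [map_mul, map_add, Derivation.leibniz, smul_eq_mul, hp]
    simp only [polyEval, MvPolynomial.aeval_X, iterDer]
    ring

theorem IsPoly.der {s : ∀ X : DiffData n, X.carrier} (hs : IsPoly s) (d : Dir n) :
    IsPoly fun X => X.der d (s X) := by
  obtain ⟨p, hp⟩ := hs
  simp only [hp]
  exact exists_der_polyEval d p

/-- The innermost derivative of the list is holomorphic. -/
def EndsHol (i : List (Dir n)) : Prop := ∃ t k, i = t ++ [Sum.inl k]

/-- The innermost derivative of the list is antiholomorphic. -/
def EndsAntihol (i : List (Dir n)) : Prop := ∃ t l, i = t ++ [Sum.inr l]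

theorem EndsHol.cons {i : List (Dir n)} (hi : EndsHol i) (d : Dir n) : EndsHol (d :: i) := by
  obtain ⟨t, k, rfl⟩ := hi
  exact ⟨d :: t, k, rfl⟩

/-- `P` is a universal differential operator, each term of which starts with some `∂_k`. -/
def IsRegular (P : ∀ X : DiffData n, X.carrier → X.carrier) : Prop :=
  ∃ c : List (Dir n) →₀ MvPolynomial (Fin n × Fin n × List (Dir n)) ℂ,
    (∀ i ∈ c.support, EndsHol i) ∧
    ∀ X ψ, P X ψ = c.sum fun i a => X.polyEval a * X.iterDer i ψ

namespace IsRegular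

variable {P Q : ∀ X : DiffData n, X.carrier → X.carrier}

theorem zero : IsRegular fun (X : DiffData n) _ => (0 : X.carrier) :=
  ⟨0, by simp, by simp⟩

theorem add (hP : IsRegular P) (hQ : IsRegular Q) : IsRegular fun X ψ => P X ψ + Q X ψ := by
  classical
  obtain ⟨c, hc, hP⟩ := hP
  obtain ⟨c', hc', hQ⟩ := hQ
  refine ⟨c + c', fun i hi => ?_, fun X ψ => ?_⟩
  · rcases Finset.mem_union.1 (Finsupp.support_add hi) with h | h
    exacts [hc i h, hc' i h]
  · beta_reduce
    rw [hP, hQ, Finsupp.sum_add_index' (by simp) (by intros; simp [add_mul])]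

theorem sum {κ : Type*} (s : Finset κ) {F : κ → ∀ X : DiffData n, X.carrier → X.carrier}
    (hF : ∀ j, IsRegular (F j)) : IsRegular fun X ψ => ∑ j ∈ s, F j X ψ := by
  classical
  induction s using Finset.induction_on with
  | empty => simpa using zero
  | insert j s hj ih =>
    simp only [Finset.sum_insert hj]
    exact (hF j).add ih

theorem single {s : ∀ X : DiffData n, X.carrier} (hs : IsPoly s) {i : List (Dir n)}
    (hi : EndsHol i) : IsRegular fun X ψ => s X * X.iterDer i ψ := by
  obtain ⟨p, hp⟩ := hs
  refine ⟨Finsupp.single i p, fun j hj => ?_, fun X ψ => ?_⟩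
  · rw [Finset.mem_singleton.1 (Finsupp.support_single_subset hj)]
    exact hi
  · beta_reduce
    rw [hp, Finsupp.sum_single_index (by simp)]

theorem exists_eq (hP : IsRegular P) : ∃ (s : Finset (List (Dir n)))
    (c : List (Dir n) → MvPolynomial (Fin n × Fin n × List (Dir n)) ℂ),
    (∀ i ∈ s, EndsHol i) ∧ ∀ X ψ, P X ψ = ∑ i ∈ s, X.polyEval (c i) * X.iterDer i ψ := by
  obtain ⟨c, hc, hP⟩ := hP
  exact ⟨c.support, c, hc, hP⟩

theorem sum_mem (s : Finset (List (Dir n))) {F : List (Dir n) → ∀ X : DiffData n, X.carrier → X.carrier}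
    (hF : ∀ j ∈ s, IsRegular (F j)) : IsRegular fun X ψ => ∑ j ∈ s, F j X ψ := by
  simp only [← Finset.sum_attach s]
  exact sum _ fun j => hF j.1 j.2

theorem poly_mul {s : ∀ X : DiffData n, X.carrier} (hs : IsPoly s) (hP : IsRegular P) :
    IsRegular fun X ψ => s X * P X ψ := by
  obtain ⟨u, c, hc, hP⟩ := hP.exists_eq
  obtain ⟨p, hp⟩ := hs
  simp only [hP, hp, Finset.mul_sum, ← mul_assoc, ← map_mul]
  exact sum_mem u fun i hi => single ⟨p * c i, fun _ => rfl⟩ (hc i hi)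

theorem smul (a : ℂ) (hP : IsRegular P) : IsRegular fun X ψ => a • P X ψ := by
  have := poly_mul (s := fun X => algebraMap ℂ X.carrier a)
    ⟨MvPolynomial.C a, fun X => by simp [polyEval]⟩ hP
  simpa only [← Algebra.smul_def] using this

/-- New derivatives are added at the head of a list, while the condition of separation of variables
concerns its last entry, so it survives. -/
theorem der (hP : IsRegular P) (d : Dir n) : IsRegular fun X ψ => X.der d (P X ψ) := by
  obtain ⟨u, c, hc, hP⟩ := hP.exists_eq
  simp only [hP, map_sum, Derivation.leibniz, smul_eq_mul]
  refine sum_mem u fun i hi => add ?_ ?_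
  · exact single ⟨c i, fun _ => rfl⟩ ((hc i hi).cons d)
  · simpa only [mul_comm] using single (exists_der_polyEval d (c i)) (hc i hi)

theorem vectorField {s : Fin n → ∀ X : DiffData n, X.carrier} (hs : ∀ k, IsPoly (s k)) :
    IsRegular fun X ψ => ∑ k, s k X * X.der (Sum.inl k) ψ :=
  sum _ fun k => single (hs k) ⟨[], k, rfl⟩

theorem vectorField_comp {s : Fin n → ∀ X : DiffData n, X.carrier} (hs : ∀ k, IsPoly (s k))
    (hP : IsRegular P) : IsRegular fun X ψ => ∑ k, s k X * X.der (Sum.inl k) (P X ψ) :=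
  sum _ fun k => (hP.der _).poly_mul (hs k)

theorem of_D (l : Fin n) : IsRegular fun X ψ => X.D l ψ := by
  simpa only [D_apply] using vectorField fun k => IsPoly.tensor l k

theorem of_lieK (m l : Fin n) : IsRegular fun X ψ => lieK X.db X.D m l ψ := by
  simpa only [lieK_apply, db] using vectorField fun k => (IsPoly.tensor l k).der _

theorem D_comp (l : Fin n) (hP : IsRegular P) : IsRegular fun X ψ => X.D l (P X ψ) := by
  simpa only [D_apply] using vectorField_comp (fun k => IsPoly.tensor l k) hP

theorem lieK_comp (m l : Fin n) (hP : IsRegular P) :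
    IsRegular fun X ψ => lieK X.db X.D m l (P X ψ) := by
  simpa only [lieK_apply, db] using vectorField_comp (fun k => (IsPoly.tensor l k).der _) hP

theorem lieW_comp (a b l : Fin n) (hP : IsRegular P) :
    IsRegular fun X ψ => lieW X.db X.D a b l (P X ψ) := by
  simpa only [lieW_apply, db] using
    vectorField_comp (fun k => ((IsPoly.tensor l k).der _).der _) hP

theorem opU_comp (l : Fin n) (hP : IsRegular P) :
    IsRegular fun X ψ => opU X.db X.D l (P X ψ) :=
  smul _ (sum _ fun m => lieK_comp m l (D_comp m hP))

theorem of_opU (l : Fin n) : IsRegular fun X ψ => opU X.db X.D l ψ :=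
  smul _ (sum _ fun m => lieK_comp m l (of_D m))

theorem of_opV (l : Fin n) : IsRegular fun X ψ => opV X.db X.D l ψ := by
  -- Subtractions and numerals are rewritten as scalar multiples, the form in which the closure
  -- lemmas apply.
  have e : ∀ (X : DiffData n) ψ, opV X.db X.D l ψ = (1 / 12 : ℂ) • ∑ a, ∑ b,
      ((2 : ℂ) • lieW X.db X.D a b l (X.D a (X.D b ψ))
        + (3 : ℂ) • lieK X.db X.D a l (lieK X.db X.D b a (X.D b ψ))
        + (-1 : ℂ) • lieK X.db X.D b a (lieK X.db X.D a l (X.D b ψ))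
        + (-1 : ℂ) • lieK X.db X.D a l (X.D b (lieK X.db X.D b a ψ))
        + X.D b (lieK X.db X.D a l (lieK X.db X.D b a ψ))) := by
    intro X ψ
    rw [opV]
    congr 1
    refine Finset.sum_congr rfl fun a _ => Finset.sum_congr rfl fun b _ => ?_
    algebra with ℂ
  simp only [e]
  exact smul _ (sum _ fun a => sum _ fun b =>
    ((((smul _ (lieW_comp a b l (D_comp a (of_D b)))).add
      (smul _ (lieK_comp a l (lieK_comp b a (of_D b))))).add
      (smul _ (lieK_comp b a (lieK_comp a l (of_D b))))).add
      (smul _ (lieK_comp a l (D_comp b (of_lieK b a))))).add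
      (D_comp b (lieK_comp a l (of_lieK b a))))

end IsRegular

/-- `Q` is a universal bidifferential operator with separation of variables. -/
def IsBiregular (Q : ∀ X : DiffData n, X.carrier → X.carrier → X.carrier) : Prop :=
  ∃ E : RegularOp n, (∀ i ∈ E.support, EndsAntihol i.1 ∧ EndsHol i.2) ∧
    ∀ X φ ψ, Q X φ ψ = X.regEval E φ ψ

namespace IsBiregular

variable {P Q : ∀ X : DiffData n, X.carrier → X.carrier → X.carrier}

theorem zero : IsBiregular fun (X : DiffData n) _ _ => (0 : X.carrier) :=
  ⟨0, by simp, by simp [regEval]⟩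

theorem add (hP : IsBiregular P) (hQ : IsBiregular Q) :
    IsBiregular fun X φ ψ => P X φ ψ + Q X φ ψ := by
  classical
  obtain ⟨c, hc, hP⟩ := hP
  obtain ⟨c', hc', hQ⟩ := hQ
  refine ⟨c + c', fun i hi => ?_, fun X φ ψ => ?_⟩
  · rcases Finset.mem_union.1 (Finsupp.support_add hi) with h | h
    exacts [hc i h, hc' i h]
  · beta_reduce
    rw [hP, hQ, regEval, regEval, regEval,
      Finsupp.sum_add_index' (by simp) (by intros; simp [add_mul])]

theorem sum {κ : Type*} (s : Finset κ)
    {F : κ → ∀ X : DiffData n, X.carrier → X.carrier → X.carrier}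
    (hF : ∀ j ∈ s, IsBiregular (F j)) : IsBiregular fun X φ ψ => ∑ j ∈ s, F j X φ ψ := by
  classical
  induction s using Finset.induction_on with
  | empty => simpa using zero
  | insert j s hj ih =>
    simp only [Finset.sum_insert hj]
    exact (hF j (by simp)).add (ih fun i hi => hF i (by simp [hi]))

theorem single (p : MvPolynomial (Fin n × Fin n × List (Dir n)) ℂ) {i j : List (Dir n)}
    (hi : EndsAntihol i) (hj : EndsHol j) :
    IsBiregular fun X φ ψ => X.polyEval p * X.iterDer i φ * X.iterDer j ψ := by
  refine ⟨Finsupp.single (i, j) p, fun k hk => ?_, fun X φ ψ => ?_⟩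
  · rw [Finset.mem_singleton.1 (Finsupp.support_single_subset hk)]
    exact ⟨hi, hj⟩
  · rw [regEval, Finsupp.sum_single_index (by simp)]

theorem iterDer_mul {P : ∀ X : DiffData n, X.carrier → X.carrier} (hP : IsRegular P)
    {i : List (Dir n)} (hi : EndsAntihol i) :
    IsBiregular fun X φ ψ => X.iterDer i φ * P X ψ := by
  obtain ⟨u, c, hc, hP⟩ := hP.exists_eq
  simp only [hP, Finset.mul_sum]
  refine sum u fun j hj => ?_
  simpa only [mul_left_comm, mul_assoc] using single (c j) hi (hc j hj)

theorem smul (a : ℂ) (hQ : IsBiregular Q) : IsBiregular fun X φ ψ => a • Q X φ ψ := by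
  obtain ⟨E, hE, hQ⟩ := hQ
  simp only [hQ, regEval, Finsupp.sum, Finset.smul_sum, ← smul_mul_assoc, ← map_smul]
  exact sum _ fun i hi => single _ (hE i hi).1 (hE i hi).2

theorem of_opC1 : IsBiregular fun (X : DiffData n) φ ψ => opC1 X.db X.D φ ψ :=
  sum _ fun l _ => iterDer_mul (IsRegular.of_D l) (i := [Sum.inr l]) ⟨[], l, rfl⟩

theorem of_opC2 : IsBiregular fun (X : DiffData n) φ ψ => opC2 X.db X.D φ ψ :=
  (sum _ fun l _ => iterDer_mul (IsRegular.of_opU l) (i := [Sum.inr l]) ⟨[], l, rfl⟩).add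
    (smul _ (sum _ fun l _ => sum _ fun q _ =>
      iterDer_mul (IsRegular.D_comp l (IsRegular.of_D q)) (i := [Sum.inr l, Sum.inr q])
        ⟨[Sum.inr l], q, rfl⟩))

theorem of_opC3 : IsBiregular fun (X : DiffData n) φ ψ => opC3 X.db X.D φ ψ :=
  ((sum _ fun l _ => iterDer_mul (IsRegular.of_opV l) (i := [Sum.inr l]) ⟨[], l, rfl⟩).add
    (smul _ (sum _ fun l _ => sum _ fun q _ =>
      iterDer_mul ((IsRegular.D_comp l (IsRegular.of_opU q)).add
        (IsRegular.opU_comp l (IsRegular.of_D q))) (i := [Sum.inr l, Sum.inr q])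
        ⟨[Sum.inr l], q, rfl⟩))).add
    (smul _ (sum _ fun l _ => sum _ fun q _ => sum _ fun t _ =>
      iterDer_mul (IsRegular.D_comp l (IsRegular.D_comp q (IsRegular.of_D t)))
        (i := [Sum.inr l, Sum.inr q, Sum.inr t]) ⟨[Sum.inr l, Sum.inr q], t, rfl⟩))

end IsBiregular

/-- The operator of order `r` in the star-product up to the third order. -/
def opC (X : DiffData n) : ℕ → X.carrier → X.carrier → X.carrier
  | 0, φ, ψ => φ * ψ
  | 1, φ, ψ => opC1 X.db X.D φ ψ
  | 2, φ, ψ => opC2 X.db X.D φ ψ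
  | 3, φ, ψ => opC3 X.db X.D φ ψ
  | _, _, _ => 0

/-- The expressions depend on n alone and have the right values in every differential algebra at
once. The support condition records separation of variables at the level of the expressions, before
any tensor is chosen. -/
theorem exists_regularOp (n : ℕ) : ∃ E : ℕ → RegularOp n,
    E 0 = Finsupp.single ([], []) 1 ∧
    (∀ r, 1 ≤ r → ∀ i ∈ (E r).support, EndsAntihol i.1 ∧ EndsHol i.2) ∧
    ∀ r (X : DiffData n) φ ψ, X.regEval (E r) φ ψ = X.opC r φ ψ := by
  obtain ⟨E1, h1, e1⟩ := IsBiregular.of_opC1 (n := n)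
  obtain ⟨E2, h2, e2⟩ := IsBiregular.of_opC2 (n := n)
  obtain ⟨E3, h3, e3⟩ := IsBiregular.of_opC3 (n := n)
  refine ⟨fun r => match r with
    | 0 => Finsupp.single ([], []) 1
    | 1 => E1
    | 2 => E2
    | 3 => E3
    | _ => 0, rfl, ?_, ?_⟩
  · rintro (_ | _ | _ | _ | r) hr
    exacts [absurd hr (by simp), h1, h2, h3, by simp]
  · rintro (_ | _ | _ | _ | r) X φ ψ
    · simp [regEval, opC, iterDer]
    · exact (e1 X φ ψ).symm
    · exact (e2 X φ ψ).symm
    · exact (e3 X φ ψ).symm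
    · simp [regEval, opC]

end DiffData

end SepVar
end

noncomputable section
set_option linter.unusedSectionVars false

namespace SepVar

/-! ### Partial derivatives of smooth functions on open subsets of `ℂⁿ` -/

section Partial

variable {n : ℕ}

/-- The partial derivative in a direction. -/
def pd : Dir n → (Cn n → ℂ) → Cn n → ℂ
  | Sum.inl k => dz k
  | Sum.inr l => dzbar l

theorem partials_cons (d : Dir n) (ds : List (Dir n)) (f : Cn n → ℂ) :
    partials (d :: ds) f = pd d (partials ds f) := by
  cases d <;> rfl

/-- A partial derivative is a combination of two real directional derivatives. -/
theorem exists_pd_eq (d : Dir n) : ∃ (v w : Cn n) (c : ℂ), ∀ (f : Cn n → ℂ) z,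
    pd d f z = (fderiv ℝ f z v + c * fderiv ℝ f z w) / 2 := by
  rcases d with k | l
  · exact ⟨Pi.single k 1, Pi.single k I, -I, fun f z => by simp only [pd, dz]; ring⟩
  · exact ⟨Pi.single l 1, Pi.single l I, I, fun f z => by simp only [pd, dzbar]⟩

theorem pd_congr (d : Dir n) {f g : Cn n → ℂ} {z : Cn n} (h : f =ᶠ[nhds z] g) :
    pd d f z = pd d g z := by
  obtain ⟨v, w, c, e⟩ := exists_pd_eq d
  rw [e, e, h.fderiv_eq]

theorem pd_congr_nhds (d : Dir n) {f g : Cn n → ℂ} {z : Cn n} (h : f =ᶠ[nhds z] g) :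
    pd d f =ᶠ[nhds z] pd d g :=
  h.eventuallyEq_nhds.mono fun _ hy => pd_congr d hy

theorem partials_congr (ds : List (Dir n)) {f g : Cn n → ℂ} {z : Cn n} (h : f =ᶠ[nhds z] g) :
    partials ds f =ᶠ[nhds z] partials ds g := by
  induction ds with
  | nil => exact h
  | cons d ds ih => rw [partials_cons, partials_cons]; exact pd_congr_nhds d ih

theorem pd_const (d : Dir n) (a : ℂ) (z : Cn n) : pd d (fun _ => a) z = 0 := by
  obtain ⟨v, w, c, e⟩ := exists_pd_eq d
  simp [e]

theorem pd_add (d : Dir n) {f g : Cn n → ℂ} {z : Cn n} (hf : DifferentiableAt ℝ f z)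
    (hg : DifferentiableAt ℝ g z) : pd d (f + g) z = pd d f z + pd d g z := by
  obtain ⟨v, w, c, e⟩ := exists_pd_eq d
  simp only [e, fderiv_add hf hg, add_apply]
  ring

theorem pd_mul (d : Dir n) {f g : Cn n → ℂ} {z : Cn n} (hf : DifferentiableAt ℝ f z)
    (hg : DifferentiableAt ℝ g z) : pd d (f * g) z = f z * pd d g z + g z * pd d f z := by
  obtain ⟨v, w, c, e⟩ := exists_pd_eq d
  simp only [e, fderiv_mul hf hg, add_apply, smul_apply,
    smul_eq_mul]
  ring

theorem contDiffOn_pd (d : Dir n) {V : Set (Cn n)} (hV : IsOpen V) {f : Cn n → ℂ}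
    (hf : ContDiffOn ℝ ∞ f V) : ContDiffOn ℝ ∞ (pd d f) V := by
  obtain ⟨v, w, c, e⟩ := exists_pd_eq d
  have h : ContDiffOn ℝ ∞ (fderiv ℝ f) V := hf.fderiv_of_isOpen hV (by simp)
  have h' : pd d f = fun z => (fderiv ℝ f z v + c * fderiv ℝ f z w) / 2 := funext (e f)
  rw [h']
  exact ((h.clm_apply contDiffOn_const).add
    (contDiffOn_const.mul (h.clm_apply contDiffOn_const))).div_const 2

theorem contDiffOn_partials (ds : List (Dir n)) {V : Set (Cn n)} (hV : IsOpen V) {f : Cn n → ℂ}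
    (hf : ContDiffOn ℝ ∞ f V) : ContDiffOn ℝ ∞ (partials ds f) V := by
  induction ds with
  | nil => exact hf
  | cons d ds ih => rw [partials_cons]; exact contDiffOn_pd d hV ih

/-- Symmetry of the second real derivative, extended to complex combinations of directions. -/
theorem pd_comm (d d' : Dir n) {f : Cn n → ℂ} {z : Cn n} (hf : ContDiffAt ℝ ∞ f z) :
    pd d (pd d' f) z = pd d' (pd d f) z := by
  have hsymm : IsSymmSndFDerivAt ℝ f z :=
    hf.isSymmSndFDerivAt (by rw [minSmoothness_of_isRCLikeNormedField]; exact WithTop.coe_le_coe.2 le_top)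
  have hd : DifferentiableAt ℝ (fderiv ℝ f) z :=
    (hf.fderiv_right (m := 1) (WithTop.coe_le_coe.2 le_top)).differentiableAt (by simp)
  obtain ⟨v, w, c, e⟩ := exists_pd_eq d
  obtain ⟨v', w', c', e'⟩ := exists_pd_eq d'
  have key : ∀ (c : ℂ) (v w u : Cn n), fderiv ℝ (fun z => (fderiv ℝ f z v + c * fderiv ℝ f z w) / 2) z u
      = (fderiv ℝ (fderiv ℝ f) z u v + c * fderiv ℝ (fderiv ℝ f) z u w) / 2 := by
    intro c v w u
    have h1 : ∀ v, HasFDerivAt (fun z => fderiv ℝ f z v) ((fderiv ℝ (fderiv ℝ f) z).flip v) z := by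
      intro v
      have := hd.hasFDerivAt.clm_apply (hasFDerivAt_const v z)
      simpa using this
    have h2 := ((h1 v).add ((h1 w).const_mul c)).mul_const (1 / 2 : ℂ)
    have h3 : (fun z => (fderiv ℝ f z v + c * fderiv ℝ f z w) / 2)
        = fun z => (fderiv ℝ f z v + c * fderiv ℝ f z w) * (1 / 2) := by
      funext z; ring
    rw [h3]
    rw [HasFDerivAt.fderiv (by simpa only [Pi.add_apply] using h2)]
    simp
    ring
  rw [e, e', show pd d' f = _ from funext (e' f), show pd d f = _ from funext (e f)]
  simp only [key]
  rw [hsymm v v', hsymm v w', hsymm w v', hsymm w w']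
  ring

end Partial

/-! ### The algebra of smooth functions -/

section SmoothAlg

open TopologicalSpace (Opens)

variable {n : ℕ}

/-- The algebra of smooth functions on an open subset of `ℂⁿ`. -/
def SmoothAlg (V : Opens (Cn n)) : Subalgebra ℂ (V → ℂ) where
  carrier := {f | ∃ F : Cn n → ℂ, ContDiffOn ℝ ∞ F V ∧ ∀ z : V, f z = F z}
  mul_mem' := by
    rintro f g ⟨F, hF, eF⟩ ⟨G, hG, eG⟩
    exact ⟨F * G, hF.mul hG, fun z => by simp [eF, eG]⟩
  add_mem' := by
    rintro f g ⟨F, hF, eF⟩ ⟨G, hG, eG⟩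
    exact ⟨F + G, hF.add hG, fun z => by simp [eF, eG]⟩
  algebraMap_mem' a := ⟨fun _ => a, contDiffOn_const, fun _ => rfl⟩

namespace SmoothAlg

variable {V : Opens (Cn n)}

/-- The restriction to `V` of a function that is smooth on `V`. -/
def mk (F : Cn n → ℂ) (hF : ContDiffOn ℝ ∞ F V) : SmoothAlg V := ⟨fun z => F z, F, hF, fun _ => rfl⟩

theorem mk_eq_iff {F G : Cn n → ℂ} {hF : ContDiffOn ℝ ∞ F V} {hG : ContDiffOn ℝ ∞ G V} :
    mk F hF = mk G hG ↔ ∀ z ∈ V, F z = G z := by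
  rw [Subtype.ext_iff, funext_iff]
  exact ⟨fun h z hz => h ⟨z, hz⟩, fun h z => h z.1 z.2⟩

theorem mk_add {F G : Cn n → ℂ} (hF : ContDiffOn ℝ ∞ F V) (hG : ContDiffOn ℝ ∞ G V) :
    mk F hF + mk G hG = mk (F + G) (hF.add hG) := rfl

theorem mk_mul {F G : Cn n → ℂ} (hF : ContDiffOn ℝ ∞ F V) (hG : ContDiffOn ℝ ∞ G V) :
    mk F hF * mk G hG = mk (F * G) (hF.mul hG) := rfl

theorem exists_mk (f : SmoothAlg V) : ∃ F hF, f = mk F hF := by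
  obtain ⟨f, F, hF, e⟩ := f
  exact ⟨F, hF, Subtype.ext (funext e)⟩

/-- A smooth representative on the whole of `ℂⁿ`. -/
def rep (f : SmoothAlg V) : Cn n → ℂ := (exists_mk f).choose

theorem contDiffOn_rep (f : SmoothAlg V) : ContDiffOn ℝ ∞ (rep f) V := (exists_mk f).choose_spec.choose

theorem mk_rep (f : SmoothAlg V) : mk (rep f) (contDiffOn_rep f) = f :=
  (exists_mk f).choose_spec.choose_spec.symm

theorem rep_mk_eventuallyEq {F : Cn n → ℂ} (hF : ContDiffOn ℝ ∞ F V) {z : Cn n} (hz : z ∈ V) :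
    rep (mk F hF) =ᶠ[nhds z] F :=
  Filter.eventuallyEq_of_mem (V.isOpen.mem_nhds hz) (mk_eq_iff.1 (mk_rep (mk F hF)))

theorem differentiableAt {F : Cn n → ℂ} (hF : ContDiffOn ℝ ∞ F V) {z : Cn n} (hz : z ∈ V) :
    DifferentiableAt ℝ F z :=
  (hF.contDiffAt (V.isOpen.mem_nhds hz)).differentiableAt (by simp)

/-- The partial derivative of a smooth function on `V`. -/
def derFun (d : Dir n) (f : SmoothAlg V) : SmoothAlg V :=
  mk (pd d (rep f)) (contDiffOn_pd d V.isOpen (contDiffOn_rep f))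

/-- V is open, so representatives that agree on V have the same partial derivatives there. -/
theorem derFun_mk (d : Dir n) {F : Cn n → ℂ} (hF : ContDiffOn ℝ ∞ F V) :
    derFun d (mk F hF) = mk (pd d F) (contDiffOn_pd d V.isOpen hF) := by
  rw [derFun, mk_eq_iff]
  exact fun _ hz => pd_congr d (rep_mk_eventuallyEq hF hz)

theorem derFun_mul (d : Dir n) (f g : SmoothAlg V) :
    derFun d (f * g) = f * derFun d g + g * derFun d f := by
  obtain ⟨F, hF, rfl⟩ := exists_mk f
  obtain ⟨G, hG, rfl⟩ := exists_mk g
  rw [mk_mul, derFun_mk, derFun_mk, derFun_mk, mk_mul, mk_mul, mk_add, mk_eq_iff]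
  exact fun z hz => pd_mul d (differentiableAt hF hz) (differentiableAt hG hz)

theorem derFun_add (d : Dir n) (f g : SmoothAlg V) :
    derFun d (f + g) = derFun d f + derFun d g := by
  obtain ⟨F, hF, rfl⟩ := exists_mk f
  obtain ⟨G, hG, rfl⟩ := exists_mk g
  rw [mk_add, derFun_mk, derFun_mk, derFun_mk, mk_add, mk_eq_iff]
  exact fun z hz => pd_add d (differentiableAt hF hz) (differentiableAt hG hz)

theorem smul_eq_mk_mul (a : ℂ) (f : SmoothAlg V) :
    a • f = mk (fun _ => a) contDiffOn_const * f := by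
  rw [Algebra.smul_def]; rfl

theorem derFun_smul (d : Dir n) (a : ℂ) (f : SmoothAlg V) :
    derFun d (a • f) = a • derFun d f := by
  have h : derFun d (mk (V := V) (fun _ => a) contDiffOn_const) = 0 := by
    rw [derFun_mk]
    exact Subtype.ext (funext fun z => pd_const d a z)
  rw [smul_eq_mk_mul, smul_eq_mk_mul, derFun_mul, h, mul_zero, add_zero]

/-- The derivation given by a partial derivative. -/
def der (d : Dir n) : Derivation ℂ (SmoothAlg V) (SmoothAlg V) :=
  Derivation.mk' ⟨⟨derFun d, derFun_add d⟩, derFun_smul d⟩ (derFun_mul d)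

theorem der_mk (d : Dir n) {F : Cn n → ℂ} (hF : ContDiffOn ℝ ∞ F V) :
    der d (mk F hF) = mk (pd d F) (contDiffOn_pd d V.isOpen hF) :=
  derFun_mk d hF

theorem der_comm (d d' : Dir n) (f : SmoothAlg V) : der d (der d' f) = der d' (der d f) := by
  obtain ⟨F, hF, rfl⟩ := exists_mk f
  simp only [der_mk]
  exact mk_eq_iff.2 fun z hz => pd_comm d d' (hF.contDiffAt (V.isOpen.mem_nhds hz))

/-- Evaluation at a point. -/
def evalAt (z : V) : SmoothAlg V →ₐ[ℂ] ℂ := (Pi.evalAlgHom ℂ (fun _ : V => ℂ) z).comp (SmoothAlg V).val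

theorem evalAt_mk (F : Cn n → ℂ) (hF : ContDiffOn ℝ ∞ F V) (z : V) : evalAt z (mk F hF) = F z := rfl

theorem ext_evalAt {f g : SmoothAlg V} (h : ∀ z, evalAt z f = evalAt z g) : f = g :=
  Subtype.ext (funext h)

end SmoothAlg

/-- The differential algebra of smooth functions on `V` with a smooth matrix function. -/
abbrev smoothData (V : Opens (Cn n)) (T : Cn n → Matrix (Fin n) (Fin n) ℂ)
    (hT : ∀ l k, ContDiffOn ℝ ∞ (fun z => T z l k) V) : DiffData n where
  carrier := SmoothAlg V
  der := SmoothAlg.der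
  der_comm := SmoothAlg.der_comm
  tensor l k := SmoothAlg.mk (fun z => T z l k) (hT l k)

namespace SmoothAlg

variable {V : Opens (Cn n)} {T : Cn n → Matrix (Fin n) (Fin n) ℂ}
  {hT : ∀ l k, ContDiffOn ℝ ∞ (fun z => T z l k) V}

theorem iterDer_mk (ds : List (Dir n)) {F : Cn n → ℂ} (hF : ContDiffOn ℝ ∞ F V) :
    (smoothData V T hT).iterDer ds (mk F hF)
      = mk (partials ds F) (contDiffOn_partials ds V.isOpen hF) := by
  induction ds with
  | nil => rfl
  | cons d ds ih => simp only [DiffData.iterDer, ih, der_mk, partials_cons]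

/-- Evaluation at a point is an algebra homomorphism; this carries identities of universal operators
over to values of regular expressions in coordinates. -/
theorem evalAt_regEval (E : RegularOp n) {φ ψ : Cn n → ℂ} (hφ : ContDiffOn ℝ ∞ φ V)
    (hψ : ContDiffOn ℝ ∞ ψ V) (z : V) :
    evalAt z ((smoothData V T hT).regEval E (mk φ hφ) (mk ψ hψ)) = E.eval T φ ψ z := by
  rw [DiffData.regEval, RegularOp.eval, Finsupp.sum, Finsupp.sum, map_sum]
  refine Finset.sum_congr rfl fun i _ => ?_
  rw [map_mul, map_mul, iterDer_mk, iterDer_mk, evalAt_mk, evalAt_mk, DiffData.polyEval,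
    ← AlgHom.comp_apply, MvPolynomial.comp_aeval]
  simp only [iterDer_mk, evalAt_mk]
  rfl

end SmoothAlg

end SmoothAlg

end SepVar
end

noncomputable section
set_option linter.unusedSectionVars false

namespace SepVar

/-! ### Kähler metrics in differential algebras -/

namespace DiffData

variable {n : ℕ}

section Definitions

variable (X : DiffData n) (g : Fin n → Fin n → X.carrier)

/-- `∂_k`. -/
def hol (k : Fin n) : Derivation ℂ X.carrier X.carrier := X.der (Sum.inl k)

/-- `Γ^s_{kp}`. -/
def chr (s k p : Fin n) : X.carrier := ∑ t, X.hol p (g k t) * X.tensor t s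

/-- `Γ^{t̄}_{l̄q̄}`. -/
def chrBar (t l q : Fin n) : X.carrier := ∑ s, X.tensor t s * X.db l (g s q)

/-- `-Γ^{t̄}_{l̄q̄}`. -/
def conn (t l q : Fin n) : X.carrier := -X.chrBar g t l q

/-- `ψ_{/kp}`. -/
def covHol2 (ψ : X.carrier) (k p : Fin n) : X.carrier :=
  X.hol p (X.hol k ψ) - ∑ s, X.chr g s k p * X.hol s ψ

/-- `ψ_{/kps}`. -/
def covHol3 (ψ : X.carrier) (k p s : Fin n) : X.carrier :=
  X.hol s (X.covHol2 g ψ k p) - ∑ a, X.chr g a k s * X.covHol2 g ψ a p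
    - ∑ a, X.chr g a p s * X.covHol2 g ψ k a

/-- `R^{q̄p}_{k l̄}`. -/
def curvUp2 (q p k l : Fin n) : X.carrier := ∑ m, X.tensor q m * -X.db l (X.chr g p m k)

/-- `R^{l̄kq̄p}`. -/
def curvUp4 (l k q p : Fin n) : X.carrier :=
  ∑ m, ∑ r, X.tensor l m * X.tensor r k * X.curvUp2 g q p m r

end Definitions

/-- The tensor of `X` is the inverse of the Kähler metric `g`. -/
structure IsKahler (X : DiffData n) (g : Fin n → Fin n → X.carrier) : Prop where
  tensor_mul : ∀ l m, ∑ k, X.tensor l k * g k m = if l = m then 1 else 0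
  mul_tensor : ∀ k m, ∑ l, g k l * X.tensor l m = if k = m then 1 else 0
  closed : ∀ m k l, X.hol m (g k l) = X.hol k (g m l)
  closed_bar : ∀ m k l, X.db m (g l k) = X.db k (g l m)

namespace IsKahler

variable {X : DiffData n} {g : Fin n → Fin n → X.carrier}

/-- Differentiate the relation between the metric and its inverse, then multiply by the inverse. -/
theorem derivation_tensor (H : IsKahler X g) (d : Derivation ℂ X.carrier X.carrier) (l k : Fin n) :
    d (X.tensor l k) = -∑ b, (∑ a, X.tensor l a * d (g a b)) * X.tensor b k := by
  have h : ∀ b, ∑ a, d (X.tensor l a) * g a b = -∑ a, X.tensor l a * d (g a b) := by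
    intro b
    have e := congrArg d (H.tensor_mul l b)
    have h0 : d (if l = b then (1 : X.carrier) else 0) = 0 := by split_ifs <;> simp
    rw [h0] at e
    simp only [map_sum, Derivation.leibniz, smul_eq_mul, Finset.sum_add_distrib] at e
    simp only [mul_comm (d _) (g _ _)]
    linear_combination e
  calc d (X.tensor l k) = ∑ a, d (X.tensor l a) * ∑ b, g a b * X.tensor b k := by
        simp [H.mul_tensor]
    _ = ∑ b, (∑ a, d (X.tensor l a) * g a b) * X.tensor b k := by
        simp only [Finset.mul_sum, Finset.sum_mul, mul_assoc]
        exact Finset.sum_comm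
    _ = _ := by simp [h]

theorem hol_tensor (H : IsKahler X g) (p l k : Fin n) :
    X.hol p (X.tensor l k) = -∑ a, X.tensor l a * X.chr g k a p := by
  rw [H.derivation_tensor]
  simp only [chr, Finset.mul_sum, Finset.sum_mul, mul_assoc]
  rw [Finset.sum_comm]

theorem db_tensor (H : IsKahler X g) (m l k : Fin n) :
    X.db m (X.tensor l k) = ∑ b, X.conn g l m b * X.tensor b k := by
  rw [H.derivation_tensor]
  simp only [conn, chrBar, neg_mul, Finset.sum_neg_distrib]

theorem chr_symm (H : IsKahler X g) (s k p : Fin n) : X.chr g s k p = X.chr g s p k := by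
  simp only [chr, H.closed p k]

theorem conn_symm (H : IsKahler X g) (t l q : Fin n) : X.conn g t l q = X.conn g t q l := by
  simp only [conn, chrBar, H.closed_bar l q]

theorem covHol2_symm (H : IsKahler X g) (ψ : X.carrier) (k p : Fin n) :
    X.covHol2 g ψ k p = X.covHol2 g ψ p k := by
  simp only [covHol2, H.chr_symm _ k p, hol, X.der_comm (Sum.inl p)]

/-- Compatibility of the connection with the metric: raising an index commutes with covariant
differentiation. -/
theorem hol_D (H : IsKahler X g) (p l : Fin n) (ψ : X.carrier) :
    X.hol p (X.D l ψ) = ∑ k, X.tensor l k * X.covHol2 g ψ k p := by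
  have e : ∑ k, X.hol k ψ * -∑ a, X.tensor l a * X.chr g k a p
      = -∑ k, X.tensor l k * ∑ s, X.chr g s k p * X.hol s ψ := by
    simp only [mul_neg, Finset.sum_neg_distrib, Finset.mul_sum]
    rw [Finset.sum_comm]
    congr 1
    exact Finset.sum_congr rfl fun a _ => Finset.sum_congr rfl fun k _ => by ring
  simp only [D_apply, map_sum, Derivation.leibniz, smul_eq_mul, H.hol_tensor, covHol2, mul_sub,
    Finset.sum_add_distrib, Finset.sum_sub_distrib, ← hol.eq_1]
  rw [e, sub_eq_add_neg]

theorem D_D (H : IsKahler X g) (q l : Fin n) (ψ : X.carrier) :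
    X.D q (X.D l ψ) = ∑ k, ∑ p, X.tensor l k * X.tensor q p * X.covHol2 g ψ k p := by
  rw [D_apply, Finset.sum_comm]
  refine Finset.sum_congr rfl fun p _ => ?_
  rw [show X.der (Sum.inl p) (X.D l ψ) = _ from H.hol_D p l ψ, Finset.mul_sum]
  exact Finset.sum_congr rfl fun k _ => by ring

theorem D_comm (H : IsKahler X g) (q l : Fin n) (ψ : X.carrier) :
    X.D q (X.D l ψ) = X.D l (X.D q ψ) := by
  rw [H.D_D, H.D_D, Finset.sum_comm]
  refine Finset.sum_congr rfl fun p _ => Finset.sum_congr rfl fun k _ => ?_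
  rw [H.covHol2_symm]
  ring

theorem lieK_apply (H : IsKahler X g) (m l : Fin n) (x : X.carrier) :
    lieK X.db X.D m l x = ∑ q, X.conn g l m q * X.D q x := by
  simp only [DiffData.lieK_apply, H.db_tensor, D_apply, Finset.mul_sum, Finset.sum_mul, ← mul_assoc]
  exact Finset.sum_comm

theorem isKahlerFrame (H : IsKahler X g) : IsKahlerFrame X.db X.D (X.conn g) where
  comm_db _ _ _ := X.der_comm _ _ _
  comm_D := H.D_comm
  symm := H.conn_symm
  lieK_apply := H.lieK_apply

/-- With K = GD the symmetry identity becomes the symmetry of G^l_{mq} in m and q, a consequence of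
closedness. Thus the inverse of a Kähler metric satisfies the algebraic Jacobi conditions. -/
theorem isSeparated (H : IsKahler X g) : IsSeparated X.db X.D where
  comm_db _ _ _ := X.der_comm _ _ _
  comm_D := H.D_comm
  symm l x y := by
    simp only [H.lieK_apply, Finset.sum_mul]
    rw [Finset.sum_comm]
    refine Finset.sum_congr rfl fun q _ => Finset.sum_congr rfl fun m _ => ?_
    rw [H.conn_symm]
    ring

/-- ∂̄_t G^m_{lq} equals a quadratic term in G minus g^{m̄s}∂̄_t∂̄_q g_{s l̄}. The last term is
symmetric in q and t, so only the quadratic terms remain to be matched. -/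
theorem flat (H : IsKahler X g) (m l q t : Fin n) :
    X.db t (X.conn g m l q) + ∑ a, X.conn g a l t * X.conn g m a q
      = X.db q (X.conn g m l t) + ∑ a, X.conn g a l q * X.conn g m a t := by
  have e : ∀ q t, X.db t (X.conn g m l q) = ∑ b, X.conn g m t b * X.conn g b q l
      - ∑ s, X.tensor m s * X.db t (X.db q (g s l)) := by
    intro q t
    rw [H.conn_symm m l q]
    conv_lhs => rw [conn, chrBar]
    simp only [map_neg, map_sum, Derivation.leibniz, smul_eq_mul, H.db_tensor,
      Finset.sum_add_distrib, Finset.mul_sum]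
    have : ∑ b, X.conn g m t b * X.conn g b q l
        = -∑ s, ∑ b, X.db q (g s l) * (X.conn g m t b * X.tensor b s) := by
      rw [Finset.sum_comm]
      conv_lhs => enter [2, b]; rw [conn.eq_1 X g b, chrBar]
      simp only [mul_neg, Finset.sum_neg_distrib, Finset.mul_sum]
      congr 1
      exact Finset.sum_congr rfl fun b _ => Finset.sum_congr rfl fun s _ => by ring
    rw [this]
    ring
  have c : ∀ s, X.db t (X.db q (g s l)) = X.db q (X.db t (g s l)) := fun s => X.der_comm _ _ _
  rw [e, e]
  simp only [c]
  have f : ∀ q t, ∑ a, X.conn g a l t * X.conn g m a q = ∑ b, X.conn g m q b * X.conn g b t l :=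
    fun q t => Finset.sum_congr rfl fun a _ => by
      rw [H.conn_symm a l t, H.conn_symm m a q]; ring
  rw [f, f]
  ring

theorem hol_D_D (H : IsKahler X g) (s q l : Fin n) (ψ : X.carrier) :
    X.hol s (X.D q (X.D l ψ))
      = ∑ k, ∑ p, X.tensor l k * X.tensor q p * X.covHol3 g ψ k p s := by
  rw [H.D_D]
  have e1 : ∑ k, ∑ p, X.hol s (X.tensor l k) * (X.tensor q p * X.covHol2 g ψ k p)
      = -∑ k, ∑ p, X.tensor l k * X.tensor q p * ∑ a, X.chr g a k s * X.covHol2 g ψ a p := by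
    simp only [H.hol_tensor, neg_mul, Finset.sum_neg_distrib, Finset.sum_mul, Finset.mul_sum]
    congr 1
    rw [← sum_rotate]
    rw [show ∀ F : Fin n → Fin n → Fin n → X.carrier,
        ∑ a, ∑ k, ∑ p, F k p a = ∑ a, ∑ p, ∑ k, F k p a from
        fun F => Finset.sum_congr rfl fun a _ => Finset.sum_comm]
    exact Finset.sum_congr rfl fun a _ => Finset.sum_congr rfl fun p _ =>
      Finset.sum_congr rfl fun k _ => by ring
  have e2 : ∑ k, ∑ p, X.hol s (X.tensor q p) * (X.tensor l k * X.covHol2 g ψ k p)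
      = -∑ k, ∑ p, X.tensor l k * X.tensor q p * ∑ a, X.chr g a p s * X.covHol2 g ψ k a := by
    simp only [H.hol_tensor, neg_mul, Finset.sum_neg_distrib, Finset.sum_mul, Finset.mul_sum]
    congr 1
    refine Finset.sum_congr rfl fun k _ => ?_
    rw [Finset.sum_comm]
    exact Finset.sum_congr rfl fun a _ => Finset.sum_congr rfl fun p _ => by ring
  have e3 : X.hol s (∑ k, ∑ p, X.tensor l k * X.tensor q p * X.covHol2 g ψ k p)
      = ∑ k, ∑ p, X.tensor l k * X.tensor q p * X.hol s (X.covHol2 g ψ k p)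
        + ∑ k, ∑ p, X.hol s (X.tensor l k) * (X.tensor q p * X.covHol2 g ψ k p)
        + ∑ k, ∑ p, X.hol s (X.tensor q p) * (X.tensor l k * X.covHol2 g ψ k p) := by
    simp only [map_sum, Derivation.leibniz, smul_eq_mul, ← Finset.sum_add_distrib]
    exact Finset.sum_congr rfl fun k _ => Finset.sum_congr rfl fun p _ => by ring
  rw [e3, e1, e2]
  simp only [covHol3, mul_sub, Finset.sum_sub_distrib]
  ring

theorem D_D_D (H : IsKahler X g) (t q l : Fin n) (ψ : X.carrier) :
    X.D t (X.D q (X.D l ψ)) = ∑ k, ∑ p, ∑ s,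
      X.tensor l k * X.tensor q p * X.tensor t s * X.covHol3 g ψ k p s := by
  rw [D_apply, ← sum_rotate]
  refine Finset.sum_congr rfl fun s _ => ?_
  rw [show X.der (Sum.inl s) _ = _ from H.hol_D_D s q l ψ, Finset.mul_sum]
  refine Finset.sum_congr rfl fun k _ => ?_
  rw [Finset.mul_sum]
  exact Finset.sum_congr rfl fun p _ => by ring

/-- Compute the mixed derivative of g^{q̄p} in both orders; one order produces ∂̄Γ, the other the
holomorphic derivative of the antiholomorphic Christoffel symbols. -/
theorem curvUp2_eq (H : IsKahler X g) (q p m r : Fin n) :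
    X.curvUp2 g q p m r = ∑ s, X.hol m (X.conn g q r s) * X.tensor s p := by
  have h : X.db r (X.hol m (X.tensor q p)) = X.hol m (X.db r (X.tensor q p)) := X.der_comm _ _ _
  rw [H.hol_tensor, H.db_tensor] at h
  simp only [map_neg, map_sum, Derivation.leibniz, smul_eq_mul, Finset.sum_add_distrib,
    H.db_tensor, H.hol_tensor, mul_neg, Finset.sum_neg_distrib] at h
  have e : ∑ a, X.chr g p a m * ∑ b, X.conn g q r b * X.tensor b a
      = ∑ b, X.conn g q r b * ∑ a, X.tensor b a * X.chr g p a m := by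
    simp only [Finset.mul_sum]
    rw [Finset.sum_comm]
    exact Finset.sum_congr rfl fun b _ => Finset.sum_congr rfl fun a _ => by ring
  rw [e] at h
  simp only [curvUp2, mul_neg, Finset.sum_neg_distrib, mul_comm (X.hol m (X.conn g _ _ _))]
  linear_combination h

theorem curvUp4_eq (H : IsKahler X g) (l k q p : Fin n) :
    X.curvUp4 g l k q p
      = ∑ r, ∑ s, X.D l (X.conn g q r s) * (X.tensor r k * X.tensor s p) := by
  simp only [curvUp4, H.curvUp2_eq, D_apply, Finset.mul_sum, Finset.sum_mul]
  refine Eq.trans ?_ (sum_rotate _)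
  exact Finset.sum_congr rfl fun m _ => Finset.sum_congr rfl fun r _ =>
    Finset.sum_congr rfl fun s _ => by rw [hol]; ring

theorem sum_covHol2 (H : IsKahler X g) (F : Fin n → Fin n → X.carrier) (ψ : X.carrier) :
    ∑ l, ∑ k, ∑ q, ∑ p, X.tensor l k * X.tensor q p * F l q * X.covHol2 g ψ k p
      = ∑ l, ∑ q, F l q * X.D l (X.D q ψ) := by
  refine Finset.sum_congr rfl fun l _ => ?_
  rw [Finset.sum_comm]
  refine Finset.sum_congr rfl fun q _ => ?_
  rw [H.D_comm, H.D_D]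
  simp only [Finset.mul_sum]
  exact Finset.sum_congr rfl fun k _ => Finset.sum_congr rfl fun p _ => by ring

theorem sum_covHol3 (H : IsKahler X g) (F : Fin n → Fin n → Fin n → X.carrier) (ψ : X.carrier) :
    ∑ l, ∑ k, ∑ q, ∑ p, ∑ t, ∑ s,
        X.tensor l k * X.tensor q p * X.tensor t s * F l q t * X.covHol3 g ψ k p s
      = ∑ l, ∑ q, ∑ t, F l q t * X.D l (X.D q (X.D t ψ)) := by
  refine Finset.sum_congr rfl fun l _ => ?_
  rw [Finset.sum_comm]
  refine Finset.sum_congr rfl fun q _ => ?_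
  rw [show ∀ F : Fin n → Fin n → Fin n → Fin n → X.carrier,
    ∑ k, ∑ p, ∑ t, ∑ s, F k p t s = ∑ t, ∑ k, ∑ p, ∑ s, F k p t s from
    fun F => (sum_rotate fun k p t => ∑ s, F k p t s).symm]
  refine Finset.sum_congr rfl fun t _ => ?_
  rw [H.D_comm q t, H.D_comm l t, H.D_comm l q, H.D_D_D]
  simp only [Finset.mul_sum]
  exact Finset.sum_congr rfl fun k _ => Finset.sum_congr rfl fun p _ =>
    Finset.sum_congr rfl fun s _ => by ring

theorem sum_curvUp4 (H : IsKahler X g) (F : Fin n → Fin n → X.carrier) (ψ : X.carrier) :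
    ∑ l, ∑ k, ∑ q, ∑ p, X.curvUp4 g l k q p * F l q * X.covHol2 g ψ k p
      = ∑ l, ∑ q, F l q * ∑ r, ∑ s, X.D l (X.conn g q r s) * X.D r (X.D s ψ) := by
  refine Finset.sum_congr rfl fun l _ => ?_
  rw [Finset.sum_comm]
  refine Finset.sum_congr rfl fun q _ => ?_
  have e : ∀ r s, X.D r (X.D s ψ)
      = ∑ k, ∑ p, X.tensor r k * X.tensor s p * X.covHol2 g ψ k p := fun r s => by
    rw [H.D_comm, H.D_D]
  simp only [e, H.curvUp4_eq, Finset.mul_sum, Finset.sum_mul]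
  rw [sum_comm_pairs]
  exact Finset.sum_congr rfl fun r _ => Finset.sum_congr rfl fun s _ =>
    Finset.sum_congr rfl fun k _ => Finset.sum_congr rfl fun p _ => by ring

/-- Each inverse metric turns a holomorphic derivative of G into D of G or turns ∂_k into D^t,
leaving the form (DG)(DG)D. -/
theorem sum_curvUp2 (H : IsKahler X g) (φ ψ : X.carrier) :
    ∑ r, ∑ m, ∑ l, ∑ p, ∑ q, ∑ k, X.tensor r m * X.curvUp2 g l p m q * X.curvUp2 g q k p r
        * X.db l φ * X.hol k ψ
      = stdR X.db X.D (X.conn g) φ ψ := by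
  have e1 : ∀ q p r, ∑ k, X.curvUp2 g q k p r * X.hol k ψ
      = ∑ t, X.hol p (X.conn g q r t) * X.D t ψ := by
    intro q p r
    simp only [H.curvUp2_eq, D_apply, Finset.mul_sum, Finset.sum_mul, hol, mul_assoc]
    exact Finset.sum_comm
  have e2 : ∀ r l p q, ∑ m, X.tensor r m * X.curvUp2 g l p m q
      = ∑ s, X.D r (X.conn g l q s) * X.tensor s p := by
    intro r l p q
    simp only [H.curvUp2_eq, D_apply, Finset.mul_sum, Finset.sum_mul, hol, mul_assoc]
    exact Finset.sum_comm
  have e3 : ∀ l q r, ∑ p, (∑ s, X.D r (X.conn g l q s) * X.tensor s p)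
        * ∑ t, X.hol p (X.conn g q r t) * X.D t ψ
      = ∑ s, ∑ t, X.D r (X.conn g l q s) * X.D s (X.conn g q r t) * X.D t ψ := by
    intro l q r
    simp only [D_apply X _ (X.conn g q _ _), Finset.mul_sum, Finset.sum_mul, hol]
    refine (Finset.sum_congr rfl fun p _ => Finset.sum_comm).trans ?_
    refine (sum_rotate _).trans ?_
    exact Finset.sum_congr rfl fun s _ => Finset.sum_congr rfl fun t _ =>
      Finset.sum_congr rfl fun p _ => by ring
  rw [sum_comm_pairs, stdR]
  refine Finset.sum_congr rfl fun l _ => ?_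
  simp only [← e3, ← e1, ← e2]
  rw [Finset.mul_sum]
  refine (Finset.sum_congr rfl fun p _ => Finset.sum_congr rfl fun r _ => Finset.sum_comm).trans ?_
  refine (sum_rotate _).symm.trans ?_
  refine Finset.sum_congr rfl fun q _ => ?_
  rw [Finset.sum_comm, Finset.mul_sum]
  refine Finset.sum_congr rfl fun r _ => ?_
  rw [Finset.mul_sum]
  refine Finset.sum_congr rfl fun p _ => ?_
  simp only [Finset.mul_sum, Finset.sum_mul]
  rw [Finset.sum_comm]
  exact Finset.sum_congr rfl fun k _ => Finset.sum_congr rfl fun m _ => by ring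

end IsKahler

end DiffData

end SepVar
end

noncomputable section
set_option linter.unusedSectionVars false

namespace SepVar

/-! ### The Jacobi identity -/

section Jacobi

variable {ι : Type*} [Fintype ι] [DecidableEq ι] {A : Type*} [CommRing A] [Algebra ℂ A]

/-- The bracket `∑ (D^l f ∂̄_l h - D^l h ∂̄_l f)`. -/
def opBr (db D : ι → Derivation ℂ A A) (f h : A) : A := opC1 db D h f - opC1 db D f h

variable {db D : ι → Derivation ℂ A A}

theorem opC1_sub_left (f g h : A) : opC1 db D (f - g) h = opC1 db D f h - opC1 db D g h := by
  simp only [opC1, map_sub, sub_mul, Finset.sum_sub_distrib]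

theorem opC1_sub_right (f g h : A) : opC1 db D f (g - h) = opC1 db D f g - opC1 db D f h := by
  simp only [opC1, map_sub, mul_sub, Finset.sum_sub_distrib]

/-- Antisymmetrize second order associativity over the six orders of the arguments: all terms with
`opC2` cancel, and the iterated `opC1` terms form the double brackets. -/
theorem IsSeparated.jacobi (H : IsSeparated db D) (f g h : A) :
    opBr db D f (opBr db D g h) + opBr db D g (opBr db D h f) + opBr db D h (opBr db D f g) = 0 := by
  have e1 := H.assoc_two f g h
  have e2 := H.assoc_two g h f
  have e3 := H.assoc_two h f g
  have e4 := H.assoc_two g f h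
  have e5 := H.assoc_two f h g
  have e6 := H.assoc_two h g f
  rw [mul_comm g f, mul_comm] at e4
  rw [mul_comm h g] at e5
  rw [mul_comm h f] at e2
  rw [mul_comm h f] at e3
  rw [mul_comm h g, mul_comm g f] at e6
  simp only [opBr, opC1_sub_left, opC1_sub_right]
  linear_combination -e1 - e2 - e3 + e4 + e5 + e6

/-- The elements y_l play the part of z̄^l: the bracket with y_l is D^l up to sign. Jacobi with two
of them says that the D's commute; Jacobi with one of them says that D^l acts on the bracket as a
derivation, which is the symmetry identity. -/
theorem isSeparated_of_jacobi (comm_db : ∀ a b f, db a (db b f) = db b (db a f)) {y : ι → A}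
    (hdb : ∀ m l, db m (y l) = if m = l then 1 else 0) (hD : ∀ m l, D m (y l) = 0)
    (hJ : ∀ f g h, opBr db D f (opBr db D g h) + opBr db D g (opBr db D h f)
      + opBr db D h (opBr db D f g) = 0) : IsSeparated db D := by
  have b1 : ∀ l h, opBr db D (y l) h = -D l h := by
    intro l h
    simp [opBr, opC1, hdb, hD]
  have b2 : ∀ l h, opBr db D h (y l) = D l h := by
    intro l h
    simp [opBr, opC1, hdb, hD]
  have hc : ∀ a b f, D a (D b f) = D b (D a f) := by
    intro a b f
    have h := hJ (y a) (y b) f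
    rw [b1 a (y b), hD, b1, b1, b2, b1, map_neg, neg_zero] at h
    have h0 : opBr db D f 0 = 0 := by simp [opBr, opC1]
    rw [h0] at h
    linear_combination h
  refine ⟨comm_db, hc, fun l g h => ?_⟩
  have e := hJ (y l) g h
  rw [b1, b2, b1] at e
  have hn : opBr db D h (-D l g) = -opBr db D h (D l g) := by
    simp only [opBr, opC1, map_neg, neg_mul, mul_neg, Finset.sum_neg_distrib]
    ring
  rw [hn] at e
  have k : ∀ x y, D l (opC1 db D x y) = opC1 db D (D l x) y + opC1 db D x (D l y)
      - ∑ m, lieK db D m l x * D m y := by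
    intro x y
    simp only [opC1, map_sum, ← Finset.sum_add_distrib, ← Finset.sum_sub_distrib]
    refine Finset.sum_congr rfl fun m _ => ?_
    simp only [Derivation.leibniz, smul_eq_mul, IsSeparated.db_D db D, hc l m]
    ring
  simp only [opBr, map_sub, k] at e
  linear_combination -e

end Jacobi

/-! ### Functions represented by elements of the algebra -/

open TopologicalSpace (Opens)

variable {n : ℕ}

namespace SmoothAlg

variable {V : Opens (Cn n)}

/-- `F` restricts to `f` on `V`. -/
def Represents (f : SmoothAlg V) (F : Cn n → ℂ) : Prop := ∀ z, evalAt z f = F z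

theorem represents_mk {F : Cn n → ℂ} (hF : ContDiffOn ℝ ∞ F V) : Represents (mk F hF) F :=
  fun _ => rfl

theorem Represents.der {f : SmoothAlg V} {F : Cn n → ℂ} (h : Represents f F) (d : Dir n) :
    Represents (der d f) (pd d F) := by
  obtain ⟨G, hG, rfl⟩ := exists_mk f
  intro z
  rw [der_mk, evalAt_mk]
  exact pd_congr d (Filter.eventuallyEq_of_mem (V.isOpen.mem_nhds z.2) fun w hw => h ⟨w, hw⟩)

theorem Represents.contDiffOn {f : SmoothAlg V} {F : Cn n → ℂ} (h : Represents f F) :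
    ContDiffOn ℝ ∞ F V := by
  obtain ⟨G, hG, rfl⟩ := exists_mk f
  exact hG.congr fun z hz => (h ⟨z, hz⟩).symm

theorem Represents.eq_mk {f : SmoothAlg V} {F : Cn n → ℂ} (h : Represents f F) :
    f = mk F h.contDiffOn := ext_evalAt h

end SmoothAlg

open SmoothAlg

/-! ### Kähler geometry in coordinates -/

section Coordinates

variable {V : Opens (Cn n)} {g : Cn n → Matrix (Fin n) (Fin n) ℂ}
  (hg : ∀ k l, ContDiffOn ℝ ∞ (fun z => g z k l) V)
  (hT : ∀ l k, ContDiffOn ℝ ∞ (fun z => (g z)⁻¹ l k) V)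

/-- The differential algebra of the inverse of a matrix function. -/
abbrev invData : DiffData n := smoothData V (fun z => (g z)⁻¹) hT

/-- The components of the metric. -/
def metricA (k l : Fin n) : (invData hT).carrier := mk (fun z => g z k l) (hg k l)

theorem isKahler_invData (hdet : ∀ z ∈ V, IsUnit (g z).det)
    (hcl : ∀ z ∈ V, ∀ k m l : Fin n,
      dz m (fun w => g w k l) z = dz k (fun w => g w m l) z ∧
      dzbar m (fun w => g w l k) z = dzbar k (fun w => g w l m) z) :
    (invData hT).IsKahler (metricA hg hT) where
  tensor_mul l m := ext_evalAt fun z => by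
    have h := congrFun (congrFun (Matrix.nonsing_inv_mul (g z) (hdet z z.2)) l) m
    rw [Matrix.mul_apply, Matrix.one_apply] at h
    rw [map_sum, apply_ite (evalAt z), map_one, map_zero, ← h]
    exact Finset.sum_congr rfl fun k _ => rfl
  mul_tensor k m := ext_evalAt fun z => by
    have h := congrFun (congrFun (Matrix.mul_nonsing_inv (g z) (hdet z z.2)) k) m
    rw [Matrix.mul_apply, Matrix.one_apply] at h
    rw [map_sum, apply_ite (evalAt z), map_one, map_zero, ← h]
    exact Finset.sum_congr rfl fun k _ => rfl
  closed m k l := ext_evalAt fun z =>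
    (((represents_mk (hg k l)).der _) z).trans
      ((hcl z z.2 k m l).1.trans (((represents_mk (hg m l)).der (Sum.inl k)) z).symm)
  closed_bar m k l := ext_evalAt fun z =>
    (((represents_mk (hg l k)).der _) z).trans
      ((hcl z z.2 k m l).2.trans (((represents_mk (hg l m)).der (Sum.inr k)) z).symm)

theorem represents_chr (s k p : Fin n) :
    Represents ((invData hT).chr (metricA hg hT) s k p) (christoffel g s k p) := by
  intro z
  simp only [DiffData.chr, christoffel, map_sum, map_mul]
  refine Finset.sum_congr rfl fun t _ => congrArg₂ _ ?_ rfl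
  exact ((represents_mk (hg k t)).der (Sum.inl p)) z

theorem represents_chrBar (t l q : Fin n) :
    Represents ((invData hT).chrBar (metricA hg hT) t l q) (christoffelBar g t l q) := by
  intro z
  simp only [DiffData.chrBar, christoffelBar, map_sum, map_mul]
  refine Finset.sum_congr rfl fun s _ => congrArg₂ _ rfl ?_
  exact ((represents_mk (hg s q)).der (Sum.inr l)) z

section Functions

variable {φ ψ : Cn n → ℂ} (hφ : ContDiffOn ℝ ∞ φ V) (hψ : ContDiffOn ℝ ∞ ψ V)

theorem represents_covHol2 (k p : Fin n) :
    Represents ((invData hT).covHol2 (metricA hg hT) (mk ψ hψ) k p) (cov2 g ψ k p) := by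
  intro z
  simp only [DiffData.covHol2, cov2, map_sub, map_sum, map_mul, represents_chr hg hT _ _ _ z]
  exact congrArg₂ _ ((((represents_mk hψ).der (Sum.inl k)).der (Sum.inl p)) z)
    (Finset.sum_congr rfl fun s _ => congrArg₂ _ rfl (((represents_mk hψ).der (Sum.inl s)) z))

theorem represents_covHol3 (k p s : Fin n) :
    Represents ((invData hT).covHol3 (metricA hg hT) (mk ψ hψ) k p s) (cov3 g ψ k p s) := by
  intro z
  simp only [DiffData.covHol3, cov3, map_sub, map_sum, map_mul, represents_chr hg hT _ _ _ z,
    represents_covHol2 hg hT hψ _ _ z]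
  congr 2
  exact ((represents_covHol2 hg hT hψ k p).der (Sum.inl s)) z

theorem represents_covTwo (l q : Fin n) :
    Represents (covTwo (invData hT).db ((invData hT).conn (metricA hg hT)) (mk φ hφ) l q)
      (cov2Bar g φ l q) := by
  intro z
  simp only [covTwo, cov2Bar, map_add, map_sum, map_mul, DiffData.conn, map_neg, neg_mul,
    Finset.sum_neg_distrib, ← sub_eq_add_neg, represents_chrBar hg hT _ _ _ z]
  exact congrArg₂ _ ((((represents_mk hφ).der (Sum.inr l)).der (Sum.inr q)) z)
    (Finset.sum_congr rfl fun s _ => congrArg₂ _ rfl (((represents_mk hφ).der (Sum.inr s)) z))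

theorem represents_covThree (l q t : Fin n) :
    Represents (covThree (invData hT).db ((invData hT).conn (metricA hg hT)) (mk φ hφ) l q t)
      (cov3Bar g φ l q t) := by
  intro z
  simp only [covThree, cov3Bar, map_add, map_sum, map_mul, represents_covTwo hg hT hφ _ _ z]
  simp only [DiffData.conn, map_neg, neg_mul,
    Finset.sum_neg_distrib, ← sub_eq_add_neg, represents_chrBar hg hT _ _ _ z]
  congr 2
  exact ((represents_covTwo hg hT hφ l q).der (Sum.inr t)) z

theorem represents_curvUp2 (q p k l : Fin n) :
    Represents ((invData hT).curvUp2 (metricA hg hT) q p k l) (curvatureUp2 g q p k l) := by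
  intro z
  simp only [DiffData.curvUp2, curvatureUp2, curvature, map_sum, map_mul, map_neg]
  exact Finset.sum_congr rfl fun m _ => congrArg₂ _ rfl
    (congrArg _ (((represents_chr hg hT p m k).der (Sum.inr l)) z))

theorem represents_curvUp4 (l k q p : Fin n) :
    Represents ((invData hT).curvUp4 (metricA hg hT) l k q p) (curvatureUp4 g l k q p) := by
  intro z
  simp only [DiffData.curvUp4, curvatureUp4, map_sum, map_mul, represents_curvUp2 hg hT _ _ _ _ z]
  rfl

theorem represents_opC1 {T : Cn n → Matrix (Fin n) (Fin n) ℂ}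
    {hT : ∀ l k, ContDiffOn ℝ ∞ (fun z => T z l k) V} :
    Represents (opC1 (smoothData V T hT).db (smoothData V T hT).D (mk φ hφ) (mk ψ hψ))
      (poissonC1 T φ ψ) := by
  intro z
  simp only [opC1, poissonC1, map_sum]
  refine Finset.sum_congr rfl fun l _ => ?_
  rw [DiffData.D_apply, Finset.mul_sum, map_sum]
  refine Finset.sum_congr rfl fun k _ => ?_
  have e1 := ((represents_mk hφ).der (Sum.inr l)) z
  have e2 := ((represents_mk hψ).der (Sum.inl k)) z
  rw [map_mul, map_mul, DiffData.db, e1, e2, evalAt_mk]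
  simp only [pd]
  ring

/-- The operators of the standard deformation quantization. -/
def stdC (X : DiffData n) (g : Fin n → Fin n → X.carrier) :
    ℕ → X.carrier → X.carrier → X.carrier
  | 0, φ, ψ => φ * ψ
  | 1, φ, ψ => opC1 X.db X.D φ ψ
  | 2, φ, ψ => stdC2 X.db X.D (X.conn g) φ ψ
  | 3, φ, ψ => stdC3 X.db X.D (X.conn g) φ ψ
  | _, _, _ => 0

theorem represents_stdC (H : (invData hT).IsKahler (metricA hg hT)) (r : ℕ) :
    Represents (stdC (invData hT) (metricA hg hT) r (mk φ hφ) (mk ψ hψ)) (kahlerC g r φ ψ) := by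
  match r with
  | 0 => exact fun _ => rfl
  | 1 => exact represents_opC1 hφ hψ
  | 2 =>
    intro z
    rw [stdC, stdC2, ← H.sum_covHol2, kahlerC, map_smul, smul_eq_mul]
    congr 1
    simp only [map_sum, map_mul, represents_covHol2 hg hT hψ _ _ z,
      represents_covTwo hg hT hφ _ _ z]
    rfl
  | 3 =>
    intro z
    rw [stdC, stdC3, ← H.sum_covHol3, ← H.sum_curvUp4, kahlerC, map_add, map_smul, map_smul,
      smul_eq_mul, smul_eq_mul]
    simp only [map_sum, map_mul, represents_covHol2 hg hT hψ _ _ z,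
      represents_covTwo hg hT hφ _ _ z, represents_covHol3 hg hT hψ _ _ _ z,
      represents_covThree hg hT hφ _ _ _ z, represents_curvUp4 hg hT _ _ _ _ z]
    rfl
  | r + 4 => exact fun _ => rfl

theorem represents_stdR (H : (invData hT).IsKahler (metricA hg hT)) :
    Represents (stdR (invData hT).db (invData hT).D ((invData hT).conn (metricA hg hT))
      (mk φ hφ) (mk ψ hψ)) (kahlerR g φ ψ) := by
  intro z
  rw [← H.sum_curvUp2, kahlerR]
  simp only [map_sum, map_mul, represents_curvUp2 hg hT _ _ _ _ z]
  have e1 : ∀ l, evalAt z ((invData hT).db l (mk φ hφ)) = dzbar l φ z := fun l =>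
    ((represents_mk hφ).der (Sum.inr l)) z
  have e2 : ∀ k, evalAt z ((invData hT).hol k (mk ψ hψ)) = dz k ψ z := fun k =>
    ((represents_mk hψ).der (Sum.inl k)) z
  simp only [e1, e2]
  rfl

theorem represents_opC_kahler (H : (invData hT).IsKahler (metricA hg hT))
    (r : ℕ) (hr : r ≤ 2) :
    Represents ((invData hT).opC r (mk φ hφ) (mk ψ hψ)) (kahlerC g r φ ψ) := by
  have h := represents_stdC hg hT hφ hψ H r
  match r with
  | 0 => exact h
  | 1 => exact h
  | 2 =>
    rw [DiffData.opC, H.isKahlerFrame.opC2_eq]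
    exact h
  | r + 3 => omega

theorem represents_opC3_kahler (H : (invData hT).IsKahler (metricA hg hT)) :
    Represents ((invData hT).opC 3 (mk φ hφ) (mk ψ hψ)) (kahlerC3Tilde g φ ψ) := by
  intro z
  rw [DiffData.opC, H.isKahlerFrame.opC3_eq, map_add, map_smul, smul_eq_mul,
    represents_stdR hg hT hφ hψ H z, kahlerC3Tilde]
  congr 1
  exact represents_stdC hg hT hφ hψ H 3 z

end Functions

/-! ### The standard deformation quantization -/

/-- Applied to y = z̄^l, which the D^q kill: the second argument is differentiated only by D's. -/
theorem stdC_mul_of_D_eq_zero {X : DiffData n} {g : Fin n → Fin n → X.carrier} {y : X.carrier}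
    (hy : ∀ q, X.D q y = 0) (r : ℕ) (φ ψ : X.carrier) :
    stdC X g r φ (y * ψ) = y * stdC X g r φ ψ := by
  have h : ∀ q ψ, X.D q (y * ψ) = y * X.D q ψ := fun q ψ => by
    rw [Derivation.leibniz, hy, smul_zero, add_zero, smul_eq_mul]
  match r with
  | 0 => simp only [stdC]; ring
  | 1 => simp only [stdC, opC1, h, Finset.mul_sum, mul_left_comm]
  | 2 => simp only [stdC, stdC2, h, mul_smul_comm, Finset.mul_sum, mul_left_comm]
  | 3 => simp only [stdC, stdC3, h, mul_add, mul_smul_comm, Finset.mul_sum, mul_left_comm y]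
  | r + 4 => simp [stdC]

theorem stdC_one {X : DiffData n} {g : Fin n → Fin n → X.carrier} (r : ℕ) (hr : 1 ≤ r)
    (φ : X.carrier) : stdC X g r φ 1 = 0 := by
  match r with
  | 0 => omega
  | 1 => simp [stdC, opC1]
  | 2 => simp [stdC, stdC2]
  | 3 => simp [stdC, stdC3]
  | r + 4 => rfl

theorem stdC_comm {X : DiffData n} {g : Fin n → Fin n → X.carrier} (H : X.IsKahler g)
    {u : Fin n → X.carrier} (hu : ∀ q l, X.D q (u l) = if q = l then 1 else 0) (l : Fin n)
    (r : ℕ) (hr : r + 1 ≤ 3) (φ ψ : X.carrier) :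
    stdC X g (r + 1) φ (u l * ψ) - u l * stdC X g (r + 1) φ ψ
      = X.db l (stdC X g r φ ψ) - stdC X g r φ (X.db l ψ) := by
  match r with
  | 0 => exact IsKahlerFrame.opC1_comm hu l φ ψ
  | 1 => exact H.isKahlerFrame.stdC2_comm hu l φ ψ
  | 2 => exact H.isKahlerFrame.stdC3_comm H.flat hu l φ ψ
  | r + 3 => omega

/-- The function `z̄^l` as a real linear map. -/
def conjCoord (l : Fin n) : Cn n →L[ℝ] ℂ :=
  (Complex.conjCLE : ℂ →L[ℝ] ℂ).comp (ContinuousLinearMap.proj l)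

theorem dzbar_conj (m l : Fin n) (z : Cn n) :
    dzbar m (fun w : Cn n => (starRingEnd ℂ) (w l)) z = if m = l then 1 else 0 := by
  have h : fderiv ℝ (fun w : Cn n => (starRingEnd ℂ) (w l)) z = conjCoord l :=
    (conjCoord l).fderiv
  rw [dzbar, h]
  by_cases hml : m = l
  · subst hml
    simp [conjCoord]
  · simp [conjCoord, hml, Ne.symm hml]

theorem dz_conj (m l : Fin n) (z : Cn n) :
    dz m (fun w : Cn n => (starRingEnd ℂ) (w l)) z = 0 := by
  have h : fderiv ℝ (fun w : Cn n => (starRingEnd ℂ) (w l)) z = conjCoord l :=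
    (conjCoord l).fderiv
  rw [dz, h]
  by_cases hml : m = l
  · subst hml
    simp [conjCoord]
  · simp [conjCoord, Ne.symm hml]

theorem contDiff_conj_coord (l : Fin n) :
    ContDiff ℝ ∞ (fun w : Cn n => (starRingEnd ℂ) (w l)) :=
  (conjCoord l).contDiff

theorem isStandardUpTo (H : (invData hT).IsKahler (metricA hg hT)) {Φ : Cn n → ℂ}
    (hΦ : ContDiffOn ℝ ∞ Φ V) (hpot : ∀ z ∈ V, ∀ k l, g z k l = dz k (dzbar l Φ) z) :
    IsStandardUpTo 3 V Φ (kahlerC g) where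
  zeroth _ _ _ _ _ _ := rfl
  one φ hφ r hr _ z hz := by
    rw [← represents_stdC hg hT hφ contDiffOn_const H r ⟨z, hz⟩]
    refine (congrArg (evalAt _) (stdC_one r hr _)).trans (map_zero _)
  comm φ ψ hφ hψ r hr l z hz := by
    have hy := (contDiff_conj_coord (n := n) l).contDiffOn (s := V)
    rw [← represents_stdC hg hT hφ (hy.mul hψ) H r ⟨z, hz⟩,
      ← represents_stdC hg hT hφ hψ H r ⟨z, hz⟩]
    have h0 : ∀ q, (invData hT).D q (mk _ hy) = 0 := by
      intro q
      rw [DiffData.D_apply]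
      refine Finset.sum_eq_zero fun k _ => ?_
      rw [show (invData hT).der (Sum.inl k) (mk _ hy) = 0 from ext_evalAt fun z =>
        (((represents_mk hy).der (Sum.inl k)) z).trans ((dz_conj k l z).trans (map_zero _).symm),
        mul_zero]
    exact (congrArg (evalAt _) (stdC_mul_of_D_eq_zero h0 r _ (mk ψ hψ))).trans (map_mul _ _ _)
  recursion φ ψ hφ hψ r hr l z hz := by
    have hu' : ∀ l, ContDiffOn ℝ ∞ (dzbar l Φ) V := fun l =>
      contDiffOn_pd (Sum.inr l) V.isOpen hΦ
    -- By the potential equation, D^q ∂̄_l Φ = g^{q̄k}g_{k l̄}.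
    have hu : ∀ q l, (invData hT).D q (mk (dzbar l Φ) (hu' l)) = if q = l then 1 else 0 := by
      intro q l
      rw [← H.tensor_mul q l, DiffData.D_apply]
      refine Finset.sum_congr rfl fun k _ => congrArg _ (ext_evalAt fun z => ?_)
      exact (((represents_mk (hu' l)).der (Sum.inl k)) z).trans (hpot z z.2 k l).symm
    have h := congrArg (evalAt ⟨z, hz⟩) (stdC_comm H hu l r hr (mk φ hφ) (mk ψ hψ))
    rw [map_sub, map_sub, map_mul] at h
    have hψ' : ContDiffOn ℝ ∞ (dzbar l ψ) V := contDiffOn_pd (Sum.inr l) V.isOpen hψ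
    have e1 := represents_stdC hg hT hφ ((hu' l).mul hψ) H (r + 1) ⟨z, hz⟩
    have e2 := represents_stdC hg hT hφ hψ H (r + 1) ⟨z, hz⟩
    have e3 := ((represents_stdC hg hT hφ hψ H r).der (Sum.inr l)) ⟨z, hz⟩
    have e4 := represents_stdC hg hT hφ hψ' H r ⟨z, hz⟩
    rw [e2, show (invData hT).db l (mk ψ hψ) = mk (dzbar l ψ) hψ' from der_mk (Sum.inr l) hψ, e4,
      DiffData.db, e3, mk_mul] at h
    exact (congrArg (· - _) e1).symm.trans h

end Coordinates

end SepVar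
end

noncomputable section
set_option linter.unusedSectionVars false

namespace SepVar

open TopologicalSpace (Opens)
open SmoothAlg

variable {n : ℕ}

/-! ### The second order operator -/

theorem DiffData.opC2_apply (X : DiffData n) (φ ψ : X.carrier) :
    opC2 X.db X.D φ ψ = (1 / 2 : ℂ) • ∑ l, ∑ k, ∑ q, ∑ p,
      (X.tensor q p * X.tensor l k * X.db l (X.db q φ) * X.hol k (X.hol p ψ)
        + X.tensor q p * X.hol p (X.tensor l k) * X.db l (X.db q φ) * X.hol k ψ
        + X.db l (X.tensor q p) * X.tensor l k * X.db q φ * X.hol k (X.hol p ψ)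
        + X.db l (X.tensor q p) * X.hol p (X.tensor l k) * X.db q φ * X.hol k ψ) := by
  have hD : ∀ l p, X.hol p (X.D l ψ)
      = ∑ k, (X.tensor l k * X.hol k (X.hol p ψ) + X.hol p (X.tensor l k) * X.hol k ψ) := by
    intro l p
    simp only [D_apply, map_sum, Derivation.leibniz, smul_eq_mul]
    refine Finset.sum_congr rfl fun k _ => ?_
    rw [show X.hol p (X.der (Sum.inl k) ψ) = X.hol k (X.hol p ψ) from X.der_comm _ _ _, hol]
    ring
  have e1 : ∑ l, db X l φ * opU X.db X.D l ψ = (1 / 2 : ℂ) • ∑ l, ∑ k, ∑ q, ∑ p,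
      (X.db l (X.tensor q p) * X.tensor l k * X.db q φ * X.hol k (X.hol p ψ)
        + X.db l (X.tensor q p) * X.hol p (X.tensor l k) * X.db q φ * X.hol k ψ) := by
    simp only [opU, mul_smul_comm, ← Finset.smul_sum]
    congr 1
    simp only [Finset.mul_sum]
    rw [Finset.sum_comm]
    refine Finset.sum_congr rfl fun l _ => ?_
    rw [Finset.sum_comm]
    refine Finset.sum_congr rfl fun q _ => ?_
    rw [X.lieK_apply, Finset.mul_sum, Finset.sum_comm]
    refine Finset.sum_congr rfl fun p _ => ?_
    rw [show X.der (Sum.inl p) (X.D l ψ) = _ from hD l p, Finset.mul_sum, Finset.mul_sum]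
    exact Finset.sum_congr rfl fun k _ => by ring
  have e2 : ∑ l, ∑ q, db X l (db X q φ) * X.D l (X.D q ψ) = ∑ l, ∑ k, ∑ q, ∑ p,
      (X.tensor q p * X.tensor l k * X.db l (X.db q φ) * X.hol k (X.hol p ψ)
        + X.tensor q p * X.hol p (X.tensor l k) * X.db l (X.db q φ) * X.hol k ψ) := by
    rw [Finset.sum_comm]
    refine Finset.sum_congr rfl fun l _ => ?_
    rw [Finset.sum_comm]
    refine Finset.sum_congr rfl fun q _ => ?_
    rw [D_apply, Finset.mul_sum, Finset.sum_comm]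
    refine Finset.sum_congr rfl fun p _ => ?_
    rw [show X.der (Sum.inl p) (X.D l ψ) = _ from hD l p, Finset.mul_sum, Finset.mul_sum,
      show X.db q (X.db l φ) = X.db l (X.db q φ) from X.der_comm _ _ _]
    exact Finset.sum_congr rfl fun k _ => by ring
  rw [opC2, e1, e2, ← smul_add]
  congr 1
  simp only [← Finset.sum_add_distrib]
  exact Finset.sum_congr rfl fun l _ => Finset.sum_congr rfl fun k _ =>
    Finset.sum_congr rfl fun q _ => Finset.sum_congr rfl fun p _ => by ring

theorem represents_opC2 {V : Opens (Cn n)} {T : Cn n → Matrix (Fin n) (Fin n) ℂ}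
    (hT : ∀ l k, ContDiffOn ℝ ∞ (fun z => T z l k) V) {φ ψ : Cn n → ℂ}
    (hφ : ContDiffOn ℝ ∞ φ V) (hψ : ContDiffOn ℝ ∞ ψ V) :
    Represents (opC2 (smoothData V T hT).db (smoothData V T hT).D (mk φ hφ) (mk ψ hψ))
      (poissonC2 T φ ψ) := by
  intro z
  rw [DiffData.opC2_apply, map_smul, smul_eq_mul, poissonC2]
  congr 1
  simp only [map_sum, map_add, map_mul]
  refine Finset.sum_congr rfl fun l _ => Finset.sum_congr rfl fun k _ =>
    Finset.sum_congr rfl fun q _ => Finset.sum_congr rfl fun p _ => ?_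
  have e1 := ((represents_mk hφ).der (Sum.inr q)) z
  have e2 := (((represents_mk hφ).der (Sum.inr q)).der (Sum.inr l)) z
  have e3 := ((represents_mk hψ).der (Sum.inl k)) z
  have e4 := (((represents_mk hψ).der (Sum.inl p)).der (Sum.inl k)) z
  have e5 := ((represents_mk (hT q p)).der (Sum.inr l)) z
  have e6 := ((represents_mk (hT l k)).der (Sum.inl p)) z
  simp only [DiffData.db, DiffData.hol, e1, e2, e3, e4, e5, e6, evalAt_mk]
  rfl

/-! ### Holomorphic coordinate changes -/

/-- The splitting of a real linear form into its complex linear and antilinear parts. Precomposition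
with a complex linear differential preserves the splitting, whence the chain rules without mixed
terms. -/
theorem clm_apply_eq_sum (L : Cn n →L[ℝ] ℂ) (u : Cn n) :
    L u = ∑ a, (u a * ((L (Pi.single a 1) - I * L (Pi.single a I)) / 2)
      + (starRingEnd ℂ) (u a) * ((L (Pi.single a 1) + I * L (Pi.single a I)) / 2)) := by
  have hu : u = ∑ a, ((u a).re • (Pi.single a 1 : Cn n) + (u a).im • (Pi.single a I : Cn n)) := by
    ext b
    simp only [Finset.sum_apply, Pi.add_apply, Pi.smul_apply, Pi.single_apply, smul_ite, smul_zero]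
    rw [Finset.sum_eq_single b (fun a _ ha => by simp [Ne.symm ha]) (by simp)]
    simp [Complex.re_add_im]
  conv_lhs => rw [hu]
  rw [map_sum]
  refine Finset.sum_congr rfl fun a _ => ?_
  rw [map_add, map_smul, map_smul, real_smul, real_smul]
  conv_rhs => rw [← Complex.re_add_im (u a)]
  simp only [map_add, map_mul, conj_ofReal, conj_I]
  linear_combination ((u a).im * L (Pi.single a I)) * I_mul_I

section ChainRule

variable {τ : Cn n → Cn n} {f : Cn n → ℂ} {z : Cn n}

theorem fderiv_comp_hol (hτ : DifferentiableAt ℂ τ z) (hf : DifferentiableAt ℝ f (τ z)) (v : Cn n) :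
    fderiv ℝ (fun w => f (τ w)) z v = fderiv ℝ f (τ z) (fderiv ℂ τ z v) := by
  have h := hf.hasFDerivAt.comp z (hτ.hasFDerivAt.restrictScalars ℝ)
  rw [show (fun w => f (τ w)) = f ∘ τ from rfl, h.fderiv]
  rfl

theorem single_I (k : Fin n) : (Pi.single k I : Cn n) = I • Pi.single k 1 := by
  ext b
  by_cases h : b = k
  · subst h; simp
  · simp [h]

theorem dz_comp_hol (hτ : DifferentiableAt ℂ τ z) (hf : DifferentiableAt ℝ f (τ z)) (k : Fin n) :
    dz k (fun w => f (τ w)) z = ∑ a, fderiv ℂ τ z (Pi.single k 1) a * dz a f (τ z) := by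
  rw [dz, fderiv_comp_hol hτ hf, fderiv_comp_hol hτ hf, single_I, map_smul, clm_apply_eq_sum,
    clm_apply_eq_sum _ (I • _), Finset.mul_sum, ← Finset.sum_sub_distrib, Finset.sum_div]
  refine Finset.sum_congr rfl fun a _ => ?_
  simp only [dz, Pi.smul_apply, smul_eq_mul, map_mul, conj_I]
  ring_nf
  simp only [I_sq, I_pow_three]
  ring

theorem dzbar_comp_hol (hτ : DifferentiableAt ℂ τ z) (hf : DifferentiableAt ℝ f (τ z)) (l : Fin n) :
    dzbar l (fun w => f (τ w)) z
      = ∑ b, (starRingEnd ℂ) (fderiv ℂ τ z (Pi.single l 1) b) * dzbar b f (τ z) := by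
  rw [dzbar, fderiv_comp_hol hτ hf, fderiv_comp_hol hτ hf, single_I, map_smul, clm_apply_eq_sum,
    clm_apply_eq_sum _ (I • _), Finset.mul_sum, ← Finset.sum_add_distrib, Finset.sum_div]
  refine Finset.sum_congr rfl fun a _ => ?_
  simp only [dzbar, Pi.smul_apply, smul_eq_mul, map_mul, conj_I]
  ring_nf
  simp only [I_sq, I_pow_three]
  ring

end ChainRule

/-- A biholomorphic map between open subsets of `ℂⁿ`, with its inverse. -/
structure IsBihol (V V' : Opens (Cn n)) (τ τ' : Cn n → Cn n) : Prop where
  mapsTo : ∀ z ∈ V, τ z ∈ V'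
  mapsTo' : ∀ w ∈ V', τ' w ∈ V
  left_inv : ∀ z ∈ V, τ' (τ z) = z
  differentiableAt : ∀ z ∈ V, DifferentiableAt ℂ τ z
  differentiableAt' : ∀ w ∈ V', DifferentiableAt ℂ τ' w
  contDiffOn : ContDiffOn ℝ ∞ τ V
  contDiffOn' : ContDiffOn ℝ ∞ τ' V'

namespace IsBihol

variable {V V' : Opens (Cn n)} {τ τ' : Cn n → Cn n}

theorem contDiffOn_comp (H : IsBihol V V' τ τ') {F : Cn n → ℂ} (hF : ContDiffOn ℝ ∞ F V') :
    ContDiffOn ℝ ∞ (fun z => F (τ z)) V :=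
  hF.comp H.contDiffOn H.mapsTo

/-- The pull-back of smooth functions. -/
def pull (H : IsBihol V V' τ τ') : SmoothAlg V' →ₐ[ℂ] SmoothAlg V where
  toFun f := ⟨fun z => f.1 ⟨τ z, H.mapsTo z z.2⟩, by
    obtain ⟨f, F, hF, e⟩ := f
    exact ⟨fun z => F (τ z), H.contDiffOn_comp hF, fun z => e _⟩⟩
  map_one' := rfl
  map_mul' _ _ := rfl
  map_zero' := rfl
  map_add' _ _ := rfl
  commutes' _ := rfl

theorem pull_mk (H : IsBihol V V' τ τ') {F : Cn n → ℂ} (hF : ContDiffOn ℝ ∞ F V') :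
    H.pull (SmoothAlg.mk F hF) = SmoothAlg.mk (fun z => F (τ z)) (H.contDiffOn_comp hF) := rfl

theorem contDiffOn_conj (H : IsBihol V V' τ τ') (b : Fin n) :
    ContDiffOn ℝ ∞ (fun z => (starRingEnd ℂ) (τ z b)) V :=
  (contDiff_conj_coord b).comp_contDiffOn H.contDiffOn

theorem contDiffOn_conj' (H : IsBihol V V' τ τ') (b : Fin n) :
    ContDiffOn ℝ ∞ (fun z => (starRingEnd ℂ) (τ' z b)) V' :=
  (contDiff_conj_coord b).comp_contDiffOn H.contDiffOn'

theorem dz_conj_comp {τ : Cn n → Cn n} {z : Cn n} (hτ : DifferentiableAt ℂ τ z) (k b : Fin n) :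
    dz k (fun z => (starRingEnd ℂ) (τ z b)) z = 0 := by
  rw [dz_comp_hol (f := fun w => (starRingEnd ℂ) (w b)) hτ
    (((contDiff_conj_coord b).differentiable (by simp)) _)]
  simp [dz_conj]

theorem dzbar_conj_comp {τ : Cn n → Cn n} {z : Cn n} (hτ : DifferentiableAt ℂ τ z) (l b : Fin n) :
    dzbar l (fun z => (starRingEnd ℂ) (τ z b)) z
      = (starRingEnd ℂ) (fderiv ℂ τ z (Pi.single l 1) b) := by
  rw [dzbar_comp_hol (f := fun w => (starRingEnd ℂ) (w b)) hτ
    (((contDiff_conj_coord b).differentiable (by simp)) _)]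
  simp [dzbar_conj]

end IsBihol

/-- The antiholomorphic functions. -/
def antihol (V : Opens (Cn n)) : Subalgebra ℂ (SmoothAlg V) where
  carrier := {f | ∀ k, der (Sum.inl k) f = 0}
  mul_mem' := by
    intro f g hf hg k
    rw [Derivation.leibniz, hf, hg, smul_zero, smul_zero, add_zero]
  add_mem' := by
    intro f g hf hg k
    rw [map_add, hf, hg, add_zero]
  algebraMap_mem' a k := Derivation.map_algebraMap _ _

namespace IsBihol

variable {V V' : Opens (Cn n)} {τ τ' : Cn n → Cn n}

/-- The antiholomorphic Jacobian matrix. -/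
def jac (H : IsBihol V V' τ τ') (b l : Fin n) : antihol V :=
  ⟨der (Sum.inr l) (SmoothAlg.mk (fun z => (starRingEnd ℂ) (τ z b)) (H.contDiffOn_conj b)), fun k => by
    rw [der_comm, show der (Sum.inl k) (SmoothAlg.mk (fun z => (starRingEnd ℂ) (τ z b)) (H.contDiffOn_conj b))
      = 0 from ext_evalAt fun z => (((represents_mk (H.contDiffOn_conj b)).der (Sum.inl k)) z).trans
        ((dz_conj_comp (H.differentiableAt z z.2) k b).trans (map_zero _).symm), map_zero]⟩

theorem evalAt_jac (H : IsBihol V V' τ τ') (b l : Fin n) (z : V) :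
    evalAt z (H.jac b l : SmoothAlg V) = (starRingEnd ℂ) (fderiv ℂ τ z (Pi.single l 1) b) :=
  (((represents_mk (H.contDiffOn_conj b)).der (Sum.inr l)) z).trans
    (dzbar_conj_comp (H.differentiableAt z z.2) l b)

theorem evalAt_der_hol_pull (H : IsBihol V V' τ τ') (k : Fin n) (f : SmoothAlg V') (z : V) :
    evalAt z (der (Sum.inl k) (H.pull f))
      = ∑ a, fderiv ℂ τ z (Pi.single k 1) a * evalAt z (H.pull (der (Sum.inl a) f)) := by
  obtain ⟨F, hF, rfl⟩ := exists_mk f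
  rw [pull_mk, der_mk, evalAt_mk]
  refine (dz_comp_hol (H.differentiableAt z z.2)
    (SmoothAlg.differentiableAt hF (H.mapsTo z z.2)) k).trans ?_
  exact Finset.sum_congr rfl fun a _ => by rw [der_mk, pull_mk, evalAt_mk]; rfl

theorem der_antihol_pull (H : IsBihol V V' τ τ') (l : Fin n) (f : SmoothAlg V') :
    der (Sum.inr l) (H.pull f) = ∑ b, (H.jac b l : SmoothAlg V) * H.pull (der (Sum.inr b) f) := by
  obtain ⟨F, hF, rfl⟩ := exists_mk f
  refine ext_evalAt fun z => ?_
  rw [pull_mk, der_mk, evalAt_mk, map_sum]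
  refine (dzbar_comp_hol (H.differentiableAt z z.2)
    (SmoothAlg.differentiableAt hF (H.mapsTo z z.2)) l).trans ?_
  exact Finset.sum_congr rfl fun a _ => by
    rw [der_mk, pull_mk, map_mul, evalAt_mk, evalAt_jac]; rfl

/-- The inverse of the antiholomorphic Jacobian matrix. -/
def jacInv (H : IsBihol V V' τ τ') (b m : Fin n) : antihol V :=
  ⟨H.pull (der (Sum.inr b) (SmoothAlg.mk (fun z => (starRingEnd ℂ) (τ' z m)) (H.contDiffOn_conj' m))),
    fun k => ext_evalAt fun z => by
      rw [evalAt_der_hol_pull, map_zero]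
      refine Finset.sum_eq_zero fun a _ => ?_
      rw [der_comm,
        show der (Sum.inl a) (SmoothAlg.mk (fun z => (starRingEnd ℂ) (τ' z m)) (H.contDiffOn_conj' m))
          = 0 from ext_evalAt fun z => (((represents_mk (H.contDiffOn_conj' m)).der (Sum.inl a)) z).trans
            ((dz_conj_comp (H.differentiableAt' z z.2) a m).trans (map_zero _).symm),
        map_zero, map_zero, map_zero, mul_zero]⟩

theorem inv_left (H : IsBihol V V' τ τ') (m l : Fin n) :
    ∑ b, H.jacInv b m * H.jac b l = if m = l then 1 else 0 := by
  have h := H.der_antihol_pull l (SmoothAlg.mk (fun z => (starRingEnd ℂ) (τ' z m)) (H.contDiffOn_conj' m))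
  have hl : der (Sum.inr l) (H.pull (SmoothAlg.mk (fun z => (starRingEnd ℂ) (τ' z m)) (H.contDiffOn_conj' m)))
      = if m = l then 1 else 0 := by
    refine ext_evalAt fun z => ?_
    rw [pull_mk, der_mk, evalAt_mk, apply_ite (evalAt z), map_one, map_zero]
    refine (pd_congr (g := fun z => (starRingEnd ℂ) (z m)) _ ?_).trans ?_
    · exact Filter.eventuallyEq_of_mem (V.isOpen.mem_nhds z.2) fun w hw => by
        simp only [H.left_inv w hw]
    · simp only [pd, dzbar_conj, eq_comm]
  rw [hl] at h
  refine Subtype.ext ?_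
  rw [AddSubmonoidClass.coe_finsetSum, apply_ite Subtype.val]
  refine Eq.trans ?_ h.symm
  exact Finset.sum_congr rfl fun b _ => mul_comm _ _

theorem inv_right (H : IsBihol V V' τ τ') (b c : Fin n) :
    ∑ l, H.jac b l * H.jacInv c l = if b = c then 1 else 0 := by
  -- For square matrices over a commutative ring a one-sided inverse is two-sided, so the chain rule
  -- is needed in one direction only.
  have h : (Matrix.of H.jacInv).transpose * Matrix.of H.jac = 1 := by
    ext m l : 2
    rw [Matrix.mul_apply, Matrix.one_apply]
    exact congrArg _ (H.inv_left m l)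
  have h1 : Matrix.of H.jac * (Matrix.of H.jacInv).transpose = 1 := mul_eq_one_comm.1 h
  have h' := congrFun (congrFun h1 b) c
  rwa [Matrix.mul_apply, Matrix.one_apply] at h'

section Tensor

variable {T T' : Cn n → Matrix (Fin n) (Fin n) ℂ}
  {hT : ∀ l k, ContDiffOn ℝ ∞ (fun z => T z l k) V}
  {hT' : ∀ l k, ContDiffOn ℝ ∞ (fun z => T' z l k) V'}

theorem pull_D (H : IsBihol V V' τ τ')
    (htr : ∀ z ∈ V, ∀ b a, T' (τ z) b a = ∑ l, ∑ k,
      (starRingEnd ℂ) (fderiv ℂ τ z (Pi.single l 1) b) * fderiv ℂ τ z (Pi.single k 1) a * T z l k)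
    (b : Fin n) (f : SmoothAlg V') :
    H.pull ((smoothData V' T' hT').D b f)
      = ∑ l, (H.jac b l : SmoothAlg V) * (smoothData V T hT).D l (H.pull f) := by
  refine ext_evalAt fun z => ?_
  rw [DiffData.D_apply, map_sum, map_sum, map_sum]
  have e1 : ∀ a, evalAt z (H.pull ((smoothData V' T' hT').tensor b a
        * (smoothData V' T' hT').der (Sum.inl a) f))
      = T' (τ z) b a * evalAt z (H.pull (der (Sum.inl a) f)) := fun a => by
    rw [map_mul, map_mul]; rfl
  have e2 : ∀ l, evalAt z ((H.jac b l : SmoothAlg V) * (smoothData V T hT).D l (H.pull f))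
      = ∑ k, ∑ a, (starRingEnd ℂ) (fderiv ℂ τ z (Pi.single l 1) b) * fderiv ℂ τ z (Pi.single k 1) a
        * T z l k * evalAt z (H.pull (der (Sum.inl a) f)) := fun l => by
    rw [map_mul, DiffData.D_apply, map_sum, evalAt_jac, Finset.mul_sum]
    refine Finset.sum_congr rfl fun k _ => ?_
    rw [map_mul, evalAt_mk, H.evalAt_der_hol_pull, Finset.mul_sum, Finset.mul_sum]
    exact Finset.sum_congr rfl fun a _ => by ring
  simp only [e1, e2, htr z z.2, Finset.sum_mul]
  exact sum_rotate _

/-- Pulling back intertwines the derivations on V' with a second frame on V, obtained from ∂̄ and D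
by the Jacobian. Naturality reduces covariance to invariance under this change of frame. -/
theorem pull_opC (H : IsBihol V V' τ τ')
    (htr : ∀ z ∈ V, ∀ b a, T' (τ z) b a = ∑ l, ∑ k,
      (starRingEnd ℂ) (fderiv ℂ τ z (Pi.single l 1) b) * fderiv ℂ τ z (Pi.single k 1) a * T z l k)
    (hS : IsSeparated (smoothData V T hT).db (smoothData V T hT).D) (r : ℕ) (f h : SmoothAlg V') :
    H.pull ((smoothData V' T' hT').opC r f h) = (smoothData V T hT).opC r (H.pull f) (H.pull h) := by
  set X := smoothData V T hT
  let db' : Fin n → Derivation ℂ (SmoothAlg V) (SmoothAlg V) := fun b =>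
    ∑ m, (H.jacInv b m : SmoothAlg V) • X.db m
  let D' : Fin n → Derivation ℂ (SmoothAlg V) (SmoothAlg V) := fun b =>
    ∑ l, (H.jac b l : SmoothAlg V) • X.D l
  have hdb' : ∀ b f, db' b f = ∑ m, H.jacInv b m • X.db m f := by
    intro b f
    simp only [db', ← Derivation.coeFnAddMonoidHom_apply, map_sum, Finset.sum_apply]
    rfl
  have hD' : ∀ b f, D' b f = ∑ l, H.jac b l • X.D l f := by
    intro b f
    simp only [D', ← Derivation.coeFnAddMonoidHom_apply, map_sum, Finset.sum_apply]
    rfl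
  have hF : IsFrameChange (antihol V) X.db X.D db' D' H.jac H.jacInv :=
    { comm_db := hS.comm_db
      comm_D := hS.comm_D
      D_eq_zero := fun q s hs => by
        rw [DiffData.D_apply]
        exact Finset.sum_eq_zero fun k _ => by rw [hs k, mul_zero]
      db_mem := fun m s hs k => by
        rw [DiffData.db, der_comm, hs k, map_zero]
      inv_left := H.inv_left
      inv_right := H.inv_right
      symm := fun m b l => der_comm _ _ _
      db'_apply := hdb'
      D'_apply := hD' }
  have hN : Intertwines H.pull (smoothData V' T' hT').db (smoothData V' T' hT').D db' D' :=
    { map_db := fun b f => by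
        have e : ∀ m, X.db m (H.pull f) = ∑ c, (H.jac c m : SmoothAlg V) * H.pull (der (Sum.inr c) f) :=
          fun m => H.der_antihol_pull m f
        rw [hdb']
        simp only [e, Finset.smul_sum]
        rw [Finset.sum_comm]
        have e' : ∀ c, ∑ m, H.jacInv b m • ((H.jac c m : SmoothAlg V) * H.pull (der (Sum.inr c) f))
            = if c = b then H.pull (der (Sum.inr c) f) else 0 := by
          intro c
          have h := congrArg (Subtype.val) (H.inv_right c b)
          rw [AddSubmonoidClass.coe_finsetSum, apply_ite Subtype.val] at h
          calc _ = (∑ m, ((H.jac c m * H.jacInv b m : antihol V) : SmoothAlg V))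
                * H.pull (der (Sum.inr c) f) := by
                rw [Finset.sum_mul]
                refine Finset.sum_congr rfl fun m _ => ?_
                rw [Subalgebra.smul_def, smul_eq_mul, Subalgebra.coe_mul]
                ring
            _ = _ := by
                rw [h]
                split_ifs
                · exact one_mul _
                · exact zero_mul _
        simp only [e', Finset.sum_ite_eq', Finset.mem_univ, if_true]
        rfl
      map_D := fun b f => by
        rw [H.pull_D htr, hD']
        rfl }
  match r with
  | 0 => exact map_mul _ _ _
  | 1 => exact (hN.map_opC1 f h).trans (hF.opC1_eq _ _)
  | 2 => exact (hN.map_opC2 f h).trans (hF.opC2_eq _ _)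
  | 3 => exact (hN.map_opC3 f h).trans (hF.opC3_eq _ _)
  | r + 4 => exact map_zero _

end Tensor

end IsBihol

end SepVar
end

noncomputable section
set_option linter.unusedSectionVars false

namespace SepVar

open TopologicalSpace (Opens)
open SmoothAlg

variable {n : ℕ}

/-! ### Holomorphic charts -/

theorem contDiffOn_of_mem_groupoid {e : OpenPartialHomeomorph (Cn n) (Cn n)}
    (he : e ∈ contDiffGroupoid ω 𝓘(ℂ, Cn n)) : ContDiffOn ℂ ω e e.source := by
  have h := (mem_groupoid_of_pregroupoid.1 he).1
  simpa [contDiffPregroupoid] using h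

/-- A complex analytic transition map is real smooth, so holomorphic charts are charts of the
underlying real smooth manifold. -/
theorem contDiffGroupoid_le_real :
    contDiffGroupoid ω 𝓘(ℂ, Cn n) ≤ contDiffGroupoid ∞ 𝓘(ℝ, Cn n) := by
  intro e he
  have h : ∀ e ∈ contDiffGroupoid ω 𝓘(ℂ, Cn n), ContDiffOn ℝ ∞ e e.source := fun e he =>
    ((contDiffOn_of_mem_groupoid he).restrict_scalars ℝ).of_le le_top
  refine mem_groupoid_of_pregroupoid.2 ⟨?_, ?_⟩
  · simpa [contDiffPregroupoid] using h e he
  · simpa [contDiffPregroupoid] using h e.symm ((contDiffGroupoid ω 𝓘(ℂ, Cn n)).symm he)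

section Charts

variable {M : Type*} [TopologicalSpace M] [ChartedSpace (Cn n) M]
  {e e' : OpenPartialHomeomorph M (Cn n)}

theorem mem_maximalAtlas_real (he : IsHolChart e) :
    e ∈ IsManifold.maximalAtlas 𝓘(ℝ, Cn n) ∞ M := by
  refine mem_maximalAtlas_iff.2 fun e' he' => ?_
  have h := mem_maximalAtlas_iff.1 he e' he'
  exact ⟨contDiffGroupoid_le_real h.1, contDiffGroupoid_le_real h.2⟩

theorem isHolChart_chartAt [IsManifold 𝓘(ℂ, Cn n) ω M] (x : M) :
    IsHolChart (chartAt (Cn n) x) :=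
  IsManifold.chart_mem_maximalAtlas x

/-- The part of the coordinate domain of a chart that lies over an open set. -/
def chartOpens (e : OpenPartialHomeomorph M (Cn n)) {U : Set M} (hU : IsOpen U) : Opens (Cn n) :=
  ⟨e.target ∩ e.symm ⁻¹' U, e.isOpen_inter_preimage_symm hU⟩

theorem mem_chartOpens {U : Set M} (hU : IsOpen U) {x : M} (hx : x ∈ U ∩ e.source) :
    e x ∈ chartOpens e hU :=
  ⟨e.map_source hx.2, by simpa [e.left_inv hx.2] using hx.1⟩

theorem contDiffOn_of_smoothOn (he : IsHolChart e) {U : Set M} (hU : IsOpen U) {f : M → ℂ}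
    (hf : SmoothOn n f U) : ContDiffOn ℝ ∞ (f ∘ e.symm) (chartOpens e hU) := by
  have h := (contMDiffOn_symm_of_mem_maximalAtlas (mem_maximalAtlas_real he)).mono
    (Set.inter_subset_left (t := e.symm ⁻¹' U))
  exact contMDiffOn_iff_contDiffOn.1 (ContMDiffOn.comp hf h fun z hz => hz.2)

theorem smoothOn_comp (he : IsHolChart e) {V : Set (Cn n)} {F : Cn n → ℂ}
    (hF : ContDiffOn ℝ ∞ F V) : SmoothOn n (F ∘ e) (e.source ∩ e ⁻¹' V) := by
  have h := (contMDiffOn_of_mem_maximalAtlas (mem_maximalAtlas_real he)).mono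
    (Set.inter_subset_left (t := e ⁻¹' V))
  exact ContMDiffOn.comp (contMDiffOn_iff_contDiffOn.2 hF) h fun z hz => hz.2

theorem differentiableAt_of_holOn (he : IsHolChart e) {U : Set M} (hU : IsOpen U) {f : M → ℂ}
    (hf : HolOn n f U) {z : Cn n} (hz : z ∈ chartOpens e hU) :
    DifferentiableAt ℂ (f ∘ e.symm) z := by
  have h := ((contMDiffOn_symm_of_mem_maximalAtlas he).mdifferentiableOn (by simp)).mono
    (Set.inter_subset_left (t := e.symm ⁻¹' U))
  have h' : DifferentiableOn ℂ (f ∘ e.symm) (chartOpens e hU) :=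
    mdifferentiableOn_iff_differentiableOn.1 (MDifferentiableOn.comp hf h fun z hz => hz.2)
  exact (h' z hz).differentiableAt ((chartOpens e hU).isOpen.mem_nhds hz)

theorem contDiffOn_transition (he : IsHolChart e) (he' : IsHolChart e') :
    ContDiffOn ℂ ω (fun z => e' (e.symm z)) (e.symm ≫ₕ e').source :=
  contDiffOn_of_mem_groupoid (IsManifold.compatible_of_mem_maximalAtlas he he')

theorem isBihol_transition (he : IsHolChart e) (he' : IsHolChart e') {W : Set M} (hW : IsOpen W)
    (h : W ⊆ e.source) (h' : W ⊆ e'.source) :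
    IsBihol (chartOpens e hW) (chartOpens e' hW) (fun z => e' (e.symm z))
      (fun z => e (e'.symm z)) := by
  have key : ∀ {e e' : OpenPartialHomeomorph M (Cn n)}, IsHolChart e → IsHolChart e' →
      W ⊆ e'.source → (∀ z ∈ chartOpens e hW, e' (e.symm z) ∈ chartOpens e' hW) ∧
      (∀ z ∈ chartOpens e hW, DifferentiableAt ℂ (fun z => e' (e.symm z)) z) ∧
      ContDiffOn ℝ ∞ (fun z => e' (e.symm z)) (chartOpens e hW) := by
    intro e e' he he' h'
    have hs : (chartOpens e hW : Set (Cn n)) ⊆ (e.symm ≫ₕ e').source := by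
      intro z hz
      rw [OpenPartialHomeomorph.trans_source]
      exact ⟨hz.1, h' hz.2⟩
    have hc := (contDiffOn_transition he he').mono hs
    refine ⟨fun z hz => mem_chartOpens hW ⟨hz.2, h' hz.2⟩, fun z hz => ?_, ?_⟩
    · exact (hc.contDiffAt ((chartOpens e hW).isOpen.mem_nhds hz)).differentiableAt (by simp)
    · exact (hc.restrict_scalars ℝ).of_le le_top
  obtain ⟨a1, a2, a3⟩ := key he he' h'
  obtain ⟨b1, b2, b3⟩ := key he' he h
  refine ⟨a1, b1, fun z hz => ?_, a2, b2, a3, b3⟩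
  rw [e'.left_inv (h' hz.2), e.right_inv hz.1]

/-! ### Tensors -/

/-- The smooth tensors of type `T^{l̄ k}`. -/
structure IsSmoothTensor (T : ChartTensor n M) : Prop where
  smooth : ∀ e : OpenPartialHomeomorph M (Cn n), IsHolChart e → ∀ l k : Fin n,
    ContDiffOn ℝ ∞ (fun z => T e z l k) e.target
  transform : ∀ e e' : OpenPartialHomeomorph M (Cn n), IsHolChart e → IsHolChart e' →
    ∀ x ∈ e.source ∩ e'.source, ∀ b a : Fin n,
      T e' (e' x) b a = ∑ l, ∑ k,
        (starRingEnd ℂ) (jacobian e e' x b l) * jacobian e e' x a k * T e (e x) l k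

namespace IsSmoothTensor

variable {T : ChartTensor n M}

theorem smooth_subset (hT : IsSmoothTensor T) (he : IsHolChart e) {V : Opens (Cn n)}
    (hV : (V : Set (Cn n)) ⊆ e.target) (l k : Fin n) : ContDiffOn ℝ ∞ (fun z => T e z l k) V :=
  (hT.smooth e he l k).mono hV

/-- The differential algebra of a tensor in a chart. -/
abbrev data (hT : IsSmoothTensor T) (he : IsHolChart e) {V : Opens (Cn n)}
    (hV : (V : Set (Cn n)) ⊆ e.target) : DiffData n :=
  smoothData V (T e) (hT.smooth_subset he hV)

theorem transform_chart (hT : IsSmoothTensor T) (he : IsHolChart e) (he' : IsHolChart e')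
    {W : Set M} (hW : IsOpen W) (h : W ⊆ e'.source) :
    ∀ z ∈ chartOpens e hW, ∀ b a, T e' (e' (e.symm z)) b a = ∑ l, ∑ k,
      (starRingEnd ℂ) (fderiv ℂ (fun z => e' (e.symm z)) z (Pi.single l 1) b)
        * fderiv ℂ (fun z => e' (e.symm z)) z (Pi.single k 1) a * T e z l k := by
  intro z hz b a
  have := hT.transform e e' he he' (e.symm z) ⟨e.map_target hz.1, h hz.2⟩ b a
  simpa only [jacobian, e.right_inv hz.1] using this

end IsSmoothTensor

/-- A local operator on functions on `ℂⁿ`, given in a chart by a universal operator, has the same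
value in all charts as soon as the universal operator is natural. -/
theorem eval_eq_of_pull {T : ChartTensor n M} (hT : IsSmoothTensor T)
    {Q : ∀ X : DiffData n, X.carrier → X.carrier → X.carrier}
    {L : (Cn n → Matrix (Fin n) (Fin n) ℂ) → (Cn n → ℂ) → (Cn n → ℂ) → Cn n → ℂ}
    (hL : ∀ (V : Opens (Cn n)) (S : Cn n → Matrix (Fin n) (Fin n) ℂ)
      (hS : ∀ l k, ContDiffOn ℝ ∞ (fun z => S z l k) V) (φ ψ : Cn n → ℂ)
      (hφ : ContDiffOn ℝ ∞ φ V) (hψ : ContDiffOn ℝ ∞ ψ V),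
      Represents (Q (smoothData V S hS) (mk φ hφ) (mk ψ hψ)) (L S φ ψ))
    (hQ : ∀ (V V' : Opens (Cn n)) (τ τ' : Cn n → Cn n) (H : IsBihol V V' τ τ')
      (e e' : OpenPartialHomeomorph M (Cn n)) (he : IsHolChart e) (he' : IsHolChart e')
      (hV : (V : Set (Cn n)) ⊆ e.target) (hV' : (V' : Set (Cn n)) ⊆ e'.target),
      (∀ z ∈ V, ∀ b a, T e' (τ z) b a = ∑ l, ∑ k, (starRingEnd ℂ) (fderiv ℂ τ z (Pi.single l 1) b)
        * fderiv ℂ τ z (Pi.single k 1) a * T e z l k) → ∀ p q,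
      H.pull (Q (hT.data he' hV') p q) = Q (hT.data he hV) (H.pull p) (H.pull q))
    (he : IsHolChart e) (he' : IsHolChart e') {V : Opens (Cn n)}
    {f h : M → ℂ} (hf : ContDiffOn ℝ ∞ (f ∘ e.symm) V) (hh : ContDiffOn ℝ ∞ (h ∘ e.symm) V)
    {x : M} (hx : x ∈ e.source) (hx' : x ∈ e'.source) (hxV : e x ∈ V) :
    L (T e') (f ∘ e'.symm) (h ∘ e'.symm) (e' x) = L (T e) (f ∘ e.symm) (h ∘ e.symm) (e x) := by
  -- On the common domain the transition map is biholomorphic and pulls the coordinate expressions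
  -- in one chart back to those in the other.
  set W : Set M := e.source ∩ e ⁻¹' V ∩ e'.source with hWdef
  have hW : IsOpen W := (e.isOpen_inter_preimage V.isOpen).inter e'.open_source
  have hWe : W ⊆ e.source := fun y hy => hy.1.1
  have hWe' : W ⊆ e'.source := fun y hy => hy.2
  have hxW : x ∈ W := ⟨⟨hx, hxV⟩, hx'⟩
  have H := isBihol_transition he he' hW hWe hWe'
  have H' := isBihol_transition he' he hW hWe' hWe
  have hsub : ∀ z ∈ chartOpens e hW, z ∈ V := fun z hz => by
    have := hz.2.1.2
    rwa [Set.mem_preimage, e.right_inv hz.1] at this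
  have sm : ∀ {f : M → ℂ}, ContDiffOn ℝ ∞ (f ∘ e.symm) V →
      ContDiffOn ℝ ∞ (f ∘ e.symm) (chartOpens e hW) := fun hf => hf.mono hsub
  have sm' : ∀ {f : M → ℂ}, ContDiffOn ℝ ∞ (f ∘ e.symm) V →
      ContDiffOn ℝ ∞ (f ∘ e'.symm) (chartOpens e' hW) := fun {f} hf =>
    (H'.contDiffOn_comp (sm hf)).congr fun z hz => by
      simp only [Function.comp_apply, e.left_inv (hWe hz.2)]
  have pl : ∀ {f : M → ℂ} (hf : ContDiffOn ℝ ∞ (f ∘ e.symm) V),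
      H.pull (mk (f ∘ e'.symm) (sm' hf)) = mk (f ∘ e.symm) (sm hf) := fun {f} hf => by
    rw [H.pull_mk, mk_eq_iff]
    intro z hz
    simp only [Function.comp_apply, e'.left_inv (hWe' hz.2)]
  have hz : e x ∈ chartOpens e hW := mem_chartOpens hW ⟨hxW, hx⟩
  have hz' : e' x ∈ chartOpens e' hW := mem_chartOpens hW ⟨hxW, hx'⟩
  rw [← hL (chartOpens e hW) (T e) (hT.smooth_subset he Set.inter_subset_left) _ _ (sm hf) (sm hh)
      ⟨e x, hz⟩,
    ← hL (chartOpens e' hW) (T e') (hT.smooth_subset he' Set.inter_subset_left) _ _ (sm' hf)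
      (sm' hh) ⟨e' x, hz'⟩]
  have key := hQ _ _ _ _ H e e' he he' Set.inter_subset_left Set.inter_subset_left
    (hT.transform_chart he he' hW hWe') (mk (f ∘ e'.symm) (sm' hf)) (mk (h ∘ e'.symm) (sm' hh))
  rw [pl hf, pl hh] at key
  refine Eq.trans ?_ (congrArg (evalAt ⟨e x, hz⟩) key)
  have hp : ∀ p : SmoothAlg (chartOpens e' hW), evalAt ⟨e' x, hz'⟩ p
      = evalAt ⟨e x, hz⟩ (H.pull p) := by
    intro p
    change p.1 _ = p.1 _
    exact congrArg p.1 (Subtype.ext (congrArg e' (e.left_inv hx)).symm)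
  exact hp _

end Charts

end SepVar
end

noncomputable section
set_option linter.unusedSectionVars false

namespace SepVar

open TopologicalSpace (Opens)
open SmoothAlg

variable {n : ℕ}

/-! ### The bracket of a tensor -/

/-- A direct contraction that needs only the transformation law. The bracket must be known to be
independent of the chart before its Jacobi identity can be used in a fixed chart. -/
theorem IsBihol.pull_opC1 {V V' : Opens (Cn n)} {τ τ' : Cn n → Cn n} (H : IsBihol V V' τ τ')
    {T T' : Cn n → Matrix (Fin n) (Fin n) ℂ}
    {hT : ∀ l k, ContDiffOn ℝ ∞ (fun z => T z l k) V}
    {hT' : ∀ l k, ContDiffOn ℝ ∞ (fun z => T' z l k) V'}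
    (htr : ∀ z ∈ V, ∀ b a, T' (τ z) b a = ∑ l, ∑ k,
      (starRingEnd ℂ) (fderiv ℂ τ z (Pi.single l 1) b) * fderiv ℂ τ z (Pi.single k 1) a * T z l k)
    (f h : SmoothAlg V') :
    H.pull (opC1 (smoothData V' T' hT').db (smoothData V' T' hT').D f h)
      = opC1 (smoothData V T hT).db (smoothData V T hT).D (H.pull f) (H.pull h) := by
  have e : ∀ l, (smoothData V T hT).db l (H.pull f)
      = ∑ b, (H.jac b l : SmoothAlg V) * H.pull (der (Sum.inr b) f) := fun l =>
    H.der_antihol_pull l f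
  have e' : ∀ b, H.pull ((smoothData V' T' hT').db b f * (smoothData V' T' hT').D b h)
      = ∑ l, (H.jac b l : SmoothAlg V) * H.pull (der (Sum.inr b) f)
        * (smoothData V T hT).D l (H.pull h) := fun b => by
    rw [map_mul, H.pull_D (hT := hT) htr, Finset.mul_sum]
    exact Finset.sum_congr rfl fun l _ => by rw [DiffData.db]; ring
  simp only [opC1]
  rw [map_sum]
  simp only [e', e, Finset.sum_mul]
  exact Finset.sum_comm

section Manifold

variable {M : Type*} [TopologicalSpace M] [ChartedSpace (Cn n) M]

theorem bracket_eq (T : ChartTensor n M) (f h : M → ℂ) (x : M) :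
    bracket T f h x = I * (poissonC1 (T (chartAt (Cn n) x)) (h ∘ (chartAt (Cn n) x).symm)
        (f ∘ (chartAt (Cn n) x).symm) (chartAt (Cn n) x x)
      - poissonC1 (T (chartAt (Cn n) x)) (f ∘ (chartAt (Cn n) x).symm)
        (h ∘ (chartAt (Cn n) x).symm) (chartAt (Cn n) x x)) := by
  simp only [bracket, poissonC1, ← Finset.sum_sub_distrib]
  congr 1
  exact Finset.sum_congr rfl fun l _ => Finset.sum_congr rfl fun k _ => by ring

variable [IsManifold 𝓘(ℂ, Cn n) ω M]

variable {T : ChartTensor n M} {e : OpenPartialHomeomorph M (Cn n)}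

/-- The bracket is computed in a chart varying with the point; its independence of the chart gives
one formula on all of V. In this form brackets can be iterated. -/
theorem represents_bracket (hT : IsSmoothTensor T) (he : IsHolChart e) {V : Opens (Cn n)}
    (hV : (V : Set (Cn n)) ⊆ e.target) {p q : SmoothAlg V} {f h : M → ℂ}
    (hp : Represents p (f ∘ e.symm)) (hq : Represents q (h ∘ e.symm)) :
    Represents (I • opBr (hT.data he hV).db (hT.data he hV).D p q) (bracket T f h ∘ e.symm) := by
  intro z
  have hx : e.symm z ∈ e.source := e.map_target (hV z.2)
  have hz : e (e.symm z) = z := e.right_inv (hV z.2)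
  have key : ∀ {f h : M → ℂ}, ContDiffOn ℝ ∞ (f ∘ e.symm) V → ContDiffOn ℝ ∞ (h ∘ e.symm) V →
      poissonC1 (T (chartAt (Cn n) (e.symm z))) (f ∘ (chartAt (Cn n) (e.symm z)).symm)
        (h ∘ (chartAt (Cn n) (e.symm z)).symm) (chartAt (Cn n) (e.symm z) (e.symm z))
        = poissonC1 (T e) (f ∘ e.symm) (h ∘ e.symm) z := by
    intro f h hf hh
    have := eval_eq_of_pull (L := poissonC1) (Q := fun X φ ψ => opC1 X.db X.D φ ψ) hT
      (fun V S hS φ ψ hφ hψ => represents_opC1 hφ hψ)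
      (fun V V' τ τ' H e e' he he' hV hV' htr p q => H.pull_opC1 htr p q)
      he (isHolChart_chartAt (e.symm z)) hf hh hx (mem_chart_source _ _) (by rw [hz]; exact z.2)
    rwa [hz] at this
  rw [Function.comp_apply, bracket_eq, key hq.contDiffOn hp.contDiffOn,
    key hp.contDiffOn hq.contDiffOn, map_smul, smul_eq_mul, opBr, map_sub, hp.eq_mk, hq.eq_mk]
  congr 1
  exact congrArg₂ _ (represents_opC1 hq.contDiffOn hp.contDiffOn z)
    (represents_opC1 hp.contDiffOn hq.contDiffOn z)

theorem opBr_smul_right {ι : Type*} [Fintype ι] {A : Type*} [CommRing A] [Algebra ℂ A]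
    (db D : ι → Derivation ℂ A A) (a : ℂ) (f h : A) :
    opBr db D f (a • h) = a • opBr db D f h := by
  simp only [opBr, opC1, Derivation.map_smul, smul_mul_assoc, mul_smul_comm, ← Finset.smul_sum,
    smul_sub]

/-- The Jacobi identity in coordinates. -/
def IsLocallySeparated (hT : IsSmoothTensor T) : Prop :=
  ∀ (e : OpenPartialHomeomorph M (Cn n)) (he : IsHolChart e) (V : Opens (Cn n))
    (hV : (V : Set (Cn n)) ⊆ e.target), IsSeparated (hT.data he hV).db (hT.data he hV).D

theorem der_antihol_conj {V : Opens (Cn n)} (m l : Fin n) :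
    der (Sum.inr m) (mk (V := V) _ ((contDiff_conj_coord l).contDiffOn))
      = if m = l then 1 else 0 := by
  refine ext_evalAt fun z => ?_
  rw [der_mk, evalAt_mk, apply_ite (evalAt z), map_one, map_zero]
  exact dzbar_conj m l z

theorem der_hol_conj {V : Opens (Cn n)} (k l : Fin n) :
    der (Sum.inl k) (mk (V := V) _ ((contDiff_conj_coord l).contDiffOn)) = 0 := by
  refine ext_evalAt fun z => ?_
  rw [der_mk, evalAt_mk, map_zero]
  exact dz_conj k l z

theorem isLocallySeparated_of_poisson (hP : IsPoissonBivector T) (hT : IsSmoothTensor T) :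
    IsLocallySeparated hT := by
  intro e he V hV
  refine isSeparated_of_jacobi (fun _ _ _ => der_comm _ _ _)
    (y := fun l => mk (V := V) _ ((contDiff_conj_coord l).contDiffOn)) der_antihol_conj
    (fun m l => ?_) fun f g h => ext_evalAt fun z => ?_
  · rw [DiffData.D_apply]
    refine Finset.sum_eq_zero fun k _ => ?_
    rw [show (hT.data he hV).der (Sum.inl k) (mk _ ((contDiff_conj_coord l).contDiffOn)) = 0 from
      der_hol_conj k l, mul_zero]
  · have hW : IsOpen (e.source ∩ e ⁻¹' V) := e.isOpen_inter_preimage V.isOpen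
    -- Arbitrary local functions in coordinates are moved to an open subset of M, where the Jacobi
    -- identity is assumed.
    have sm : ∀ f : SmoothAlg V, SmoothOn n (rep f ∘ e) (e.source ∩ e ⁻¹' V) := fun f =>
      smoothOn_comp he (contDiffOn_rep f)
    have rp : ∀ f : SmoothAlg V, Represents f ((rep f ∘ e) ∘ e.symm) := fun f z => by
      simp only [Function.comp_apply, e.right_inv (hV z.2)]
      conv_lhs => rw [← mk_rep f]
      rfl
    have hx : e.symm z ∈ e.source ∩ e ⁻¹' V :=
      ⟨e.map_target (hV z.2), by rw [Set.mem_preimage, e.right_inv (hV z.2)]; exact z.2⟩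
    have J := hP.jacobi _ hW _ _ _ (sm f) (sm g) (sm h) _ hx
    have b : ∀ f g h : SmoothAlg V, bracket T (rep f ∘ e) (bracket T (rep g ∘ e) (rep h ∘ e)) (e.symm z)
        = -evalAt z (opBr (hT.data he hV).db (hT.data he hV).D f
          (opBr (hT.data he hV).db (hT.data he hV).D g h)) := by
      intro f g h
      have := represents_bracket hT he hV (rp f) (represents_bracket hT he hV (rp g) (rp h)) z
      rw [Function.comp_apply] at this
      -- Each bracket carries a factor i, so a double bracket carries -1.
      rw [← this, opBr_smul_right, map_smul, map_smul, smul_smul, I_mul_I, neg_one_smul]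
    rw [b, b, b] at J
    rw [map_add, map_add, map_zero]
    linear_combination -J

theorem jacobi_of_isLocallySeparated (hT : IsSmoothTensor T) (hS : IsLocallySeparated hT)
    (U : Set M) (hU : IsOpen U) (f g h : M → ℂ) (hf : SmoothOn n f U) (hg : SmoothOn n g U)
    (hh : SmoothOn n h U) (x : M) (hx : x ∈ U) :
    bracket T f (bracket T g h) x + bracket T g (bracket T h f) x
        + bracket T h (bracket T f g) x = 0 := by
  have he := isHolChart_chartAt (n := n) x
  set e := chartAt (Cn n) x with hedef
  have hxe : x ∈ e.source := mem_chart_source _ _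
  have hV : (chartOpens e hU : Set (Cn n)) ⊆ e.target := Set.inter_subset_left
  have hz : e x ∈ chartOpens e hU := mem_chartOpens hU ⟨hx, hxe⟩
  have b : ∀ {f g h : M → ℂ} (hf : SmoothOn n f U) (hg : SmoothOn n g U) (hh : SmoothOn n h U),
      bracket T f (bracket T g h) x
        = -evalAt ⟨e x, hz⟩ (opBr (hT.data he hV).db (hT.data he hV).D
          (mk _ (contDiffOn_of_smoothOn he hU hf))
          (opBr (hT.data he hV).db (hT.data he hV).D (mk _ (contDiffOn_of_smoothOn he hU hg))
            (mk _ (contDiffOn_of_smoothOn he hU hh)))) := by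
    intro f g h hf hg hh
    have := represents_bracket hT he hV (represents_mk (contDiffOn_of_smoothOn he hU hf))
      (represents_bracket hT he hV (represents_mk (contDiffOn_of_smoothOn he hU hg))
        (represents_mk (contDiffOn_of_smoothOn he hU hh))) ⟨e x, hz⟩
    rw [Function.comp_apply, e.left_inv hxe] at this
    rw [← this, opBr_smul_right, map_smul, map_smul, smul_smul, I_mul_I, neg_one_smul]
  rw [b hf hg hh, b hg hh hf, b hh hf hg, ← neg_add, ← neg_add, ← map_add, ← map_add,
    (hS e he _ hV).jacobi, map_zero, neg_zero]

end Manifold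

end SepVar
end

noncomputable section
set_option linter.unusedSectionVars false

namespace SepVar

open TopologicalSpace (Opens)
open SmoothAlg

variable {n : ℕ}

/-! ### Associativity of the formal product -/

section Series

variable {A : Type*} [CommRing A]

/-- The coefficient of `ν^k` in the product of two formal series. -/
def starCoeff (C : ℕ → A → A → A) (F H : ℕ → A) (k : ℕ) : A :=
  ∑ p ∈ Finset.HasAntidiagonal.antidiagonal k, ∑ q ∈ Finset.HasAntidiagonal.antidiagonal p.2,
    C p.1 (F q.1) (H q.2)

/-- By additivity in each argument, associativity of the truncated series reduces to the identities
between the C_r on single functions. -/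
theorem starCoeff_assoc {C : ℕ → A → A → A} (hl : ∀ r f g h, C r (f + g) h = C r f h + C r g h)
    (hr : ∀ r f g h, C r f (g + h) = C r f g + C r f h)
    (ha : ∀ k ≤ 3, ∀ f g h, ∑ p ∈ Finset.HasAntidiagonal.antidiagonal k, C p.1 (C p.2 f g) h
      = ∑ p ∈ Finset.HasAntidiagonal.antidiagonal k, C p.1 f (C p.2 g h))
    (F G H : ℕ → A) (k : ℕ) (hk : k ≤ 3) :
    starCoeff C (starCoeff C F G) H k = starCoeff C F (starCoeff C G H) k := by
  have a0 := ha 0 (by norm_num)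
  have a1 := ha 1 (by norm_num)
  have a2 := ha 2 (by norm_num)
  have a3 := ha 3 (by norm_num)
  simp [Finset.Nat.antidiagonal_succ] at a0 a1 a2 a3
  interval_cases k
  · simp [starCoeff, a0]
  · simp [starCoeff, Finset.Nat.antidiagonal_succ, hl, hr]
    -- One instance of the order j identity for every triple of indices of F, G, H with sum k - j.
    linear_combination a0 (F 0) (G 0) (H 1) + a0 (F 0) (G 1) (H 0) + a0 (F 1) (G 0) (H 0)
      + a1 (F 0) (G 0) (H 0)
  · simp [starCoeff, Finset.Nat.antidiagonal_succ, hl, hr]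
    linear_combination a0 (F 0) (G 0) (H 2) + a0 (F 0) (G 1) (H 1) + a0 (F 0) (G 2) (H 0)
      + a0 (F 1) (G 0) (H 1) + a0 (F 1) (G 1) (H 0) + a0 (F 2) (G 0) (H 0)
      + a1 (F 0) (G 0) (H 1) + a1 (F 0) (G 1) (H 0) + a1 (F 1) (G 0) (H 0)
      + a2 (F 0) (G 0) (H 0)
  · simp [starCoeff, Finset.Nat.antidiagonal_succ, hl, hr]
    linear_combination a0 (F 0) (G 0) (H 3) + a0 (F 0) (G 1) (H 2) + a0 (F 0) (G 2) (H 1)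
      + a0 (F 0) (G 3) (H 0) + a0 (F 1) (G 0) (H 2) + a0 (F 1) (G 1) (H 1)
      + a0 (F 1) (G 2) (H 0) + a0 (F 2) (G 0) (H 1) + a0 (F 2) (G 1) (H 0)
      + a0 (F 3) (G 0) (H 0) + a1 (F 0) (G 0) (H 2) + a1 (F 0) (G 1) (H 1)
      + a1 (F 0) (G 2) (H 0) + a1 (F 1) (G 0) (H 1) + a1 (F 1) (G 1) (H 0)
      + a1 (F 2) (G 0) (H 0) + a2 (F 0) (G 0) (H 1) + a2 (F 0) (G 1) (H 0)
      + a2 (F 1) (G 0) (H 0) + a3 (F 0) (G 0) (H 0)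

end Series

namespace DiffData

variable (X : DiffData n)

theorem opU_add (l : Fin n) (f g : X.carrier) :
    opU X.db X.D l (f + g) = opU X.db X.D l f + opU X.db X.D l g := by
  simp only [opU, map_add, Finset.sum_add_distrib, smul_add]

theorem opV_add (l : Fin n) (f g : X.carrier) :
    opV X.db X.D l (f + g) = opV X.db X.D l f + opV X.db X.D l g := by
  simp only [opV, ← smul_add, ← Finset.sum_add_distrib, map_add]
  congr 1
  exact Finset.sum_congr rfl fun a _ => Finset.sum_congr rfl fun b _ => by ring

theorem opC_add_left (r : ℕ) (f g h : X.carrier) :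
    X.opC r (f + g) h = X.opC r f h + X.opC r g h := by
  match r with
  | 0 => exact add_mul _ _ _
  | 1 => simp only [opC, opC1, map_add, add_mul, Finset.sum_add_distrib]
  | 2 =>
    simp only [opC, opC2, map_add, add_mul, Finset.sum_add_distrib, smul_add]
    ring
  | 3 =>
    simp only [opC, opC3, map_add, add_mul, Finset.sum_add_distrib, smul_add]
    ring
  | r + 4 => simp [opC]

theorem opC_add_right (r : ℕ) (f g h : X.carrier) :
    X.opC r f (g + h) = X.opC r f g + X.opC r f h := by
  match r with
  | 0 => exact mul_add _ _ _
  | 1 => simp only [opC, opC1, map_add, mul_add, Finset.sum_add_distrib]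
  | 2 =>
    simp only [opC, opC2, map_add, mul_add, Finset.sum_add_distrib, smul_add, opU_add]
    ring
  | 3 =>
    simp only [opC, opC3, map_add, mul_add, Finset.sum_add_distrib, smul_add, opU_add, opV_add]
    ring
  | r + 4 => simp [opC]

theorem opC_assoc {X : DiffData n} (H : IsSeparated X.db X.D) (k : ℕ) (hk : k ≤ 3)
    (f g h : X.carrier) :
    ∑ p ∈ Finset.HasAntidiagonal.antidiagonal k, X.opC p.1 (X.opC p.2 f g) h
      = ∑ p ∈ Finset.HasAntidiagonal.antidiagonal k, X.opC p.1 f (X.opC p.2 g h) := by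
  interval_cases k
  · simp [opC, mul_assoc]
  · simp [Finset.Nat.antidiagonal_succ, opC]
    linear_combination IsSeparated.assoc_one (db := X.db) (D := X.D) f g h
  · simp [Finset.Nat.antidiagonal_succ, opC]
    linear_combination H.assoc_two f g h
  · simp [Finset.Nat.antidiagonal_succ, opC]
    linear_combination H.assoc_three f g h

end DiffData

/-! ### Separation of variables -/

theorem dzbar_eq_zero {f : Cn n → ℂ} {z : Cn n} (hf : DifferentiableAt ℂ f z) (l : Fin n) :
    dzbar l f z = 0 := by
  rw [dzbar, hf.fderiv_restrictScalars ℝ, single_I]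
  simp only [ContinuousLinearMap.coe_restrictScalars', map_smul, smul_eq_mul, ← mul_assoc, I_mul_I]
  ring

theorem dz_eq_zero {f : Cn n → ℂ} {z : Cn n}
    (hf : DifferentiableAt ℂ (fun w => (starRingEnd ℂ) (f w)) z) (k : Fin n) : dz k f z = 0 := by
  have h := (Complex.conjCLE : ℂ →L[ℝ] ℂ).hasFDerivAt.comp z (hf.hasFDerivAt.restrictScalars ℝ)
  have e : (Complex.conjCLE : ℂ →L[ℝ] ℂ) ∘ (fun w => (starRingEnd ℂ) (f w)) = f := by
    funext w; simp
  rw [e] at h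
  rw [dz, h.fderiv, single_I]
  simp only [ContinuousLinearMap.comp_apply, ContinuousLinearMap.coe_restrictScalars', map_smul,
    smul_eq_mul, ContinuousLinearEquiv.coe_coe, conjCLE_apply, map_mul, conj_I, ← mul_assoc,
    mul_neg, I_mul_I]
  ring

theorem partials_append (s t : List (Dir n)) (f : Cn n → ℂ) :
    partials (s ++ t) f = partials s (partials t f) := by
  induction s with
  | nil => rfl
  | cons d s ih => rw [List.cons_append, partials_cons, partials_cons, ih]

/-- The innermost derivative vanishes on a whole neighbourhood, so all further derivatives of it
vanish at the point. -/
theorem partials_eq_zero {i : List (Dir n)} {d : Dir n} {f : Cn n → ℂ} {z : Cn n}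
    (hf : ∀ᶠ w in nhds z, pd d f w = 0) : partials (i ++ [d]) f z = 0 := by
  rw [partials_append, partials_cons]
  have h : pd d (partials [] f) =ᶠ[nhds z] fun _ => 0 := hf
  rw [(partials_congr i h).eq_of_nhds]
  have : ∀ i : List (Dir n), partials i (fun _ : Cn n => (0 : ℂ)) = fun _ => 0 := by
    intro i
    induction i with
    | nil => rfl
    | cons d i ih => rw [partials_cons, ih]; exact funext fun z => pd_const d 0 z
  rw [this]

/-! ### The star-product up to the third order -/

/-- The regular expressions `E r` have the universal operators as their values. -/
structure IsUniversal (E : ℕ → RegularOp n) : Prop where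
  zeroth : E 0 = Finsupp.single ([], []) 1
  separated : ∀ r, 1 ≤ r → ∀ i ∈ (E r).support, DiffData.EndsAntihol i.1 ∧ DiffData.EndsHol i.2
  regEval : ∀ r (X : DiffData n) φ ψ, X.regEval (E r) φ ψ = X.opC r φ ψ

namespace IsUniversal

variable {E : ℕ → RegularOp n}

theorem represents_eval (hE : IsUniversal E) (r : ℕ) {V : Opens (Cn n)}
    {S : Cn n → Matrix (Fin n) (Fin n) ℂ} (hS : ∀ l k, ContDiffOn ℝ ∞ (fun z => S z l k) V)
    {φ ψ : Cn n → ℂ} (hφ : ContDiffOn ℝ ∞ φ V) (hψ : ContDiffOn ℝ ∞ ψ V) :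
    Represents ((smoothData V S hS).opC r (SmoothAlg.mk φ hφ) (SmoothAlg.mk ψ hψ)) ((E r).eval S φ ψ) := by
  intro z
  rw [← hE.regEval, evalAt_regEval]

variable {M : Type*} [TopologicalSpace M] [ChartedSpace (Cn n) M]
  {T : ChartTensor n M}

theorem eval_eq (hE : IsUniversal E) (hT : IsSmoothTensor T) (hS : IsLocallySeparated hT) (r : ℕ)
    {e e' : OpenPartialHomeomorph M (Cn n)} (he : IsHolChart e) (he' : IsHolChart e')
    {V : Opens (Cn n)} {f h : M → ℂ} (hf : ContDiffOn ℝ ∞ (f ∘ e.symm) V)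
    (hh : ContDiffOn ℝ ∞ (h ∘ e.symm) V) {x : M} (hx : x ∈ e.source) (hx' : x ∈ e'.source)
    (hxV : e x ∈ V) :
    (E r).eval (T e') (f ∘ e'.symm) (h ∘ e'.symm) (e' x)
      = (E r).eval (T e) (f ∘ e.symm) (h ∘ e.symm) (e x) :=
  eval_eq_of_pull (L := (E r).eval) (Q := fun X φ ψ => X.opC r φ ψ) hT
    (fun _ _ hS _ _ hφ hψ => hE.represents_eval r hS hφ hψ)
    (fun _ _ _ _ H e _ he _ hV _ htr p q => H.pull_opC htr (hS e he _ hV) r p q)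
    he he' hf hh hx hx' hxV

variable [IsManifold 𝓘(ℂ, Cn n) ω M]

/-- The operator on M uses a different chart at each point. Covariance replaces these by one fixed
chart, so that operators can be composed and associativity can be checked inside one differential
algebra. -/
theorem represents_toOperator (hE : IsUniversal E) (hT : IsSmoothTensor T)
    (hS : IsLocallySeparated hT) (r : ℕ) {e : OpenPartialHomeomorph M (Cn n)} (he : IsHolChart e)
    {V : Opens (Cn n)} (hV : (V : Set (Cn n)) ⊆ e.target) {p q : SmoothAlg V} {f h : M → ℂ}
    (hp : Represents p (f ∘ e.symm)) (hq : Represents q (h ∘ e.symm)) :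
    Represents ((hT.data he hV).opC r p q) ((E r).toOperator T f h ∘ e.symm) := by
  intro z
  have hz : e (e.symm z) = z := e.right_inv (hV z.2)
  have h := hE.eval_eq hT hS r he (isHolChart_chartAt (e.symm z)) hp.contDiffOn hq.contDiffOn
    (e.map_target (hV z.2)) (mem_chart_source _ _) (by rw [hz]; exact z.2)
  rw [hz] at h
  rw [Function.comp_apply, RegularOp.toOperator, h, hp.eq_mk, hq.eq_mk]
  exact hE.represents_eval r _ hp.contDiffOn hq.contDiffOn z

theorem isCovariant (hE : IsUniversal E) (hT : IsSmoothTensor T) (hS : IsLocallySeparated hT)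
    (r : ℕ) : (E r).IsCovariant T := by
  intro U hU f h hf hh e he x hx
  exact (hE.eval_eq hT hS r he (isHolChart_chartAt x) (contDiffOn_of_smoothOn he hU hf)
    (contDiffOn_of_smoothOn he hU hh) hx.2 (mem_chart_source _ _) (mem_chartOpens hU hx)).symm

theorem isBidifferential (hE : IsUniversal E) (hT : IsSmoothTensor T) (hS : IsLocallySeparated hT)
    (r : ℕ) : IsBidifferential (n := n) ((E r).toOperator T) := by
  intro e he
  refine ⟨(E r).mapRange (fun a z =>
    MvPolynomial.eval (fun v => partials v.2.2 (fun w => T e w v.1 v.2.1) z) a)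
    (funext fun z => map_zero _), fun i => ?_, fun U hU f h hf hh x hx => ?_⟩
  · rw [Finsupp.mapRange_apply]
    let V : Opens (Cn n) := ⟨e.target, e.open_target⟩
    -- A coefficient is the value of a polynomial in elements of the algebra of smooth functions,
    -- hence smooth.
    have hr : Represents ((hT.data he (V := V) subset_rfl).polyEval (E r i)) (fun z =>
        MvPolynomial.eval (fun v => partials v.2.2 (fun w => T e w v.1 v.2.1) z) (E r i)) := by
      intro z
      rw [DiffData.polyEval, ← AlgHom.comp_apply, MvPolynomial.comp_aeval]
      simp only [iterDer_mk, evalAt_mk]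
      rfl
    exact hr.contDiffOn
  · rw [Finsupp.sum_mapRange_index (by intro i; simp), ← hE.isCovariant hT hS r U hU f h hf hh e he x hx]
    rfl

/-- Every term of positive order has an innermost ∂̄ on the first argument, which kills holomorphic
functions, and an innermost ∂ on the second, which kills antiholomorphic ones. -/
theorem hasSeparation (hE : IsUniversal E) :
    HasSeparationOfVariablesUpTo n 3 (fun r => (E r).toOperator (M := M) T) := by
  intro U hU a b f ha hb _ r hr _ x hx
  have he := isHolChart_chartAt (n := n) x
  have hxV := mem_chartOpens (e := chartAt (Cn n) x) hU ⟨hx, mem_chart_source _ x⟩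
  have hn := (chartOpens (chartAt (Cn n) x) hU).isOpen.mem_nhds hxV
  constructor
  · refine Finset.sum_eq_zero fun i hi => ?_
    obtain ⟨t, l, hl⟩ := (hE.separated r hr i hi).1
    beta_reduce
    rw [hl, partials_eq_zero, mul_zero, zero_mul]
    exact Filter.mem_of_superset hn fun w hw =>
      dzbar_eq_zero (differentiableAt_of_holOn he hU ha hw) l
  · refine Finset.sum_eq_zero fun i hi => ?_
    obtain ⟨t, k, hk⟩ := (hE.separated r hr i hi).2
    beta_reduce
    rw [hk, partials_eq_zero, mul_zero]
    exact Filter.mem_of_superset hn fun w hw =>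
      dz_eq_zero (differentiableAt_of_holOn he hU hb hw) k

theorem toOperator_one (hE : IsUniversal E) (hT : IsSmoothTensor T)
    {U : Set M} (hU : IsOpen U) {f h : M → ℂ} (hf : SmoothOn n f U) (hh : SmoothOn n h U) {x : M}
    (hx : x ∈ U) : (E 1).toOperator T f h x
      = poissonC1 (T (chartAt (Cn n) x)) (f ∘ (chartAt (Cn n) x).symm)
        (h ∘ (chartAt (Cn n) x).symm) (chartAt (Cn n) x x) := by
  have he := isHolChart_chartAt (n := n) x
  have hxV := mem_chartOpens (e := chartAt (Cn n) x) hU ⟨hx, mem_chart_source _ x⟩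
  have hV : (chartOpens (chartAt (Cn n) x) hU : Set (Cn n)) ⊆ (chartAt (Cn n) x).target :=
    Set.inter_subset_left
  have h1 := hE.represents_eval 1 (hT.smooth_subset he hV) (contDiffOn_of_smoothOn he hU hf)
    (contDiffOn_of_smoothOn he hU hh) ⟨_, hxV⟩
  have h2 := represents_opC1 (hT := hT.smooth_subset he hV) (contDiffOn_of_smoothOn he hU hf)
    (contDiffOn_of_smoothOn he hU hh) ⟨_, hxV⟩
  exact h1.symm.trans h2

theorem represents_starSeries (hE : IsUniversal E) (hT : IsSmoothTensor T)
    (hS : IsLocallySeparated hT) {e : OpenPartialHomeomorph M (Cn n)} (he : IsHolChart e)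
    {V : Opens (Cn n)} (hV : (V : Set (Cn n)) ⊆ e.target) {P Q : ℕ → SmoothAlg V}
    {F H : ℕ → M → ℂ} (hP : ∀ i, Represents (P i) (F i ∘ e.symm))
    (hQ : ∀ i, Represents (Q i) (H i ∘ e.symm)) (k : ℕ) :
    Represents (starCoeff (hT.data he hV).opC P Q k)
      (starSeries (fun r => (E r).toOperator T) F H k ∘ e.symm) := by
  intro z
  simp only [starCoeff, starSeries, Function.comp_apply]
  rw [map_sum]
  refine Finset.sum_congr rfl fun p _ => ?_
  rw [map_sum]
  exact Finset.sum_congr rfl fun q _ =>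
    hE.represents_toOperator hT hS p.1 he hV (hP q.1) (hQ q.2) z

theorem definesStarProduct (hE : IsUniversal E) (hT : IsSmoothTensor T)
    (hS : IsLocallySeparated hT) : DefinesStarProduct E T where
  covariant r _ := hE.isCovariant hT hS r
  separation := hE.hasSeparation
  star :=
    { bidifferential := fun r _ => hE.isBidifferential hT hS r
      zeroth := fun U hU f h _ _ x _ => by
        change (E 0).eval _ _ _ _ = _
        rw [hE.zeroth, RegularOp.eval, Finsupp.sum_single_index (by simp)]
        simp [partials]
      first := fun _ U hU f h hf hh x hx => by
        rw [hE.toOperator_one hT hU hf hh hx, hE.toOperator_one hT hU hh hf hx, bracket_eq,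
          ← mul_assoc, I_mul_I]
        ring
      unit := fun U hU f hf r hr hr3 x hx => by
        -- The constant 1 is both holomorphic and antiholomorphic, so the unit property is a case of
        -- separation of variables.
        have h1 : HolOn n (fun _ : M => (1 : ℂ)) U := mdifferentiableOn_const
        have h2 : HolOn n (fun _ : M => (starRingEnd ℂ) 1) U := mdifferentiableOn_const
        exact hE.hasSeparation U hU _ _ f h1 h2 hf r hr hr3 x hx
      assoc := fun U hU F G H hF hG hH k hk x hx => by
        have he := isHolChart_chartAt (n := n) x
        have hxV := mem_chartOpens (e := chartAt (Cn n) x) hU ⟨hx, mem_chart_source _ x⟩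
        have hV : (chartOpens (chartAt (Cn n) x) hU : Set (Cn n)) ⊆ (chartAt (Cn n) x).target :=
          Set.inter_subset_left
        have rF := fun i => represents_mk (contDiffOn_of_smoothOn he hU (hF i))
        have rG := fun i => represents_mk (contDiffOn_of_smoothOn he hU (hG i))
        have rH := fun i => represents_mk (contDiffOn_of_smoothOn he hU (hH i))
        have l := hE.represents_starSeries hT hS he hV
          (hE.represents_starSeries hT hS he hV rF rG) rH k ⟨_, hxV⟩
        have r := hE.represents_starSeries hT hS he hV rF
          (hE.represents_starSeries hT hS he hV rG rH) k ⟨_, hxV⟩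
        rw [Function.comp_apply, (chartAt (Cn n) x).left_inv (mem_chart_source _ x)] at l r
        rw [← l, ← r, starCoeff_assoc (DiffData.opC_add_left _) (DiffData.opC_add_right _)
          (DiffData.opC_assoc (hS _ he _ hV)) _ _ _ k hk] }

end IsUniversal

/-! ### Kähler manifolds -/

theorem contDiffOn_det {V : Set (Cn n)} {g : Cn n → Matrix (Fin n) (Fin n) ℂ}
    (hg : ∀ k l, ContDiffOn ℝ ∞ (fun z => g z k l) V) :
    ContDiffOn ℝ ∞ (fun z => (g z).det) V := by
  simp only [Matrix.det_apply']
  exact ContDiffOn.sum fun σ _ => contDiffOn_const.mul (contDiffOn_prod fun i _ => hg _ _)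

theorem contDiffOn_inv {V : Set (Cn n)} {g : Cn n → Matrix (Fin n) (Fin n) ℂ}
    (hg : ∀ k l, ContDiffOn ℝ ∞ (fun z => g z k l) V) (hdet : ∀ z ∈ V, (g z).det ≠ 0)
    (l k : Fin n) : ContDiffOn ℝ ∞ (fun z => (g z)⁻¹ l k) V := by
  simp only [Matrix.inv_def, Matrix.smul_apply, Ring.inverse_eq_inv', Matrix.adjugate_apply,
    smul_eq_mul]
  refine ((contDiffOn_det hg).inv hdet).mul (contDiffOn_det fun i j => ?_)
  by_cases h : i = k
  · subst h
    simp only [Matrix.updateRow_self]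
    exact contDiffOn_const
  · simp only [Matrix.updateRow_ne h]
    exact hg i j

section Kahler

variable {M : Type*} [TopologicalSpace M] [ChartedSpace (Cn n) M] {g : ChartTensor n M}

/-- From G⁻¹ Jᵀ G' J̄ = 1, J̄ is invertible from both sides, and moving it to the front exhibits a
left inverse of G'. -/
theorem inverse_transform {G G' J : Matrix (Fin n) (Fin n) ℂ} (hG : IsUnit G.det)
    (h : G = J.transpose * G' * J.map (starRingEnd ℂ)) :
    G'⁻¹ = J.map (starRingEnd ℂ) * G⁻¹ * J.transpose := by
  have h1 : (G⁻¹ * J.transpose * G') * J.map (starRingEnd ℂ) = 1 := by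
    rw [Matrix.mul_assoc, Matrix.mul_assoc, ← Matrix.mul_assoc J.transpose, ← h,
      Matrix.nonsing_inv_mul _ hG]
  have h2 : J.map (starRingEnd ℂ) * (G⁻¹ * J.transpose * G') = 1 := mul_eq_one_comm.1 h1
  refine Matrix.inv_eq_left_inv ?_
  rw [← h2]
  simp only [Matrix.mul_assoc]

theorem isUnit_det (hg : IsKahlerMetric g) {e : OpenPartialHomeomorph M (Cn n)} (he : IsHolChart e)
    {z : Cn n} (hz : z ∈ e.target) : IsUnit (g e z).det :=
  (Matrix.isUnit_iff_isUnit_det _).1 (hg.posDef e he z hz).isUnit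

theorem isSmoothTensor_inverse (hg : IsKahlerMetric g) : IsSmoothTensor (inverseTensor g) where
  smooth e he l k := contDiffOn_inv (hg.smooth e he) (fun z hz => (isUnit_det hg he hz).ne_zero) l k
  transform e e' he he' x hx b a := by
    have h : g e (e x) = (Matrix.of (jacobian e e' x)).transpose * g e' (e' x)
        * (Matrix.of (jacobian e e' x)).map (starRingEnd ℂ) := by
      ext k l
      rw [hg.transform e e' he he' x hx k l, Matrix.mul_apply]
      simp only [Matrix.mul_apply, Matrix.transpose_apply, Matrix.of_apply, Matrix.map_apply,
        Finset.sum_mul]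
      rw [Finset.sum_comm]
      exact Finset.sum_congr rfl fun b _ => Finset.sum_congr rfl fun a _ => by ring
    have h' := congrFun (congrFun (inverse_transform (isUnit_det hg he (e.map_source hx.1)) h) b) a
    rw [inverseTensor, inverseTensor, h', Matrix.mul_apply]
    simp only [Matrix.mul_apply, Matrix.transpose_apply, Matrix.of_apply, Matrix.map_apply,
      Finset.sum_mul]
    rw [Finset.sum_comm]
    exact Finset.sum_congr rfl fun b _ => Finset.sum_congr rfl fun a _ => by ring

theorem isKahler_chart (hg : IsKahlerMetric g) {e : OpenPartialHomeomorph M (Cn n)}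
    (he : IsHolChart e) {V : Opens (Cn n)} (hV : (V : Set (Cn n)) ⊆ e.target) :
    (invData (g := g e) ((isSmoothTensor_inverse hg).smooth_subset he hV)).IsKahler
      (metricA (fun k l => (hg.smooth e he k l).mono hV) _) :=
  isKahler_invData _ _ (fun _ hz => isUnit_det hg he (hV hz))
    fun z hz => hg.closed e he z (hV hz)

theorem isLocallySeparated_inverse [IsManifold 𝓘(ℂ, Cn n) ω M] (hg : IsKahlerMetric g) :
    IsLocallySeparated (isSmoothTensor_inverse hg) :=
  fun _ he _ hV => (isKahler_chart hg he hV).isSeparated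

/-- Closedness of the Kähler form gives the commuting and symmetric derivations in each chart, and
these give the Jacobi identity back. -/
theorem isPoissonBivector_inverse [IsManifold 𝓘(ℂ, Cn n) ω M] (hg : IsKahlerMetric g) :
    IsPoissonBivector (inverseTensor g) where
  smooth := (isSmoothTensor_inverse hg).smooth
  transform := (isSmoothTensor_inverse hg).transform
  jacobi := jacobi_of_isLocallySeparated _ (isLocallySeparated_inverse hg)

end Kahler

end SepVar

end

/-! ### The main theorem: one family of expressions for Kähler and Poisson manifolds -/

theorem mainTheorem3 (n : ℕ) :
    ∃ D : ℕ → RegularOp n,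
      (∀ (M : Type*) [TopologicalSpace M] [ChartedSpace (Cn n) M] [IsManifold 𝓘(ℂ, Cn n) ω M]
        (g : ChartTensor n M), IsKahlerMetric g →
        (∀ e : OpenPartialHomeomorph M (Cn n), IsHolChart e →
          ∀ V : Set (Cn n), IsOpen V → V ⊆ e.target →
            (∀ φ ψ : Cn n → ℂ, ContDiffOn ℝ ∞ φ V → ContDiffOn ℝ ∞ ψ V → ∀ z ∈ V,
              (D 0).eval (inverseTensor g e) φ ψ z = φ z * ψ z ∧
              (D 1).eval (inverseTensor g e) φ ψ z = kahlerC (g e) 1 φ ψ z ∧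
              (D 2).eval (inverseTensor g e) φ ψ z = kahlerC (g e) 2 φ ψ z ∧
              (D 3).eval (inverseTensor g e) φ ψ z = kahlerC3Tilde (g e) φ ψ z) ∧
            (∀ Φ : Cn n → ℂ, ContDiffOn ℝ ∞ Φ V →
              (∀ z ∈ V, ∀ k l, g e z k l = dz k (dzbar l Φ) z) →
              IsStandardUpTo 3 V Φ (kahlerC (g e)))) ∧
        IsPoissonBivector (inverseTensor g) ∧
        DefinesStarProduct D (inverseTensor g)) ∧
      (∀ (M : Type*) [TopologicalSpace M] [ChartedSpace (Cn n) M] [IsManifold 𝓘(ℂ, Cn n) ω M]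
        (T : ChartTensor n M), IsPoissonBivector T →
        (∀ e : OpenPartialHomeomorph M (Cn n), IsHolChart e →
          ∀ V : Set (Cn n), IsOpen V → V ⊆ e.target →
            ∀ φ ψ : Cn n → ℂ, ContDiffOn ℝ ∞ φ V → ContDiffOn ℝ ∞ ψ V → ∀ z ∈ V,
              (D 1).eval (T e) φ ψ z = poissonC1 (T e) φ ψ z ∧
              (D 2).eval (T e) φ ψ z = poissonC2 (T e) φ ψ z) ∧
        DefinesStarProduct D T) := by
  obtain ⟨E, h0, hs, hr⟩ := SepVar.DiffData.exists_regularOp n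
  have hE : SepVar.IsUniversal E := ⟨h0, hs, hr⟩
  refine ⟨E, fun M _ _ _ g hg => ⟨fun e he V hVo hV => ?_, SepVar.isPoissonBivector_inverse hg,
    hE.definesStarProduct _ (SepVar.isLocallySeparated_inverse hg)⟩, fun M _ _ _ T hP => ?_⟩
  · have H := SepVar.isKahler_chart hg he (V := ⟨V, hVo⟩) hV
    refine ⟨fun φ ψ hφ hψ z hz => ?_, fun Φ hΦ hpot => ?_⟩
    · have key := fun r => hE.represents_eval r (V := ⟨V, hVo⟩)
        ((SepVar.isSmoothTensor_inverse hg).smooth_subset he hV) hφ hψ ⟨z, hz⟩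
      have kC := fun r hr => SepVar.represents_opC_kahler _ _ hφ hψ H r hr ⟨z, hz⟩
      exact ⟨(key 0).symm.trans (kC 0 (by norm_num)), (key 1).symm.trans (kC 1 (by norm_num)),
        (key 2).symm.trans (kC 2 le_rfl),
        (key 3).symm.trans (SepVar.represents_opC3_kahler _ _ hφ hψ H ⟨z, hz⟩)⟩
    · exact SepVar.isStandardUpTo _ _ H hΦ hpot
  · have hT : SepVar.IsSmoothTensor T := ⟨hP.smooth, hP.transform⟩
    refine ⟨fun e he V hVo hV φ ψ hφ hψ z hz => ?_,
      hE.definesStarProduct hT (SepVar.isLocallySeparated_of_poisson hP hT)⟩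
    have key := fun r => hE.represents_eval r (V := ⟨V, hVo⟩) (hT.smooth_subset he hV) hφ hψ ⟨z, hz⟩
    exact ⟨(key 1).symm.trans (SepVar.represents_opC1 hφ hψ ⟨z, hz⟩),
      (key 2).symm.trans (SepVar.represents_opC2 _ hφ hψ ⟨z, hz⟩)⟩
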